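/- Let $k$ be a field and let $H$ be a finite-dimensional Hopf algebra over $k$, with comultiplication $\Delta$, counit $\varepsilon$ and (automatically bijective) antipode $S$. A *twist* for a Hopf algebra $A$ over $k$ is an invertible element $J\in A\otimes A$ with $$(\Delta\otimes I)(J)\,J_{12}=(I\otimes\Delta)(J)\,J_{23},\qquad (\varepsilon\otimes I)(J)=(I\otimes\varepsilon)(J)=1 .$$ The twisted Hopf algebra $A^J$ is $A$ as an algebra, with the same counit and with the comultiplication $\Delta^J(x)=J^{-1}\Delta(x)J$. A *quasitriangular Hopf algebra* is a pair $(A,R)$ of a Hopf algebra $A$ and an invertible $R\in A\otimes A$ such that $R\,\Delta(x)=\Delta^{op}(x)\,R$ for all $x\in A$, $(\Delta\otimes I)(R)=R_{13}R_{23}$ and $(I\otimes\Delta)(R)=R_{13}R_{12}$. For a twist $J$ for $A$ put $R^J=J_{21}^{-1}RJ\in A^J\otimes A^J$. An isomorphism of quasitriangular Hopf algebras $(A,R)\to(B,R')$ is an isomorphism of Hopf algebras $f:A\to B$ with $(f\otimes f)(R)=R'$. The *Drinfeld double* $D(H)$ is $H^{*cop}\otimes H$ as a coalgebra, with unit $\varepsilon\otimes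 1$ and the product $$(p\otimes h)(q\otimes g)=\sum p\,q\big(S^{-1}(h_{(3)})\,?\,h_{(1)}\big)\otimes h_{(2)}\,g ,$$ so that $h\mapsto\varepsilon\otimes h$ and $p\mapsto p\otimes 1$ embed $H$ and $H^{*cop}$ as Hopf subalgebras; its $R$-matrix is ${\cal R}=\sum_i h_i\otimes h_i^*\in H\otimes H^{*cop}\subset D(H)\otimes D(H)$, where $\{h_i\}$ and $\{h_i^*\}$ are dual bases of $H$ and $H^*$. **Proposition.** Let $J$ be a twist for $H$, regarded also as a twist for $D(H)$ through $H\subset D(H)$. Write ${\cal R}_{D(H^J)}$ for the $R$-matrix of $D(H^J)$ and ${\cal R}$ for that of $D(H)$. Then $(D(H^J),{\cal R}_{D(H^J)})$ and $(D(H)^J,{\cal R}^J)$ are quasitriangular Hopf algebras, and they are isomorphic as quasitriangular Hopf algebras. -/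

import Mathlib

set_option linter.unusedSectionVars false

namespace QDouble
open scoped TensorProduct
open Coalgebra HopfAlgebra WithConv

section Antipode

variable {k : Type*} {H : Type*} {B : Type*} [Field k] [Ring H] [HopfAlgebra k H]
  [Ring B] [Algebra k B]

theorem conv_antipode (φ : H →ₐ[k] B) :
    toConv φ.toLinearMap * toConv (φ.toLinearMap ∘ₗ antipode k) = 1 := by
  have h := LinearMap.algHom_comp_convMul_distrib (R := k) φ
    (toConv LinearMap.id) (toConv (antipode k (A := H)))
  rw [LinearMap.id_mul_antipode] at h
  apply WithConv.ext
  refine Eq.trans h.symm ?_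
  ext x
  simp [LinearMap.convOne_def]

theorem antipode_conv (φ : H →ₐ[k] B) :
    toConv (φ.toLinearMap ∘ₗ antipode k) * toConv φ.toLinearMap = 1 := by
  have h := LinearMap.algHom_comp_convMul_distrib (R := k) φ
    (toConv (antipode k (A := H))) (toConv LinearMap.id)
  rw [LinearMap.antipode_mul_id] at h
  apply WithConv.ext
  refine Eq.trans h.symm ?_
  ext x
  simp [LinearMap.convOne_def]

/-- `h ↦ h ⊗ 1`. -/
noncomputable abbrev inl (k H : Type*) [Field k] [Ring H] [HopfAlgebra k H] : H →ₐ[k] H ⊗[k] H :=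
  Algebra.TensorProduct.includeLeft

/-- `h ↦ 1 ⊗ h`. -/
noncomputable abbrev inr (k H : Type*) [Field k] [Ring H] [HopfAlgebra k H] : H →ₐ[k] H ⊗[k] H :=
  Algebra.TensorProduct.includeRight

theorem conv_inl_inr (f g : H →ₗ[k] H) :
    toConv ((inl k H).toLinearMap ∘ₗ f) * toConv ((inr k H).toLinearMap ∘ₗ g)
      = toConv (TensorProduct.map f g ∘ₗ comul) := by
  ext x
  rw [(ℛ k x).convMul_apply]
  simp [← (ℛ k x).eq]

theorem comul_antipode_conv :
    toConv (comul ∘ₗ antipode k (A := H)) =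
      toConv ((inr k H).toLinearMap ∘ₗ antipode k) *
        toConv ((inl k H).toLinearMap ∘ₗ antipode k) := by
  refine left_inv_eq_right_inv (a := toConv (comul (R := k) (A := H)))
    (antipode_conv (Bialgebra.comulAlgHom k H)) ?_
  have h := conv_inl_inr (k := k) (H := H) LinearMap.id LinearMap.id
  simp only [LinearMap.comp_id, TensorProduct.map_id, LinearMap.id_comp] at h
  rw [← h]
  calc _ = toConv (inl k H).toLinearMap * (toConv (inr k H).toLinearMap *
          toConv ((inr k H).toLinearMap ∘ₗ antipode k)) *
          toConv ((inl k H).toLinearMap ∘ₗ antipode k) := by simp only [mul_assoc]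
    _ = 1 := by rw [conv_antipode, mul_one, conv_antipode]

/-- The antipode reverses the comultiplication. -/
theorem comul_antipode (h : H) :
    comul (R := k) (antipode k h) =
      TensorProduct.comm k H H (TensorProduct.map (antipode k) (antipode k) (comul h)) := by
  have := congr(($(comul_antipode_conv (k := k) (H := H)) : WithConv _) h)
  rw [(ℛ k h).convMul_apply] at this
  simpa [← (ℛ k h).eq] using this

theorem comul_antipode_sum (h : H) :
    comul (R := k) (antipode k h) =
      ∑ i ∈ (ℛ k h).index, ((1 : H) ⊗ₜ[k] antipode k ((ℛ k h).left i)) *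
        (antipode k ((ℛ k h).right i) ⊗ₜ[k] (1 : H)) := by
  rw [comul_antipode, ← (ℛ k h).eq]
  simp

/-- `h₁ S(h₂) ⊗ h₃ = 1 ⊗ h`. -/
theorem sum_antipode_left (h : H) :
    ∑ i ∈ (ℛ k h).index, (((ℛ k h).left i) ⊗ₜ[k] (1 : H)) *
      TensorProduct.map (antipode k) LinearMap.id (comul ((ℛ k h).right i)) = 1 ⊗ₜ h := by
  have e : toConv (inl k H).toLinearMap *
      toConv (TensorProduct.map (antipode k) LinearMap.id ∘ₗ comul) =
      toConv (inr k H).toLinearMap := by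
    rw [← conv_inl_inr, ← mul_assoc, conv_antipode, one_mul, LinearMap.comp_id]
  have := congr(($e : WithConv _) h)
  rw [(ℛ k h).convMul_apply] at this
  simpa using this

/-- `S(h₃) ⊗ h₁ S(h₂) = S(h) ⊗ 1`. -/
theorem sum_comul_antipode (h : H) :
    ∑ i ∈ (ℛ k h).index, ((1 : H) ⊗ₜ[k] ((ℛ k h).left i)) *
      comul (antipode k ((ℛ k h).right i)) = antipode k h ⊗ₜ 1 := by
  have e : toConv (inr k H).toLinearMap * toConv (comul ∘ₗ antipode k (A := H)) =
      toConv ((inl k H).toLinearMap ∘ₗ antipode k) := by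
    rw [comul_antipode_conv, ← mul_assoc, conv_antipode, one_mul]
  have := congr(($e : WithConv _) h)
  rw [(ℛ k h).convMul_apply] at this
  simpa using this

theorem comm_map_antipode_mul (u v : H ⊗[k] H) :
    TensorProduct.comm k H H (TensorProduct.map (antipode k) (antipode k) (u * v)) =
      TensorProduct.comm k H H (TensorProduct.map (antipode k) (antipode k) v) *
      TensorProduct.comm k H H (TensorProduct.map (antipode k) (antipode k) u) := by
  induction u with
  | zero => simp
  | add u₁ u₂ h₁ h₂ => simp only [add_mul, map_add, mul_add, h₁, h₂]
  | tmul a b =>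
    induction v with
    | zero => simp
    | add u₁ u₂ h₁ h₂ => simp only [add_mul, map_add, mul_add, h₁, h₂]
    | tmul c d => simp [antipode_mul_antidistrib]

/-- `S²(h₂) S(h₁) ⊗ S²(h₃) = 1 ⊗ S²(h)`. -/
theorem sum_comul_antipode_sq (h : H) :
    ∑ i ∈ (ℛ k h).index, comul (R := k) (antipode k (antipode k ((ℛ k h).right i))) *
      (antipode k ((ℛ k h).left i) ⊗ₜ[k] (1 : H)) = 1 ⊗ₜ antipode k (antipode k h) := by
  have := congr(TensorProduct.comm k H H (TensorProduct.map (antipode k) (antipode k)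
    $(sum_comul_antipode (k := k) h)))
  rw [map_sum, map_sum] at this
  simp only [comm_map_antipode_mul, ← comul_antipode] at this
  simpa using this

/-- The right translation `y ↦ p(y₁) y₂`. -/
noncomputable def rightHit (p : Module.Dual k H) : H →ₗ[k] H :=
  (TensorProduct.lid k H).toLinearMap ∘ₗ TensorProduct.map p LinearMap.id ∘ₗ comul

/-- The left translation `y ↦ y₁ p(y₂)`. -/
noncomputable def leftHit (p : Module.Dual k H) : H →ₗ[k] H :=
  (TensorProduct.rid k H).toLinearMap ∘ₗ TensorProduct.map LinearMap.id p ∘ₗ comul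

theorem leftHit_rightHit (p q : Module.Dual k H) :
    leftHit q ∘ₗ rightHit p = rightHit p ∘ₗ leftHit q := by
  ext y
  let Ω : H ⊗[k] (H ⊗[k] H) →ₗ[k] H :=
    (TensorProduct.lid k H).toLinearMap ∘ₗ TensorProduct.map p
      ((TensorProduct.rid k H).toLinearMap ∘ₗ TensorProduct.map LinearMap.id q)
  have h1 : ∀ t : H ⊗[k] H,
      leftHit q (TensorProduct.lid k H (TensorProduct.map p LinearMap.id t)) =
        Ω (comul.lTensor H t) := by
    intro t
    induction t with
    | zero => simp
    | add u v hu hv => simp only [map_add, hu, hv]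
    | tmul a b => simp [Ω, leftHit]
  have h2 : ∀ t : H ⊗[k] H,
      rightHit p (TensorProduct.rid k H (TensorProduct.map LinearMap.id q t)) =
        Ω (TensorProduct.assoc k H H H (comul.rTensor H t)) := by
    intro t
    induction t with
    | zero => simp
    | add u v hu hv => simp only [map_add, hu, hv]
    | tmul a b =>
      simp only [TensorProduct.map_tmul, LinearMap.id_coe, id_eq, TensorProduct.rid_tmul,
        map_smul, rightHit, LinearMap.comp_apply, LinearMap.rTensor_tmul, LinearEquiv.coe_coe]
      generalize comul (R := k) a = s
      induction s with
      | zero => simp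
      | add u v hu hv => simp only [map_add, hu, hv, TensorProduct.add_tmul, smul_add]
      | tmul c d => simp [Ω, smul_smul, mul_comm]
  have e1 := h1 (comul y)
  have e2 := h2 (comul y)
  rw [coassoc_apply] at e2
  exact e1.trans e2.symm

variable [FiniteDimensional k H]

/-- An operator commuting with right translations produces a left integral. -/
theorem trace_integral (T : H →ₗ[k] H) (hT : ∀ p, T ∘ₗ rightHit p = rightHit p ∘ₗ T)
    (p : Module.Dual k H) (x : H) :
    LinearMap.trace k H (LinearMap.mulLeft k (rightHit p x) ∘ₗ antipode k ∘ₗ antipode k ∘ₗ T) =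
      p 1 * LinearMap.trace k H (LinearMap.mulLeft k x ∘ₗ antipode k ∘ₗ antipode k ∘ₗ T) := by
  obtain ⟨w, hw⟩ := (TensorProduct.dualDistribEquiv k H H).surjective (p ∘ₗ LinearMap.mul' k H)
  obtain ⟨s, rfl⟩ := TensorProduct.exists_finset w
  replace hw : ∀ a b, ∑ i ∈ s, i.1 a * i.2 b = p (a * b) := by
    intro a b
    have := congr($hw (a ⊗ₜ b))
    simpa using this
  have key : LinearMap.mulLeft k (rightHit p x) ∘ₗ antipode k ∘ₗ antipode k =
      ∑ i ∈ s, rightHit i.1 ∘ₗ (LinearMap.mulLeft k x ∘ₗ antipode k ∘ₗ antipode k) ∘ₗ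
        rightHit (i.2 ∘ₗ antipode k) := by
    ext y
    have h1 : ∀ (c : H) (t : H ⊗[k] H), ∑ i ∈ s, i.2 c •
        TensorProduct.lid k H (TensorProduct.map i.1 LinearMap.id t) =
        TensorProduct.lid k H (TensorProduct.map p LinearMap.id (t * (c ⊗ₜ 1))) := by
      intro c t
      induction t with
      | zero => simp
      | add u v hu hv => simp only [map_add, hu, hv, add_mul, smul_add, Finset.sum_add_distrib]
      | tmul a b => simp [← hw, smul_smul, Finset.sum_smul, mul_comm]
    have h2 : ∀ q : Module.Dual k H, rightHit q y =
        ∑ j ∈ (ℛ k y).index, q ((ℛ k y).left j) • (ℛ k y).right j := by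
      intro q
      simp [rightHit, ← (ℛ k y).eq]
    have h3 := congr(TensorProduct.lid k H (TensorProduct.map p LinearMap.id
      (comul x * $(sum_comul_antipode_sq (k := k) y))))
    simp only [Finset.mul_sum, ← mul_assoc, ← Bialgebra.comul_mul, map_sum, ← h1] at h3
    have h4 : TensorProduct.lid k H (TensorProduct.map p LinearMap.id
        (comul x * ((1 : H) ⊗ₜ[k] antipode k (antipode k y)))) =
        rightHit p x * antipode k (antipode k y) := by
      rw [rightHit, LinearMap.comp_apply, LinearMap.comp_apply]
      generalize comul (R := k) x = t
      induction t with
      | zero => simp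
      | add u v hu hv => simp only [map_add, add_mul, hu, hv]
      | tmul a b => simp
    rw [h4] at h3
    simp only [LinearMap.comp_apply, LinearMap.mulLeft_apply, LinearMap.sum_apply, ← h3, h2,
      map_sum, map_smul]
    rw [Finset.sum_comm]
    simp [rightHit]
  have key2 : ∑ i ∈ s, rightHit (i.2 ∘ₗ antipode k) ∘ₗ rightHit i.1 =
      p 1 • (LinearMap.id : H →ₗ[k] H) := by
    ext y
    have h1 : ∀ (c : H) (t : H ⊗[k] H), ∑ i ∈ s, i.1 c •
        TensorProduct.lid k H (TensorProduct.map (i.2 ∘ₗ antipode k) LinearMap.id t) =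
        TensorProduct.lid k H (TensorProduct.map p LinearMap.id
          ((c ⊗ₜ 1) * TensorProduct.map (antipode k) LinearMap.id t)) := by
      intro c t
      induction t with
      | zero => simp
      | add u v hu hv => simp only [map_add, hu, hv, mul_add, smul_add, Finset.sum_add_distrib]
      | tmul a b => simp [← hw, smul_smul, Finset.sum_smul]
    have h3 := congr(TensorProduct.lid k H (TensorProduct.map p LinearMap.id
      $(sum_antipode_left (k := k) y)))
    simp only [map_sum, ← h1] at h3
    have h2 : ∀ q : Module.Dual k H, rightHit q y =
        ∑ j ∈ (ℛ k y).index, q ((ℛ k y).left j) • (ℛ k y).right j := by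
      intro q
      simp [rightHit, ← (ℛ k y).eq]
    simp only [LinearMap.sum_apply, LinearMap.comp_apply, h2, map_sum, map_smul]
    rw [Finset.sum_comm]
    simpa [rightHit] using h3
  have hT' : ∀ q z, T (rightHit q z) = rightHit q (T z) := fun q z => congr($(hT q) z)
  have e1 : LinearMap.mulLeft k (rightHit p x) ∘ₗ antipode k ∘ₗ antipode k ∘ₗ T =
      (LinearMap.mulLeft k (rightHit p x) ∘ₗ antipode k ∘ₗ antipode k) ∘ₗ T := rfl
  have e2 : ∀ i : Module.Dual k H × Module.Dual k H, LinearMap.trace k H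
      ((rightHit i.1 ∘ₗ (LinearMap.mulLeft k x ∘ₗ antipode k ∘ₗ antipode k) ∘ₗ
        rightHit (i.2 ∘ₗ antipode k)) ∘ₗ T) = LinearMap.trace k H
      ((LinearMap.mulLeft k x ∘ₗ antipode k ∘ₗ antipode k ∘ₗ T) ∘ₗ
        (rightHit (i.2 ∘ₗ antipode k) ∘ₗ rightHit i.1)) := by
    intro i
    rw [LinearMap.comp_assoc, LinearMap.trace_comp_comm']
    congr 1
    ext z
    simp only [LinearMap.comp_apply]
    rw [hT', hT', hT']
  have e3 : ∀ F : Module.Dual k H × Module.Dual k H → H →ₗ[k] H,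
      (∑ i ∈ s, F i) ∘ₗ T = ∑ i ∈ s, F i ∘ₗ T := fun F => by ext; simp
  have e4 : ∀ (G : H →ₗ[k] H) (F : Module.Dual k H × Module.Dual k H → H →ₗ[k] H),
      ∑ i ∈ s, G ∘ₗ F i = G ∘ₗ ∑ i ∈ s, F i := fun G F => by ext; simp
  rw [e1, key, e3, map_sum, Finset.sum_congr rfl (fun i _ => e2 i), ← map_sum,
    e4, key2]
  simp [LinearMap.comp_smul]

/-- A finite-dimensional Hopf algebra has a nonzero left integral in its dual. -/
theorem exists_integral : ∃ l : Module.Dual k H, l ≠ 0 ∧ ∀ x, leftHit l x = l x • (1 : H) := by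
  let lam (T : H →ₗ[k] H) : Module.Dual k H :=
    LinearMap.trace k H ∘ₗ LinearMap.lcomp k H (antipode k ∘ₗ antipode k ∘ₗ T) ∘ₗ LinearMap.mul k H
  have hlam : ∀ T x, lam T x =
    LinearMap.trace k H (LinearMap.mulLeft k x ∘ₗ antipode k ∘ₗ antipode k ∘ₗ T) := fun _ _ => rfl
  have hint : ∀ q x, leftHit (lam (leftHit q)) x = lam (leftHit q) x • (1 : H) := by
    intro q x
    rw [← sub_eq_zero, ← Module.forall_dual_apply_eq_zero_iff k]
    intro p
    have h := trace_integral (leftHit q) (fun p => leftHit_rightHit p q) p x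
    rw [← hlam, ← hlam] at h
    rw [map_sub, sub_eq_zero, map_smul, smul_eq_mul, mul_comm, ← h]
    simp [leftHit, rightHit, ← (ℛ k x).eq, mul_comm]
  by_contra hne
  push Not at hne
  have h0 : ∀ q, lam (leftHit q) = 0 := by
    intro q
    by_contra hq
    obtain ⟨x, hx⟩ := hne _ hq
    exact hx (hint q x)
  let b := Module.finBasis k H
  have key : ∑ i, LinearMap.mulLeft k (antipode k (b i)) ∘ₗ antipode k ∘ₗ antipode k ∘ₗ
      leftHit (b.coord i) = Algebra.linearMap k H ∘ₗ counit := by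
    ext y
    have h1 : ∀ t : H ⊗[k] H, ∑ i, antipode k (b i) * antipode k (antipode k
        (TensorProduct.rid k H (TensorProduct.map LinearMap.id (b.coord i) t))) =
        antipode k (LinearMap.mul' k H (TensorProduct.map (antipode k) LinearMap.id t)) := by
      intro t
      induction t with
      | zero => simp
      | add u v hu hv => simp only [map_add, mul_add, Finset.sum_add_distrib, hu, hv]
      | tmul c d =>
        simp only [TensorProduct.map_tmul, LinearMap.id_coe, id_eq, TensorProduct.rid_tmul,
          map_smul, LinearMap.mul'_apply, antipode_mul_antidistrib]
        conv_rhs => rw [← b.sum_repr d]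
        simp only [map_sum, map_smul, Finset.sum_mul, smul_mul_assoc, mul_smul_comm,
          Module.Basis.coord_apply]
    have h2 := mul_antipode_rTensor_comul_apply (R := k) y
    rw [LinearMap.rTensor_def] at h2
    have h3 := h1 (comul y)
    rw [h2] at h3
    simpa [leftHit, Algebra.algebraMap_eq_smul_one] using h3
  have htr := congr(LinearMap.trace k H $key)
  rw [map_sum] at htr
  have h5 : ∀ i, LinearMap.trace k H (LinearMap.mulLeft k (antipode k (b i)) ∘ₗ antipode k ∘ₗ
      antipode k ∘ₗ leftHit (b.coord i)) = 0 := fun i => by rw [← hlam, h0]; rfl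
  rw [Finset.sum_congr rfl (fun i _ => h5 i), LinearMap.trace_comp_comm'] at htr
  have h6 : (counit ∘ₗ Algebra.linearMap k H : k →ₗ[k] k) = LinearMap.id := by
    ext; simp
  rw [h6] at htr
  simp at htr

/-- `x₁ l(x₂ S(h)) = l(x S(h₁)) h₂` -/
theorem antipode_injective : Function.Injective (antipode k (A := H)) := by
  obtain ⟨l, hl0, hl⟩ := exists_integral (k := k) (H := H)
  rw [injective_iff_map_eq_zero]
  intro h hh
  let om : H ⊗[k] H →ₗ[k] H :=
    (TensorProduct.rid k H).toLinearMap ∘ₗ TensorProduct.map LinearMap.id l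
  have hom : ∀ (t : H ⊗[k] H) (c : H), om (t * (c ⊗ₜ 1)) = om t * c := by
    intro t c
    induction t with
    | zero => simp
    | add u v hu hv => simp only [map_add, hu, hv, add_mul]
    | tmul a b => simp [om]
  have h1 : ∀ x : H, ∑ i ∈ (ℛ k h).index, l (x * antipode k ((ℛ k h).left i)) • (ℛ k h).right i
      = 0 := by
    intro x
    let A : H →ₗ[k] H := om ∘ₗ LinearMap.mulLeft k (comul x) ∘ₗ (inr k H).toLinearMap ∘ₗ antipode k
    let Bm : H →ₗ[k] H := Algebra.linearMap k H ∘ₗ l ∘ₗ LinearMap.mulLeft k x ∘ₗ antipode k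
    have e : toConv A * toConv (antipode k) = toConv Bm := by
      ext y
      rw [(ℛ k y).convMul_apply]
      have : l (x * antipode k y) • (1 : H) = om (comul x * comul (antipode k y)) := by
        rw [← Bialgebra.comul_mul, ← hl]; rfl
      rw [comul_antipode_sum, Finset.mul_sum, map_sum] at this
      simp only [← mul_assoc, hom] at this
      simpa [A, Bm, Algebra.algebraMap_eq_smul_one] using this.symm
    have e2 : toConv A = toConv Bm * toConv LinearMap.id := by
      rw [← e, mul_assoc, LinearMap.antipode_mul_id, mul_one]
    have e3 := congr(($e2 : WithConv _) h)
    rw [(ℛ k h).convMul_apply] at e3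
    simpa [A, Bm, hh, Algebra.algebraMap_eq_smul_one] using e3.symm
  let th : Module.Dual k H ⊗[k] H :=
    ∑ i ∈ (ℛ k h).index, (l ∘ₗ (LinearMap.mulRight k (antipode k ((ℛ k h).left i)))) ⊗ₜ
      (ℛ k h).right i
  have hth : th = 0 := by
    apply (dualTensorHomEquiv k H H).injective
    ext x
    simpa [th, dualTensorHomEquiv] using h1 x
  by_contra hne
  apply hl0
  ext x
  let La : H ⊗[k] H →ₗ[k] H := (TensorProduct.lid k H).toLinearMap ∘ₗ
    TensorProduct.map (l ∘ₗ LinearMap.mulLeft k x ∘ₗ antipode k) LinearMap.id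
  let Ga : Module.Dual k H ⊗[k] H →ₗ[k] H := TensorProduct.lift
    (LinearMap.mk₂ k (fun f y => (TensorProduct.lid k H)
      (TensorProduct.map (f ∘ₗ LinearMap.mulLeft k x ∘ₗ antipode k ∘ₗ antipode k)
        LinearMap.id (comul y)))
      (fun f g y => by
        simp [LinearMap.add_comp, TensorProduct.map_add_left])
      (fun c f y => by
        simp [LinearMap.smul_comp, TensorProduct.map_smul_left])
      (fun f y z => by simp) (fun c f y => by simp))
  have h2 : ∀ (f : Module.Dual k H) (a : H) (t : H ⊗[k] H),
    TensorProduct.lid k H (TensorProduct.map ((l ∘ₗ LinearMap.mulRight k (antipode k a)) ∘ₗ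
      LinearMap.mulLeft k x ∘ₗ antipode k ∘ₗ antipode k) LinearMap.id t) =
      La ((a ⊗ₜ 1) * TensorProduct.map (antipode k) LinearMap.id t) := by
    intro f a t
    induction t with
    | zero => simp
    | add u v hu hv => simp only [map_add, hu, hv, mul_add]
    | tmul b c => simp [La, antipode_mul_antidistrib, mul_assoc]
  have h3 := congr(La $(sum_antipode_left (k := k) h))
  have h4 := congr(Ga $hth)
  simp only [th, map_sum, map_zero, Ga, TensorProduct.lift.tmul, LinearMap.mk₂_apply,
    h2 l] at h4
  rw [map_sum, h4] at h3
  have : l x • h = 0 := by simpa [La] using h3.symm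
  exact (smul_eq_zero.mp this).resolve_right hne

theorem antipode_bijective : Function.Bijective (antipode k (A := H)) :=
  ⟨antipode_injective, LinearMap.injective_iff_surjective.mp antipode_injective⟩

end Antipode

section AntipodeInv

variable {k : Type*} {H : Type*} [Field k] [Ring H] [HopfAlgebra k H] [FiniteDimensional k H]

/-- The inverse `S⁻¹` of the antipode of a finite-dimensional Hopf algebra. -/
noncomputable def antipodeInv (k H : Type*) [Field k] [Ring H] [HopfAlgebra k H]
    [FiniteDimensional k H] : H →ₗ[k] H :=
  (LinearEquiv.ofBijective (antipode k (A := H)) antipode_bijective).symm.toLinearMap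

@[simp] theorem antipode_antipodeInv (x : H) : antipode k (antipodeInv k H x) = x :=
  (LinearEquiv.ofBijective (antipode k (A := H)) antipode_bijective).apply_symm_apply x

@[simp] theorem antipodeInv_antipode (x : H) : antipodeInv k H (antipode k x) = x :=
  (LinearEquiv.ofBijective (antipode k (A := H)) antipode_bijective).symm_apply_apply x

theorem antipodeInv_mul (x y : H) :
    antipodeInv k H (x * y) = antipodeInv k H y * antipodeInv k H x := by
  apply antipode_injective (k := k)
  simp [antipode_mul_antidistrib]

@[simp] theorem antipodeInv_one : antipodeInv k H 1 = 1 := by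
  apply antipode_injective (k := k)
  simp

theorem comul_antipodeInv (x : H) : comul (R := k) (antipodeInv k H x) =
    TensorProduct.comm k H H (TensorProduct.map (antipodeInv k H) (antipodeInv k H)
      (comul x)) := by
  have h := comul_antipode (k := k) (antipodeInv k H x)
  rw [antipode_antipodeInv] at h
  rw [h]
  generalize comul (R := k) (antipodeInv k H x) = t
  induction t with
  | zero => simp
  | add u v hu hv => simpa only [map_add] using congr($hu + $hv)
  | tmul a b => simp

theorem counit_antipodeInv (x : H) : counit (R := k) (antipodeInv k H x) = counit (R := k) x := by
  conv_rhs => rw [← antipode_antipodeInv (k := k) x, counit_antipode]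

theorem sum_right_mul_antipodeInv_left (x : H) :
    ∑ i ∈ (ℛ k x).index, (ℛ k x).right i * antipodeInv k H ((ℛ k x).left i) =
      algebraMap k H (counit x) := by
  apply antipode_injective (k := k)
  simp [antipode_mul_antidistrib, sum_mul_antipode_eq_algebraMap_counit,
    Algebra.algebraMap_eq_smul_one]

theorem sum_antipodeInv_right_mul_left (x : H) :
    ∑ i ∈ (ℛ k x).index, antipodeInv k H ((ℛ k x).right i) * (ℛ k x).left i =
      algebraMap k H (counit x) := by
  apply antipode_injective (k := k)
  simp [antipode_mul_antidistrib, sum_antipode_mul_eq_algebraMap_counit,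
    Algebra.algebraMap_eq_smul_one]

end AntipodeInv

/-- The underlying space of the Hopf algebra `H^{*cop}`: the linear dual of `H`, with the
convolution product `(p q)(x) = p(x₁) q(x₂)` and unit `ε`. -/
def DualCop (k H : Type*) [Field k] [Ring H] [HopfAlgebra k H] : Type _ :=
  WithConv (H →ₗ[k] k)

namespace DualCop

section Basic

variable {k : Type*} {H : Type*} [Field k] [Ring H] [HopfAlgebra k H]

noncomputable instance : Ring (DualCop k H) := inferInstanceAs (Ring (WithConv (H →ₗ[k] k)))

noncomputable instance : Algebra k (DualCop k H) :=
  inferInstanceAs (Algebra k (WithConv (H →ₗ[k] k)))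

/-- An element of `H^{*cop}` as a functional on `H`. -/
noncomputable def toDual (k H : Type*) [Field k] [Ring H] [HopfAlgebra k H] :
    DualCop k H ≃ₗ[k] Module.Dual k H :=
  WithConv.linearEquiv k (H →ₗ[k] k)

theorem toDual_mul (p q : DualCop k H) (x : H) : toDual k H (p * q) x =
    ∑ i ∈ (ℛ k x).index,
      toDual k H p ((ℛ k x).left i) * toDual k H q ((ℛ k x).right i) :=
  (ℛ k x).convMul_apply _ _

theorem toDual_mul' (p q : DualCop k H) (x : H) : toDual k H (p * q) x =
    TensorProduct.dualDistrib k H H (toDual k H p ⊗ₜ toDual k H q) (comul x) := by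
  rw [toDual_mul]
  conv_rhs => rw [← (ℛ k x).eq]
  simp

@[simp] theorem toDual_one (x : H) : toDual k H 1 x = counit x := rfl

theorem ext' {p q : DualCop k H} (h : ∀ x, toDual k H p x = toDual k H q x) : p = q :=
  (toDual k H).injective (LinearMap.ext h)

end Basic

section Finite

variable {k : Type*} {H : Type*} [Field k] [Ring H] [HopfAlgebra k H] [FiniteDimensional k H]

instance : FiniteDimensional k (DualCop k H) := (toDual k H).symm.finiteDimensional

/-- The pairing of `H^* ⊗ H^*` with `H ⊗ H`: `⟨p ⊗ q, x ⊗ y⟩ = p(x) q(y)`. -/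
noncomputable def pair₂ (k H : Type*) [Field k] [Ring H] [HopfAlgebra k H]
    [FiniteDimensional k H] : DualCop k H ⊗[k] DualCop k H ≃ₗ[k] Module.Dual k (H ⊗[k] H) :=
  TensorProduct.congr (toDual k H) (toDual k H) ≪≫ₗ TensorProduct.dualDistribEquiv k H H

@[simp] theorem pair₂_tmul (p q : DualCop k H) (x y : H) :
    pair₂ k H (p ⊗ₜ q) (x ⊗ₜ y) = toDual k H p x * toDual k H q y := by
  simp [pair₂]

/-- The co-opposite of the comultiplication dual to the multiplication of `H`: if
`Δ(p) = p₁ ⊗ p₂` then `p₁(x) p₂(y) = p(y x)`. -/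
noncomputable instance : CoalgebraStruct k (DualCop k H) where
  comul := (pair₂ k H).symm.toLinearMap ∘ₗ
    (LinearMap.mul' k H ∘ₗ (TensorProduct.comm k H H).toLinearMap).dualMap ∘ₗ
      (toDual k H).toLinearMap
  counit := LinearMap.applyₗ (1 : H) ∘ₗ (toDual k H).toLinearMap

theorem pair₂_comul (p : DualCop k H) (x y : H) :
    pair₂ k H (comul p) (x ⊗ₜ y) = toDual k H p (y * x) := by
  simp [comul]

theorem counit_apply (p : DualCop k H) : counit (R := k) p = toDual k H p 1 := rfl

/-- The pairing of `H^* ⊗ (H^* ⊗ H^*)` with `H ⊗ (H ⊗ H)`. -/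
noncomputable def pair₃ (k H : Type*) [Field k] [Ring H] [HopfAlgebra k H]
    [FiniteDimensional k H] : DualCop k H ⊗[k] (DualCop k H ⊗[k] DualCop k H) ≃ₗ[k]
      Module.Dual k (H ⊗[k] (H ⊗[k] H)) :=
  TensorProduct.congr (toDual k H) (pair₂ k H) ≪≫ₗ
    TensorProduct.dualDistribEquiv k H (H ⊗[k] H)

theorem pair₃_tmul (p : DualCop k H) (t : DualCop k H ⊗[k] DualCop k H) (x : H)
    (s : H ⊗[k] H) : pair₃ k H (p ⊗ₜ t) (x ⊗ₜ s) = toDual k H p x * pair₂ k H t s := by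
  simp [pair₃]

noncomputable instance : Coalgebra k (DualCop k H) where
  coassoc := by
    ext p
    apply (pair₃ k H).injective
    ext x y z
    have h1 : ∀ t : DualCop k H ⊗[k] DualCop k H,
        pair₃ k H (TensorProduct.assoc k _ _ _ (comul.rTensor _ t)) (x ⊗ₜ (y ⊗ₜ z)) =
          pair₂ k H t ((y * x) ⊗ₜ z) := by
      intro t
      induction t with
      | zero => simp
      | add u v hu hv => simp only [map_add, LinearMap.add_apply, hu, hv]
      | tmul a b =>
        rw [LinearMap.rTensor_tmul, pair₂_tmul, ← pair₂_comul]
        generalize comul (R := k) a = s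
        induction s with
        | zero => simp
        | add u v hu hv => simp only [map_add, LinearMap.add_apply, hu, hv,
            TensorProduct.add_tmul, add_mul]
        | tmul c d => simp [pair₃_tmul, mul_assoc]
    have h2 : ∀ t : DualCop k H ⊗[k] DualCop k H,
        pair₃ k H (comul.lTensor _ t) (x ⊗ₜ (y ⊗ₜ z)) = pair₂ k H t (x ⊗ₜ (z * y)) := by
      intro t
      induction t with
      | zero => simp
      | add u v hu hv => simp only [map_add, LinearMap.add_apply, hu, hv]
      | tmul a b => rw [LinearMap.lTensor_tmul, pair₃_tmul, pair₂_tmul, ← pair₂_comul]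
    have e1 := h1 (comul p)
    have e2 := h2 (comul p)
    rw [pair₂_comul] at e1 e2
    rw [← mul_assoc] at e1
    exact e1.trans e2.symm
  rTensor_counit_comp_comul := by
    ext p
    apply (TensorProduct.lid k (DualCop k H)).injective
    apply ext'
    intro x
    have h1 : ∀ t : DualCop k H ⊗[k] DualCop k H,
        toDual k H (TensorProduct.lid k _ (counit.rTensor _ t)) x = pair₂ k H t (1 ⊗ₜ x) := by
      intro t
      induction t with
      | zero => simp
      | add u v hu hv => simp only [map_add, LinearMap.add_apply, hu, hv]
      | tmul a b => simp [counit_apply]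
    have e := h1 (comul p)
    rw [pair₂_comul] at e
    simpa using e
  lTensor_counit_comp_comul := by
    ext p
    apply (TensorProduct.rid k (DualCop k H)).injective
    apply ext'
    intro x
    have h1 : ∀ t : DualCop k H ⊗[k] DualCop k H,
        toDual k H (TensorProduct.rid k _ (counit.lTensor _ t)) x = pair₂ k H t (x ⊗ₜ 1) := by
      intro t
      induction t with
      | zero => simp
      | add u v hu hv => simp only [map_add, LinearMap.add_apply, hu, hv]
      | tmul a b => simp [counit_apply, mul_comm]
    have e := h1 (comul p)
    rw [pair₂_comul] at e
    simpa using e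

theorem pair₂_mul (u v : DualCop k H ⊗[k] DualCop k H) (x y : H) :
    pair₂ k H (u * v) (x ⊗ₜ y) = ∑ i ∈ (ℛ k x).index, ∑ j ∈ (ℛ k y).index,
      pair₂ k H u ((ℛ k x).left i ⊗ₜ (ℛ k y).left j) *
        pair₂ k H v ((ℛ k x).right i ⊗ₜ (ℛ k y).right j) := by
  induction u with
  | zero => simp
  | add u₁ u₂ h₁ h₂ => simp only [map_add, LinearMap.add_apply, add_mul, h₁, h₂,
      Finset.sum_add_distrib]
  | tmul a b =>
    induction v with
    | zero => simp
    | add u₁ u₂ h₁ h₂ => simp only [map_add, LinearMap.add_apply, mul_add, h₁, h₂,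
        Finset.sum_add_distrib]
    | tmul c d =>
      simp only [Algebra.TensorProduct.tmul_mul_tmul, pair₂_tmul, toDual_mul, Finset.sum_mul_sum]
      refine Finset.sum_congr rfl fun i _ => Finset.sum_congr rfl fun j _ => by ring

noncomputable instance : Bialgebra k (DualCop k H) :=
  Bialgebra.mk' k (DualCop k H)
    (by rw [counit_apply, toDual_one, Bialgebra.counit_one])
    (by
      intro p q
      rw [counit_apply, counit_apply, counit_apply, toDual_mul', Bialgebra.comul_one,
        Algebra.TensorProduct.one_def]
      simp)
    (by
      apply (pair₂ k H).injective
      ext x y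
      simp only [TensorProduct.AlgebraTensorModule.curry_apply, TensorProduct.curry_apply,
        LinearMap.restrictScalars_self]
      rw [pair₂_comul, Algebra.TensorProduct.one_def, pair₂_tmul]
      simp [mul_comm])
    (by
      intro p q
      apply (pair₂ k H).injective
      ext x y
      simp only [TensorProduct.AlgebraTensorModule.curry_apply, TensorProduct.curry_apply,
        LinearMap.restrictScalars_self]
      rw [pair₂_comul, pair₂_mul, toDual_mul', Bialgebra.comul_mul]
      simp only [pair₂_comul]
      conv_lhs => rw [← (ℛ k x).eq, ← (ℛ k y).eq]
      simp [Finset.mul_sum, Finset.sum_mul]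
      try rw [Finset.sum_comm])

/-- The antipode of `H^{*cop}` is `p ↦ p ∘ S⁻¹`. -/
noncomputable instance : HopfAlgebra k (DualCop k H) where
  antipode := (toDual k H).symm.toLinearMap ∘ₗ (antipodeInv k H).dualMap ∘ₗ
    (toDual k H).toLinearMap
  mul_antipode_rTensor_comul := by
    ext p
    apply ext'
    intro x
    have h1 : ∀ t : DualCop k H ⊗[k] DualCop k H,
        toDual k H (LinearMap.mul' k _ (((toDual k H).symm.toLinearMap ∘ₗ
          (antipodeInv k H).dualMap ∘ₗ (toDual k H).toLinearMap).rTensor _ t)) x =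
        ∑ i ∈ (ℛ k x).index,
          pair₂ k H t (antipodeInv k H ((ℛ k x).left i) ⊗ₜ (ℛ k x).right i) := by
      intro t
      induction t with
      | zero => simp
      | add u v hu hv => simp only [map_add, LinearMap.add_apply, hu, hv, Finset.sum_add_distrib]
      | tmul a b => simp [toDual_mul]
    refine (h1 (comul p)).trans ?_
    simp only [pair₂_comul]
    rw [← map_sum, sum_right_mul_antipodeInv_left]
    simp [Algebra.algebraMap_eq_smul_one, counit_apply, mul_comm]
  mul_antipode_lTensor_comul := by
    ext p
    apply ext'
    intro x
    have h1 : ∀ t : DualCop k H ⊗[k] DualCop k H,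
        toDual k H (LinearMap.mul' k _ (((toDual k H).symm.toLinearMap ∘ₗ
          (antipodeInv k H).dualMap ∘ₗ (toDual k H).toLinearMap).lTensor _ t)) x =
        ∑ i ∈ (ℛ k x).index,
          pair₂ k H t ((ℛ k x).left i ⊗ₜ antipodeInv k H ((ℛ k x).right i)) := by
      intro t
      induction t with
      | zero => simp
      | add u v hu hv => simp only [map_add, LinearMap.add_apply, hu, hv, Finset.sum_add_distrib]
      | tmul a b => simp [toDual_mul]
    refine (h1 (comul p)).trans ?_
    simp only [pair₂_comul]
    rw [← map_sum, sum_antipodeInv_right_mul_left]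
    simp [Algebra.algebraMap_eq_smul_one, counit_apply, mul_comm]

theorem toDual_antipode (p : DualCop k H) (x : H) :
    toDual k H (antipode k p) x = toDual k H p (antipodeInv k H x) := rfl

end Finite
end DualCop

section Convolution

variable {k : Type*} {H : Type*} [Field k] [Ring H] [HopfAlgebra k H]

/-- The algebra homomorphism `h ↦ f(h₁) g(h₂)` for algebra homomorphisms with commuting values. -/
noncomputable def convAlgHom {B : Type*} [Ring B] [Algebra k B] (f g : H →ₐ[k] B)
    (hfg : ∀ x y, Commute (f x) (g y)) : H →ₐ[k] B :=
  (Algebra.TensorProduct.lift f g hfg).comp (Bialgebra.comulAlgHom k H)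

theorem convAlgHom_apply {B : Type*} [Ring B] [Algebra k B] (f g : H →ₐ[k] B)
    (hfg : ∀ x y, Commute (f x) (g y)) (h : H) :
    convAlgHom f g hfg h = ∑ i ∈ (ℛ k h).index, f ((ℛ k h).left i) * g ((ℛ k h).right i) := by
  simp [convAlgHom, ← (ℛ k h).eq]

theorem toConv_convAlgHom {B : Type*} [Ring B] [Algebra k B] (f g : H →ₐ[k] B)
    (hfg : ∀ x y, Commute (f x) (g y)) :
    toConv (convAlgHom f g hfg).toLinearMap = toConv f.toLinearMap * toConv g.toLinearMap := by
  ext h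
  rw [(ℛ k h).convMul_apply]
  exact convAlgHom_apply f g hfg h

variable {V W : Type*} [AddCommGroup V] [Module k V] [AddCommGroup W] [Module k W]

/-- `m` intertwines the families of operators `f'` and `f`. -/
def Inter (m : W →ₗ[k] V) (f : WithConv (H →ₗ[k] Module.End k V))
    (f' : WithConv (H →ₗ[k] Module.End k W)) : Prop :=
  ∀ h w, f.ofConv h (m w) = m (f'.ofConv h w)

theorem Inter.mul {m : W →ₗ[k] V} {f g : WithConv (H →ₗ[k] Module.End k V)}
    {f' g' : WithConv (H →ₗ[k] Module.End k W)} (hf : Inter m f f') (hg : Inter m g g') :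
    Inter m (f * g) (f' * g') := by
  intro h w
  rw [(ℛ k h).convMul_apply, (ℛ k h).convMul_apply]
  simp only [LinearMap.sum_apply, map_sum, Module.End.mul_apply]
  refine Finset.sum_congr rfl fun i _ => ?_
  rw [hg, hf]

/-- If `g` acts trivially on the image of `m` and commutes with `c`, it can be dropped. -/
theorem Inter.drop {m : W →ₗ[k] V} {f g c : WithConv (H →ₗ[k] Module.End k V)}
    (hg : Inter m g 1) (hc : ∀ x y, Commute (g.ofConv x) (c.ofConv y)) (h : H) (w : W) :
    (f * (g * c)).ofConv h (m w) = (f * c).ofConv h (m w) := by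
  have e : ∀ y, (g * c).ofConv y (m w) = c.ofConv y (m w) := by
    intro y
    rw [(ℛ k y).convMul_apply]
    conv_rhs => rw [← sum_counit_smul (ℛ k y)]
    simp only [LinearMap.sum_apply, map_sum, map_smul, LinearMap.smul_apply]
    refine Finset.sum_congr rfl fun i _ => ?_
    rw [(hc _ _).eq, Module.End.mul_apply, hg]
    simp [Algebra.algebraMap_eq_smul_one]
  rw [(ℛ k h).convMul_apply, (ℛ k h).convMul_apply]
  simp only [LinearMap.sum_apply, Module.End.mul_apply, e]

end Convolution

section Action

variable (k : Type*) (H : Type*) [Field k] [Ring H] [HopfAlgebra k H] [FiniteDimensional k H]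

/-- The action `h • q = q(? h)` of `H` on `H^*`. -/
noncomputable def dualRight : H →ₐ[k] Module.End k (DualCop k H) :=
  AlgHom.ofLinearMap
    (LinearMap.mk₂ k
      (fun (h : H) (q : DualCop k H) =>
        (DualCop.toDual k H).symm (DualCop.toDual k H q ∘ₗ LinearMap.mulRight k h))
      (fun a b q => DualCop.ext' fun x => by simp [mul_add])
      (fun c a q => DualCop.ext' fun x => by simp)
      (fun a p q => DualCop.ext' fun x => by simp)
      (fun c a q => DualCop.ext' fun x => by simp))
    (LinearMap.ext fun q => DualCop.ext' fun x => by simp)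
    (fun a b => LinearMap.ext fun q => DualCop.ext' fun x => by simp [mul_assoc])

/-- The action `h • q = q(S⁻¹(h) ?)` of `H` on `H^*`. -/
noncomputable def dualLeft : H →ₐ[k] Module.End k (DualCop k H) :=
  AlgHom.ofLinearMap
    (LinearMap.mk₂ k
      (fun (h : H) (q : DualCop k H) =>
        (DualCop.toDual k H).symm
          (DualCop.toDual k H q ∘ₗ LinearMap.mulLeft k (antipodeInv k H h)))
      (fun a b q => DualCop.ext' fun x => by simp [add_mul])
      (fun c a q => DualCop.ext' fun x => by simp)
      (fun a p q => DualCop.ext' fun x => by simp)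
      (fun c a q => DualCop.ext' fun x => by simp))
    (LinearMap.ext fun q => DualCop.ext' fun x => by simp)
    (fun a b => LinearMap.ext fun q => DualCop.ext' fun x => by
      simp [antipodeInv_mul])

variable {k H}

@[simp] theorem toDual_dualRight (h : H) (q : DualCop k H) (x : H) :
    DualCop.toDual k H (dualRight k H h q) x = DualCop.toDual k H q (x * h) := by
  simp [dualRight]

@[simp] theorem toDual_dualLeft (h : H) (q : DualCop k H) (x : H) :
    DualCop.toDual k H (dualLeft k H h q) x =
      DualCop.toDual k H q (antipodeInv k H h * x) := by
  simp [dualLeft]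

theorem dualRight_comm_dualLeft (x y : H) : Commute (dualRight k H x) (dualLeft k H y) :=
  LinearMap.ext fun q => DualCop.ext' fun z => by simp [mul_assoc]

variable (k H)

/-- `dualRight` acting on the first factor of `H^* ⊗ H`. -/
noncomputable def actRight : H →ₐ[k] Module.End k (DualCop k H ⊗[k] H) :=
  (Module.End.rTensorAlgHom k (DualCop k H) H).comp (dualRight k H)

/-- `dualLeft` acting on the first factor of `H^* ⊗ H`. -/
noncomputable def actLeft : H →ₐ[k] Module.End k (DualCop k H ⊗[k] H) :=
  (Module.End.rTensorAlgHom k (DualCop k H) H).comp (dualLeft k H)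

/-- Left multiplication on the second factor of `H^* ⊗ H`. -/
noncomputable def actMul : H →ₐ[k] Module.End k (DualCop k H ⊗[k] H) :=
  (Module.End.lTensorAlgHom k H (DualCop k H)).comp (Algebra.lmul k H)

variable {k H}

@[simp] theorem actRight_tmul (h : H) (q : DualCop k H) (g : H) :
    actRight k H h (q ⊗ₜ g) = dualRight k H h q ⊗ₜ g := rfl

@[simp] theorem actLeft_tmul (h : H) (q : DualCop k H) (g : H) :
    actLeft k H h (q ⊗ₜ g) = dualLeft k H h q ⊗ₜ g := rfl

@[simp] theorem actMul_tmul (h : H) (q : DualCop k H) (g : H) :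
    actMul k H h (q ⊗ₜ g) = q ⊗ₜ (h * g) := rfl

theorem actMul_comm_actLeft (x y : H) : Commute (actMul k H x) (actLeft k H y) :=
  TensorProduct.ext' fun q g => by simp

theorem actRight_comm_actMul (x y : H) : Commute (actRight k H x) (actMul k H y) :=
  TensorProduct.ext' fun q g => by simp

theorem actRight_comm_actLeft (x y : H) : Commute (actRight k H x) (actLeft k H y) :=
  TensorProduct.ext' fun q g => by
    simpa using congr($((dualRight_comm_dualLeft (k := k) x y).eq) q ⊗ₜ[k] g)

variable (k H)

/-- Left multiplication by `h ∈ H` in the double: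
`h · (q ⊗ g) = ∑ q(S⁻¹(h₃) ? h₁) ⊗ h₂ g`. -/
noncomputable def actH : H →ₐ[k] Module.End k (DualCop k H ⊗[k] H) :=
  convAlgHom (actRight k H) (convAlgHom (actMul k H) (actLeft k H) actMul_comm_actLeft)
    (fun x y => by
      rw [convAlgHom_apply]
      exact Commute.sum_right _ _ _ fun i _ =>
        (actRight_comm_actMul _ _).mul_right (actRight_comm_actLeft _ _))

theorem toConv_actH : toConv (actH k H).toLinearMap = toConv (actRight k H).toLinearMap *
    (toConv (actMul k H).toLinearMap * toConv (actLeft k H).toLinearMap) := by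
  rw [actH, toConv_convAlgHom, toConv_convAlgHom]

/-- Left multiplication by `p ∈ H^*` in the double: `p · (q ⊗ g) = p q ⊗ g`. -/
noncomputable def actDual : DualCop k H →ₐ[k] Module.End k (DualCop k H ⊗[k] H) :=
  (Module.End.rTensorAlgHom k (DualCop k H) H).comp (Algebra.lmul k (DualCop k H))

@[simp] theorem actDual_tmul (p q : DualCop k H) (g : H) :
    actDual k H p (q ⊗ₜ g) = (p * q) ⊗ₜ g := rfl

/-- The multiplication of the double: `(p ⊗ h) (q ⊗ g) = ∑ p q(S⁻¹(h₃) ? h₁) ⊗ h₂ g`. -/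
noncomputable def doubleMul :
    DualCop k H ⊗[k] H →ₗ[k] Module.End k (DualCop k H ⊗[k] H) :=
  LinearMap.mul' k (Module.End k (DualCop k H ⊗[k] H)) ∘ₗ
    TensorProduct.map (actDual k H).toLinearMap (actH k H).toLinearMap

variable {k H}

theorem doubleMul_tmul (p : DualCop k H) (h : H) (y : DualCop k H ⊗[k] H) :
    doubleMul k H (p ⊗ₜ h) y = actDual k H p (actH k H h y) := by
  simp [doubleMul]

/-- `p ⊗ v ↦ p · v`. -/
noncomputable def dualMul (k H : Type*) [Field k] [Ring H] [HopfAlgebra k H]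
    [FiniteDimensional k H] :
    DualCop k H ⊗[k] (DualCop k H ⊗[k] H) →ₗ[k] DualCop k H ⊗[k] H :=
  TensorProduct.lift (actDual k H).toLinearMap

@[simp] theorem dualMul_tmul (p : DualCop k H) (v : DualCop k H ⊗[k] H) :
    dualMul k H (p ⊗ₜ v) = actDual k H p v := by simp [dualMul]

section
variable (k H) (V : Type*) [AddCommGroup V] [Module k V]

/-- A family of operators acting on the left tensor factor. -/
noncomputable def onLeft (M : Type*) [AddCommGroup M] [Module k M]
    (f : H →ₐ[k] Module.End k M) : WithConv (H →ₗ[k] Module.End k (M ⊗[k] V)) :=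
  toConv ((Module.End.rTensorAlgHom k M V).comp f).toLinearMap

/-- A family of operators acting on the right tensor factor. -/
noncomputable def onRight (M : Type*) [AddCommGroup M] [Module k M]
    (f : H →ₐ[k] Module.End k M) : WithConv (H →ₗ[k] Module.End k (V ⊗[k] M)) :=
  toConv ((Module.End.lTensorAlgHom k M V).comp f).toLinearMap

variable {k H V}

@[simp] theorem onLeft_tmul (M : Type*) [AddCommGroup M] [Module k M]
    (f : H →ₐ[k] Module.End k M) (h : H) (m : M) (v : V) :
    (onLeft k H V M f).ofConv h (m ⊗ₜ v) = f h m ⊗ₜ v := rfl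

@[simp] theorem onRight_tmul (M : Type*) [AddCommGroup M] [Module k M]
    (f : H →ₐ[k] Module.End k M) (h : H) (m : M) (v : V) :
    (onRight k H V M f).ofConv h (v ⊗ₜ m) = v ⊗ₜ f h m := rfl

end

theorem dualRight_mul (h : H) (p q : DualCop k H) : dualRight k H h (p * q) =
    ∑ i ∈ (ℛ k h).index,
      dualRight k H ((ℛ k h).left i) p * dualRight k H ((ℛ k h).right i) q := by
  refine DualCop.ext' fun x => ?_
  rw [map_sum, LinearMap.sum_apply, toDual_dualRight, DualCop.toDual_mul']
  simp only [DualCop.toDual_mul, toDual_dualRight]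
  rw [Bialgebra.comul_mul]
  conv_lhs => rw [← (ℛ k x).eq, ← (ℛ k h).eq]
  simp only [Finset.sum_mul_sum, Algebra.TensorProduct.tmul_mul_tmul, map_sum,
    TensorProduct.dualDistrib_apply]
  rw [Finset.sum_comm]

theorem dualLeft_mul (h : H) (p q : DualCop k H) : dualLeft k H h (p * q) =
    ∑ i ∈ (ℛ k h).index,
      dualLeft k H ((ℛ k h).right i) p * dualLeft k H ((ℛ k h).left i) q := by
  refine DualCop.ext' fun x => ?_
  rw [map_sum, LinearMap.sum_apply, toDual_dualLeft, DualCop.toDual_mul']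
  simp only [DualCop.toDual_mul, toDual_dualLeft]
  rw [Bialgebra.comul_mul, comul_antipodeInv]
  conv_lhs => rw [← (ℛ k x).eq, ← (ℛ k h).eq]
  simp only [map_sum, TensorProduct.map_tmul, TensorProduct.comm_tmul,
    Finset.sum_mul_sum, Algebra.TensorProduct.tmul_mul_tmul,
    TensorProduct.dualDistrib_apply]

theorem inter_actH : Inter (dualMul k H) (toConv (actH k H).toLinearMap)
    (onLeft k H _ _ (dualRight k H) *
      (onRight k H _ _ (actH k H) * onLeft k H _ _ (dualLeft k H))) := by
  have h1 : Inter (dualMul k H) (toConv (actRight k H).toLinearMap)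
      (onLeft k H _ _ (dualRight k H) * onRight k H _ _ (actRight k H)) := by
    intro h w
    rw [(ℛ k h).convMul_apply]
    induction w with
    | zero => simp
    | add u v hu hv => simp only [map_add, hu, hv]
    | tmul p v =>
      induction v with
      | zero => simp
      | add u v hu hv => simp only [map_add, TensorProduct.tmul_add, hu, hv]
      | tmul q g =>
        simp only [LinearMap.sum_apply, map_sum, Module.End.mul_apply, AlgHom.toLinearMap_apply]
        simp [dualRight_mul, TensorProduct.sum_tmul]
  have h2 : Inter (dualMul k H) (toConv (actMul k H).toLinearMap)
      (onRight k H _ _ (actMul k H)) := by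
    intro h w
    induction w with
    | zero => simp
    | add u v hu hv => simp only [map_add, hu, hv]
    | tmul p v =>
      induction v with
      | zero => simp
      | add u v hu hv => simp only [map_add, TensorProduct.tmul_add, hu, hv]
      | tmul q g => simp
  have h3 : Inter (dualMul k H) (toConv (actLeft k H).toLinearMap)
      (onRight k H _ _ (actLeft k H) * onLeft k H _ _ (dualLeft k H)) := by
    intro h w
    rw [(ℛ k h).convMul_apply]
    induction w with
    | zero => simp
    | add u v hu hv => simp only [map_add, hu, hv]
    | tmul p v =>
      induction v with
      | zero => simp
      | add u v hu hv => simp only [map_add, TensorProduct.tmul_add, hu, hv]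
      | tmul q g =>
        simp only [LinearMap.sum_apply, map_sum, Module.End.mul_apply, AlgHom.toLinearMap_apply]
        simp [dualLeft_mul, TensorProduct.sum_tmul]
  have e : onRight k H (DualCop k H) _ (actH k H) = onRight k H _ _ (actRight k H) *
      (onRight k H _ _ (actMul k H) * onRight k H _ _ (actLeft k H)) := by
    have a1 := LinearMap.algHom_comp_convMul_distrib (R := k)
      (Module.End.lTensorAlgHom k (DualCop k H ⊗[k] H) (DualCop k H))
      (toConv (actRight k H).toLinearMap)
      (toConv (actMul k H).toLinearMap * toConv (actLeft k H).toLinearMap)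
    rw [← toConv_actH, LinearMap.algHom_comp_convMul_distrib] at a1
    exact WithConv.ext a1
  rw [e]
  have := h1.mul (h2.mul h3)
  rw [← toConv_actH] at this
  simpa only [mul_assoc] using this

/-- `q ⊗ g ↦ q ⊗ (g · z)` -/
noncomputable def insertAct (z : DualCop k H ⊗[k] H) :
    DualCop k H ⊗[k] H →ₗ[k] DualCop k H ⊗[k] (DualCop k H ⊗[k] H) :=
  TensorProduct.map LinearMap.id (LinearMap.applyₗ z ∘ₗ (actH k H).toLinearMap)

@[simp] theorem insertAct_tmul (z : DualCop k H ⊗[k] H) (q : DualCop k H) (g : H) :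
    insertAct z (q ⊗ₜ g) = q ⊗ₜ actH k H g z := by
  simp [insertAct]

theorem inter_insertAct (z : DualCop k H ⊗[k] H) : Inter (insertAct z)
    (onLeft k H _ _ (dualRight k H) *
      (onRight k H _ _ (actH k H) * onLeft k H _ _ (dualLeft k H)))
    (toConv (actH k H).toLinearMap) := by
  rw [toConv_actH]
  refine Inter.mul ?_ (Inter.mul ?_ ?_)
  all_goals
    intro h w
    induction w with
    | zero => simp
    | add u v hu hv => simp only [map_add, hu, hv]
    | tmul p v => simp

theorem doubleMul_eq (y z : DualCop k H ⊗[k] H) :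
    doubleMul k H y z = dualMul k H (insertAct z y) := by
  induction y with
  | zero => simp
  | add u v hu hv => simp only [map_add, LinearMap.add_apply, hu, hv]
  | tmul p h => simp [doubleMul_tmul]

theorem doubleMul_actH (h : H) (y z : DualCop k H ⊗[k] H) :
    doubleMul k H (actH k H h y) z = actH k H h (doubleMul k H y z) := by
  rw [doubleMul_eq, doubleMul_eq]
  have h1 := inter_actH (k := k) h (insertAct z y)
  rw [inter_insertAct] at h1
  exact h1.symm

theorem doubleMul_actDual (p : DualCop k H) (y z : DualCop k H ⊗[k] H) :
    doubleMul k H (actDual k H p y) z = actDual k H p (doubleMul k H y z) := by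
  induction y with
  | zero => simp
  | add u v hu hv => simp only [map_add, LinearMap.add_apply, hu, hv]
  | tmul q g => simp [doubleMul_tmul]

theorem doubleMul_assoc (x y z : DualCop k H ⊗[k] H) :
    doubleMul k H (doubleMul k H x y) z = doubleMul k H x (doubleMul k H y z) := by
  induction x with
  | zero => simp
  | add u v hu hv => simp only [map_add, LinearMap.add_apply, hu, hv]
  | tmul p h => simp only [doubleMul_tmul, doubleMul_actDual, doubleMul_actH]

theorem actH_one_tmul (h g : H) : actH k H h (1 ⊗ₜ g) = 1 ⊗ₜ (h * g) := by
  let m : H →ₗ[k] DualCop k H ⊗[k] H := TensorProduct.mk k (DualCop k H) H 1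
  have h1 : Inter m (toConv (actRight k H).toLinearMap) 1 := by
    intro h w
    have : dualRight k H h 1 = counit (R := k) h • (1 : DualCop k H) :=
      DualCop.ext' fun x => by simp [mul_comm]
    simp [m, this, TensorProduct.smul_tmul', Algebra.algebraMap_eq_smul_one]
  have h3 : Inter m (toConv (actLeft k H).toLinearMap) 1 := by
    intro h w
    have : dualLeft k H h 1 = counit (R := k) h • (1 : DualCop k H) :=
      DualCop.ext' fun x => by simp [counit_antipodeInv]
    simp [m, this, TensorProduct.smul_tmul', Algebra.algebraMap_eq_smul_one]
  have h2 : Inter m (toConv (actMul k H).toLinearMap) (toConv (Algebra.lmul k H).toLinearMap) := by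
    intro h w
    simp [m]
  have := h1.mul (h2.mul h3) h g
  rw [← toConv_actH, one_mul, mul_one] at this
  simpa [m] using this

theorem one_doubleMul (x : DualCop k H ⊗[k] H) : doubleMul k H (1 ⊗ₜ 1) x = x := by
  rw [doubleMul_tmul, map_one, map_one]; rfl

theorem doubleMul_one (x : DualCop k H ⊗[k] H) : doubleMul k H x (1 ⊗ₜ 1) = x := by
  induction x with
  | zero => simp
  | add u v hu hv => simp only [map_add, LinearMap.add_apply, hu, hv]
  | tmul p h => rw [doubleMul_tmul, actH_one_tmul, actDual_tmul, mul_one, mul_one]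

end Action

section Comul

variable {k : Type*} {H : Type*} [Field k] [Ring H] [HopfAlgebra k H] [FiniteDimensional k H]

theorem comul_actMul (h : H) (v : DualCop k H ⊗[k] H) :
    comul (R := k) (actMul k H h v) = ∑ i ∈ (ℛ k h).index,
      TensorProduct.map (actMul k H ((ℛ k h).left i)) (actMul k H ((ℛ k h).right i))
        (comul v) := by
  induction v with
  | zero => simp
  | add u v hu hv => simp only [map_add, hu, hv, Finset.sum_add_distrib]
  | tmul q g =>
    simp only [actMul_tmul, TensorProduct.comul_tmul, Bialgebra.comul_mul]
    rw [← (ℛ k h).eq, ← (ℛ k q).eq, ← (ℛ k g).eq]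
    simp [TensorProduct.sum_tmul, TensorProduct.tmul_sum, Finset.sum_mul, Finset.mul_sum]
    rw [Finset.sum_comm]

theorem comul_dualRight (h : H) (q : DualCop k H) : comul (R := k) (dualRight k H h q) =
    TensorProduct.map (dualRight k H h) LinearMap.id (comul q) := by
  apply (DualCop.pair₂ k H).injective
  ext x y
  simp only [TensorProduct.AlgebraTensorModule.curry_apply, TensorProduct.curry_apply,
    LinearMap.restrictScalars_self]
  have h1 : ∀ t : DualCop k H ⊗[k] DualCop k H, DualCop.pair₂ k H
      (TensorProduct.map (dualRight k H h) LinearMap.id t) (x ⊗ₜ y) =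
      DualCop.pair₂ k H t ((x * h) ⊗ₜ y) := by
    intro t
    induction t with
    | zero => simp
    | add u v hu hv => simp only [map_add, LinearMap.add_apply, hu, hv]
    | tmul a b => simp
  rw [h1, DualCop.pair₂_comul, DualCop.pair₂_comul]
  simp [mul_assoc]

theorem comul_dualLeft (h : H) (q : DualCop k H) : comul (R := k) (dualLeft k H h q) =
    TensorProduct.map LinearMap.id (dualLeft k H h) (comul q) := by
  apply (DualCop.pair₂ k H).injective
  ext x y
  simp only [TensorProduct.AlgebraTensorModule.curry_apply, TensorProduct.curry_apply,
    LinearMap.restrictScalars_self]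
  have h1 : ∀ t : DualCop k H ⊗[k] DualCop k H, DualCop.pair₂ k H
      (TensorProduct.map LinearMap.id (dualLeft k H h) t) (x ⊗ₜ y) =
      DualCop.pair₂ k H t (x ⊗ₜ (antipodeInv k H h * y)) := by
    intro t
    induction t with
    | zero => simp
    | add u v hu hv => simp only [map_add, LinearMap.add_apply, hu, hv]
    | tmul a b => simp
  rw [h1, DualCop.pair₂_comul, DualCop.pair₂_comul]
  simp [mul_assoc]

theorem dualLeft_dualRight_comul (h : H) (q : DualCop k H) :
    ∑ i ∈ (ℛ k h).index, TensorProduct.map (dualLeft k H ((ℛ k h).left i))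
      (dualRight k H ((ℛ k h).right i)) (comul q) = counit (R := k) h • comul q := by
  apply (DualCop.pair₂ k H).injective
  ext x y
  simp only [TensorProduct.AlgebraTensorModule.curry_apply, TensorProduct.curry_apply,
    LinearMap.restrictScalars_self]
  have h1 : ∀ (a b : H) (t : DualCop k H ⊗[k] DualCop k H), DualCop.pair₂ k H
      (TensorProduct.map (dualLeft k H a) (dualRight k H b) t) (x ⊗ₜ y) =
      DualCop.pair₂ k H t ((antipodeInv k H a * x) ⊗ₜ (y * b)) := by
    intro a b t
    induction t with
    | zero => simp
    | add u v hu hv => simp only [map_add, LinearMap.add_apply, hu, hv]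
    | tmul a b => simp
  simp only [map_sum, LinearMap.sum_apply, h1, DualCop.pair₂_comul, map_smul,
    LinearMap.smul_apply]
  rw [← map_sum]
  have h2 : ∀ i, y * (ℛ k h).right i * (antipodeInv k H ((ℛ k h).left i) * x) =
      y * ((ℛ k h).right i * antipodeInv k H ((ℛ k h).left i)) * x := fun i => by
    simp only [mul_assoc]
  simp only [h2]
  rw [← Finset.sum_mul, ← Finset.mul_sum, sum_right_mul_antipodeInv_left]
  simp [Algebra.algebraMap_eq_smul_one]

theorem inter_comul_actRight : Inter (comul (R := k) (A := DualCop k H ⊗[k] H))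
    (onLeft k H _ _ (actRight k H)) (toConv (actRight k H).toLinearMap) := by
  intro h w
  induction w with
  | zero => simp
  | add u v hu hv => simp only [map_add, hu, hv]
  | tmul q g =>
    simp only [AlgHom.toLinearMap_apply, actRight_tmul, TensorProduct.comul_tmul, comul_dualRight]
    rw [← (ℛ k q).eq, ← (ℛ k g).eq]
    simp [TensorProduct.sum_tmul, TensorProduct.tmul_sum]

theorem inter_comul_actLeft : Inter (comul (R := k) (A := DualCop k H ⊗[k] H))
    (onRight k H _ _ (actLeft k H)) (toConv (actLeft k H).toLinearMap) := by
  intro h w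
  induction w with
  | zero => simp
  | add u v hu hv => simp only [map_add, hu, hv]
  | tmul q g =>
    simp only [AlgHom.toLinearMap_apply, actLeft_tmul, TensorProduct.comul_tmul, comul_dualLeft]
    rw [← (ℛ k q).eq, ← (ℛ k g).eq]
    simp [TensorProduct.sum_tmul, TensorProduct.tmul_sum]

theorem inter_comul_actMul : Inter (comul (R := k) (A := DualCop k H ⊗[k] H))
    (onLeft k H _ _ (actMul k H) * onRight k H _ _ (actMul k H))
    (toConv (actMul k H).toLinearMap) := by
  intro h w
  rw [(ℛ k h).convMul_apply]
  refine Eq.trans ?_ (comul_actMul h w).symm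
  rw [LinearMap.sum_apply]
  refine Finset.sum_congr rfl fun i _ => ?_
  generalize comul (R := k) w = t
  induction t with
  | zero => simp
  | add u v hu hv => simp only [map_add, hu, hv]
  | tmul a b => simp

theorem inter_comul_drop : Inter (comul (R := k) (A := DualCop k H ⊗[k] H))
    (onLeft k H _ _ (actLeft k H) * onRight k H _ _ (actRight k H)) 1 := by
  intro h w
  rw [(ℛ k h).convMul_apply]
  induction w with
  | zero => simp
  | add u v hu hv => simp only [map_add, hu, hv]
  | tmul q g =>
    have e := congr(TensorProduct.AlgebraTensorModule.tensorTensorTensorComm k k k k _ _ _ _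
      ($(dualLeft_dualRight_comul h q) ⊗ₜ[k] comul g))
    simp only [LinearMap.sum_apply, Module.End.mul_apply, TensorProduct.comul_tmul,
      LinearMap.convOne_apply, Algebra.algebraMap_eq_smul_one, LinearMap.smul_apply,
      Module.End.one_apply, map_smul, TensorProduct.smul_tmul', ← e]
    rw [← (ℛ k q).eq, ← (ℛ k g).eq]
    simp [TensorProduct.sum_tmul, TensorProduct.tmul_sum]
    rw [Finset.sum_comm]

theorem comul_actH (h : H) (v : DualCop k H ⊗[k] H) :
    comul (R := k) (actH k H h v) =
      (onLeft k H _ _ (actH k H) * onRight k H _ _ (actH k H)).ofConv h (comul v) := by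
  have e1 : onLeft k H (DualCop k H ⊗[k] H) _ (actH k H) = onLeft k H _ _ (actRight k H) *
      (onLeft k H _ _ (actMul k H) * onLeft k H _ _ (actLeft k H)) := by
    have a1 := LinearMap.algHom_comp_convMul_distrib (R := k)
      (Module.End.rTensorAlgHom k (DualCop k H ⊗[k] H) (DualCop k H ⊗[k] H))
      (toConv (actRight k H).toLinearMap)
      (toConv (actMul k H).toLinearMap * toConv (actLeft k H).toLinearMap)
    rw [← toConv_actH, LinearMap.algHom_comp_convMul_distrib] at a1
    exact WithConv.ext a1
  have e2 : onRight k H (DualCop k H ⊗[k] H) _ (actH k H) = onRight k H _ _ (actRight k H) *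
      (onRight k H _ _ (actMul k H) * onRight k H _ _ (actLeft k H)) := by
    have a1 := LinearMap.algHom_comp_convMul_distrib (R := k)
      (Module.End.lTensorAlgHom k (DualCop k H ⊗[k] H) (DualCop k H ⊗[k] H))
      (toConv (actRight k H).toLinearMap)
      (toConv (actMul k H).toLinearMap * toConv (actLeft k H).toLinearMap)
    rw [← toConv_actH, LinearMap.algHom_comp_convMul_distrib] at a1
    exact WithConv.ext a1
  have e3 := inter_comul_actRight.mul
    (inter_comul_actMul.mul (inter_comul_actLeft (k := k) (H := H))) h v
  rw [← toConv_actH] at e3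
  have e4 := Inter.drop
    (f := onLeft k H _ _ (actRight k H) * onLeft k H _ _ (actMul k H))
    (c := onRight k H _ _ (actMul k H) * onRight k H _ _ (actLeft k H))
    (inter_comul_drop (k := k) (H := H)) (fun x y => by
      rw [(ℛ k x).convMul_apply, (ℛ k y).convMul_apply]
      refine Commute.sum_left _ _ _ fun i _ => Commute.sum_right _ _ _ fun j _ => ?_
      have c1 : ∀ (f g : H →ₐ[k] Module.End k (DualCop k H ⊗[k] H)) (a b : H),
          Commute ((onLeft k H (DualCop k H ⊗[k] H) _ f).ofConv a)
            ((onRight k H (DualCop k H ⊗[k] H) _ g).ofConv b) := fun f g a b =>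
        TensorProduct.ext' fun u v => by simp
      have c2 : ∀ (f g : H →ₐ[k] Module.End k (DualCop k H ⊗[k] H)),
          (∀ a b, Commute (f a) (g b)) → ∀ a b,
          Commute ((onRight k H (DualCop k H ⊗[k] H) _ f).ofConv a)
            ((onRight k H (DualCop k H ⊗[k] H) _ g).ofConv b) := fun f g hfg a b =>
        TensorProduct.ext' fun u v => by
          simpa using congr(u ⊗ₜ[k] ($((hfg a b).eq) v))
      exact Commute.mul_left ((c1 _ _ _ _).mul_right (c1 _ _ _ _))
        ((c2 _ _ actRight_comm_actMul _ _).mul_right (c2 _ _ actRight_comm_actLeft _ _))) h v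
  rw [e1, e2]
  simp only [mul_assoc] at e3 e4 ⊢
  exact e3.symm.trans e4.symm

theorem comul_actDual (p : DualCop k H) (v : DualCop k H ⊗[k] H) :
    comul (R := k) (actDual k H p v) = ∑ i ∈ (ℛ k p).index,
      TensorProduct.map (actDual k H ((ℛ k p).left i)) (actDual k H ((ℛ k p).right i))
        (comul v) := by
  induction v with
  | zero => simp
  | add u v hu hv => simp only [map_add, hu, hv, Finset.sum_add_distrib]
  | tmul q g =>
    simp only [actDual_tmul, TensorProduct.comul_tmul, Bialgebra.comul_mul]
    rw [← (ℛ k p).eq, ← (ℛ k q).eq, ← (ℛ k g).eq]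
    simp [TensorProduct.sum_tmul, TensorProduct.tmul_sum, Finset.sum_mul, Finset.mul_sum]
    conv_rhs => rw [Finset.sum_comm]
    refine Finset.sum_congr rfl fun _ _ => Finset.sum_comm

theorem counit_actH (h : H) (v : DualCop k H ⊗[k] H) :
    counit (R := k) (actH k H h v) = counit (R := k) h * counit (R := k) v := by
  have a1 : ∀ (x y : H) (w : DualCop k H ⊗[k] H),
      counit (R := k) (actRight k H x (actMul k H y w)) =
        counit (R := k) y * counit (R := k) (actRight k H x w) := by
    intro x y w
    induction w with
    | zero => simp
    | add u v hu hv => simp only [map_add, mul_add, hu, hv]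
    | tmul q g => simp [mul_assoc]
  have a2 : ∀ (x y : H) (w : DualCop k H ⊗[k] H), counit (R := k) (actRight k H x
      ((toConv (actMul k H).toLinearMap * toConv (actLeft k H).toLinearMap).ofConv y w)) =
        counit (R := k) (actRight k H x (actLeft k H y w)) := by
    intro x y w
    rw [(ℛ k y).convMul_apply]
    conv_rhs => rw [← sum_counit_smul (ℛ k y)]
    simp [LinearMap.sum_apply, a1]
  have a3 : actH k H h = ∑ i ∈ (ℛ k h).index, actRight k H ((ℛ k h).left i) *
      (toConv (actMul k H).toLinearMap * toConv (actLeft k H).toLinearMap).ofConv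
        ((ℛ k h).right i) := by
    have := congr(($(toConv_actH k H) : WithConv _) h)
    rw [(ℛ k h).convMul_apply] at this
    exact this
  rw [a3]
  simp only [LinearMap.sum_apply, map_sum, Module.End.mul_apply, a2]
  induction v with
  | zero => simp
  | add u v hu hv => simp only [map_add, mul_add, Finset.sum_add_distrib, hu, hv]
  | tmul q g =>
    simp only [actLeft_tmul, actRight_tmul, TensorProduct.counit_tmul, DualCop.counit_apply,
      toDual_dualRight, toDual_dualLeft, one_mul, smul_eq_mul, ← Finset.mul_sum, ← map_sum,
      sum_antipodeInv_right_mul_left]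
    simp [Algebra.algebraMap_eq_smul_one, mul_left_comm]

theorem counit_actDual (p : DualCop k H) (v : DualCop k H ⊗[k] H) :
    counit (R := k) (actDual k H p v) = counit (R := k) p * counit (R := k) v := by
  induction v with
  | zero => simp
  | add u v hu hv => simp only [map_add, mul_add, hu, hv]
  | tmul q g => simp [mul_left_comm]

end Comul

/-- The Drinfeld double `D(H) = H^{*cop} ⊗ H` of a finite-dimensional Hopf algebra. -/
def DrinfeldDouble (k H : Type*) [Field k] [Ring H] [HopfAlgebra k H]
    [FiniteDimensional k H] : Type _ :=
  DualCop k H ⊗[k] H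

namespace DrinfeldDouble

variable {k : Type*} {H : Type*} [Field k] [Ring H] [HopfAlgebra k H] [FiniteDimensional k H]

noncomputable instance : AddCommGroup (DrinfeldDouble k H) :=
  inferInstanceAs (AddCommGroup (DualCop k H ⊗[k] H))

noncomputable instance : Module k (DrinfeldDouble k H) :=
  inferInstanceAs (Module k (DualCop k H ⊗[k] H))

instance : FiniteDimensional k (DrinfeldDouble k H) :=
  inferInstanceAs (FiniteDimensional k (DualCop k H ⊗[k] H))

/-- As a coalgebra, `D(H)` is the tensor product of the coalgebras `H^{*cop}` and `H`. -/
noncomputable instance : Coalgebra k (DrinfeldDouble k H) :=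
  inferInstanceAs (Coalgebra k (DualCop k H ⊗[k] H))

/-- The element `p ⊗ h` of the double. -/
noncomputable def mk (p : DualCop k H) (h : H) : DrinfeldDouble k H := p ⊗ₜ[k] h

/-- The multiplication is determined by
`(p ⊗ h) (q ⊗ g) = ∑ p q(S⁻¹(h₃) ? h₁) ⊗ h₂ g`. -/
noncomputable instance : Ring (DrinfeldDouble k H) where
  mul x y := doubleMul k H x y
  one := mk 1 1
  left_distrib x y z := map_add (doubleMul k H x) y z
  right_distrib x y z := LinearMap.congr_fun (map_add (doubleMul k H) x y) z
  zero_mul x := LinearMap.congr_fun (map_zero (doubleMul k H)) x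
  mul_zero x := map_zero (doubleMul k H x)
  mul_assoc x y z := doubleMul_assoc x y z
  one_mul x := one_doubleMul x
  mul_one x := doubleMul_one x
  zsmul := fun n x => n • x
  zsmul_zero' := SubNegMonoid.zsmul_zero'
  zsmul_succ' := SubNegMonoid.zsmul_succ'
  zsmul_neg' := SubNegMonoid.zsmul_neg'
  neg_add_cancel := neg_add_cancel

theorem mul_def (x y : DrinfeldDouble k H) : x * y = doubleMul k H x y := rfl

noncomputable instance : Algebra k (DrinfeldDouble k H) :=
  Algebra.ofModule
    (fun c x y => LinearMap.congr_fun (map_smul (doubleMul k H) c x) y)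
    (fun c x y => map_smul (doubleMul k H x) c y)

theorem actH_one (y : DualCop k H ⊗[k] H) : actH k H 1 y = y := by
  rw [map_one]; rfl

/-- The inclusion `H → D(H)`, `h ↦ ε ⊗ h`. -/
noncomputable def inclAlg (k H : Type*) [Field k] [Ring H] [HopfAlgebra k H]
    [FiniteDimensional k H] : H →ₐ[k] DrinfeldDouble k H :=
  AlgHom.ofLinearMap (TensorProduct.mk k (DualCop k H) H 1) rfl fun a b => by
    have h := doubleMul_tmul (1 : DualCop k H) a (1 ⊗ₜ b)
    rw [actH_one_tmul, actDual_tmul, mul_one] at h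
    exact h.symm

/-- The inclusion `H^{*cop} → D(H)`, `p ↦ p ⊗ 1`. -/
noncomputable def inclDualAlg (k H : Type*) [Field k] [Ring H] [HopfAlgebra k H]
    [FiniteDimensional k H] : DualCop k H →ₐ[k] DrinfeldDouble k H :=
  AlgHom.ofLinearMap ((TensorProduct.mk k (DualCop k H) H).flip 1) rfl fun a b => by
    have h := doubleMul_tmul a (1 : H) (b ⊗ₜ 1)
    rw [actH_one, actDual_tmul] at h
    exact h.symm

theorem inclAlg_mul (h : H) (y : DrinfeldDouble k H) : inclAlg k H h * y = actH k H h y := by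
  have : actDual k H (1 : DualCop k H) = 1 := map_one _
  exact (doubleMul_tmul 1 h y).trans (by rw [this]; rfl)

theorem inclDualAlg_mul (p : DualCop k H) (y : DrinfeldDouble k H) :
    inclDualAlg k H p * y = actDual k H p y := by
  have : actH k H (1 : H) = 1 := map_one _
  exact (doubleMul_tmul p 1 y).trans (by rw [this]; rfl)

theorem mk_eq (p : DualCop k H) (h : H) : mk p h = inclDualAlg k H p * inclAlg k H h := by
  rw [inclDualAlg_mul]
  change p ⊗ₜ[k] h = actDual k H p (1 ⊗ₜ h)
  simp

/-- The explicit product formula `(p ⊗ h) (q ⊗ g) = ∑ p q(S⁻¹(h₃) ? h₁) ⊗ h₂ g`. -/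
theorem mk_mul_mk (p q : DualCop k H) (h g : H) : mk p h * mk q g =
    ∑ i ∈ (ℛ k h).index, ∑ j ∈ (ℛ k ((ℛ k h).right i)).index,
      mk (p * (DualCop.toDual k H).symm (DualCop.toDual k H q ∘ₗ
          LinearMap.mulLeft k (antipodeInv k H ((ℛ k ((ℛ k h).right i)).right j)) ∘ₗ
          LinearMap.mulRight k ((ℛ k h).left i)))
        ((ℛ k ((ℛ k h).right i)).left j * g) := by
  refine (doubleMul_tmul p h (q ⊗ₜ g)).trans ?_
  rw [actH, convAlgHom_apply]
  simp only [convAlgHom_apply, LinearMap.sum_apply, Module.End.mul_apply, map_sum,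
    actLeft_tmul, actMul_tmul, actRight_tmul, actDual_tmul]
  refine Finset.sum_congr rfl fun i _ => Finset.sum_congr rfl fun j _ => ?_
  refine congrArg (fun r => (p * r) ⊗ₜ[k] _) (DualCop.ext' fun x => ?_)
  simp

theorem induction_on {P : DrinfeldDouble k H → Prop} (x : DrinfeldDouble k H) (h0 : P 0)
    (hmk : ∀ p h, P (mk p h)) (hadd : ∀ x y, P x → P y → P (x + y)) : P x :=
  TensorProduct.induction_on (motive := P) x h0 hmk hadd

theorem comul_actH' (h : H) (v : DualCop k H ⊗[k] H) :
    comul (R := k) (actH k H h v) = ∑ i ∈ (ℛ k h).index,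
      TensorProduct.map (actH k H ((ℛ k h).left i)) (actH k H ((ℛ k h).right i)) (comul v) := by
  rw [comul_actH, (ℛ k h).convMul_apply, LinearMap.sum_apply]
  refine Finset.sum_congr rfl fun i _ => ?_
  generalize comul (R := k) v = t
  induction t with
  | zero => simp
  | add u v hu hv => simp only [map_add, hu, hv]
  | tmul a b => simp

theorem comul_inclAlg_mul (h : H) (y : DrinfeldDouble k H) :
    comul (R := k) (inclAlg k H h * y) =
      Algebra.TensorProduct.map (inclAlg k H) (inclAlg k H) (comul h) * comul y := by
  have key : ∀ (a b : H) (t : DrinfeldDouble k H ⊗[k] DrinfeldDouble k H),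
      TensorProduct.map (actH k H a) (actH k H b) t = (inclAlg k H a ⊗ₜ[k] inclAlg k H b) * t := by
    intro a b t
    induction t using TensorProduct.induction_on with
    | zero => rw [mul_zero]; exact map_zero (TensorProduct.map (actH k H a) (actH k H b))
    | add u v hu hv =>
      rw [mul_add, ← hu, ← hv]
      exact map_add (TensorProduct.map (actH k H a) (actH k H b)) u v
    | tmul c d =>
      rw [Algebra.TensorProduct.tmul_mul_tmul, inclAlg_mul, inclAlg_mul]
      rfl
  rw [inclAlg_mul]
  refine (comul_actH' h y).trans ?_
  rw [← (ℛ k h).eq, map_sum, Finset.sum_mul]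
  refine Finset.sum_congr rfl fun i _ => ?_
  rw [Algebra.TensorProduct.map_tmul]
  exact key _ _ _

theorem comul_inclDualAlg_mul (p : DualCop k H) (y : DrinfeldDouble k H) :
    comul (R := k) (inclDualAlg k H p * y) =
      Algebra.TensorProduct.map (inclDualAlg k H) (inclDualAlg k H) (comul p) * comul y := by
  have key : ∀ (a b : DualCop k H) (t : DrinfeldDouble k H ⊗[k] DrinfeldDouble k H),
      TensorProduct.map (actDual k H a) (actDual k H b) t = (inclDualAlg k H a ⊗ₜ[k] inclDualAlg k H b) * t := by
    intro a b t
    induction t using TensorProduct.induction_on with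
    | zero => rw [mul_zero]; exact map_zero (TensorProduct.map (actDual k H a) (actDual k H b))
    | add u v hu hv =>
      rw [mul_add, ← hu, ← hv]
      exact map_add (TensorProduct.map (actDual k H a) (actDual k H b)) u v
    | tmul c d =>
      rw [Algebra.TensorProduct.tmul_mul_tmul, inclDualAlg_mul, inclDualAlg_mul]
      rfl
  rw [inclDualAlg_mul]
  refine (comul_actDual p y).trans ?_
  rw [← (ℛ k p).eq, map_sum, Finset.sum_mul]
  refine Finset.sum_congr rfl fun i _ => ?_
  rw [Algebra.TensorProduct.map_tmul]
  exact key _ _ _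

theorem comul_one' : comul (R := k) (1 : DrinfeldDouble k H) = 1 := by
  change comul (R := k) ((1 : DualCop k H) ⊗ₜ[k] (1 : H)) = _
  rw [TensorProduct.comul_tmul, Bialgebra.comul_one, Bialgebra.comul_one]
  rfl

theorem comul_inclAlg (h : H) : comul (R := k) (inclAlg k H h) =
    Algebra.TensorProduct.map (inclAlg k H) (inclAlg k H) (comul h) := by
  have := comul_inclAlg_mul h (1 : DrinfeldDouble k H)
  rwa [mul_one, comul_one', mul_one] at this

theorem comul_inclDualAlg (p : DualCop k H) : comul (R := k) (inclDualAlg k H p) =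
    Algebra.TensorProduct.map (inclDualAlg k H) (inclDualAlg k H) (comul p) := by
  have := comul_inclDualAlg_mul p (1 : DrinfeldDouble k H)
  rwa [mul_one, comul_one', mul_one] at this

theorem counit_inclAlg_mul (h : H) (y : DrinfeldDouble k H) :
    counit (R := k) (inclAlg k H h * y) = counit (R := k) h * counit (R := k) y := by
  rw [inclAlg_mul]
  exact counit_actH h y

theorem counit_inclDualAlg_mul (p : DualCop k H) (y : DrinfeldDouble k H) :
    counit (R := k) (inclDualAlg k H p * y) = counit (R := k) p * counit (R := k) y := by
  rw [inclDualAlg_mul]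
  exact counit_actDual p y

theorem counit_mk (p : DualCop k H) (h : H) :
    counit (R := k) (mk p h) = counit (R := k) p * counit (R := k) h := by
  change counit (R := k) (p ⊗ₜ[k] h) = _
  simp [mul_comm]

theorem counit_one' : counit (R := k) (1 : DrinfeldDouble k H) = 1 := by
  change counit (R := k) (mk (1 : DualCop k H) (1 : H)) = _
  rw [counit_mk]; simp

noncomputable instance : Bialgebra k (DrinfeldDouble k H) :=
  Bialgebra.mk' k (DrinfeldDouble k H) counit_one'
    (by
      intro x y
      induction x using induction_on with
      | h0 => simp
      | hadd u v hu hv => simp only [add_mul, map_add, hu, hv]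
      | hmk p h =>
        rw [mk_eq, mul_assoc, counit_inclDualAlg_mul, counit_inclAlg_mul, ← mk_eq, counit_mk,
          mul_assoc])
    comul_one'
    (by
      intro x y
      induction x using induction_on with
      | h0 => simp
      | hadd u v hu hv => simp only [add_mul, map_add, hu, hv]
      | hmk p h =>
        rw [mk_eq, mul_assoc, comul_inclDualAlg_mul, comul_inclAlg_mul, comul_inclDualAlg_mul,
          comul_inclAlg, mul_assoc])

/-- The linear map `p ⊗ h ↦ (ε ⊗ S(h)) (S(p) ⊗ 1)`. -/
noncomputable def antipodeMap (k H : Type*) [Field k] [Ring H] [HopfAlgebra k H]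
    [FiniteDimensional k H] : DrinfeldDouble k H →ₗ[k] DrinfeldDouble k H :=
  TensorProduct.lift (LinearMap.mk₂ k
    (fun (p : DualCop k H) (h : H) =>
      inclAlg k H (antipode k h) * inclDualAlg k H (antipode k p))
    (fun p q h => by simp [mul_add]) (fun c p h => by simp)
    (fun p h g => by simp [add_mul]) (fun c p h => by simp))

theorem antipodeMap_mk (p : DualCop k H) (h : H) : antipodeMap k H (mk p h) =
    inclAlg k H (antipode k h) * inclDualAlg k H (antipode k p) := rfl

theorem comul_mk (p : DualCop k H) (h : H) : comul (R := k) (mk p h) =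
    ∑ i ∈ (ℛ k p).index, ∑ j ∈ (ℛ k h).index,
      mk ((ℛ k p).left i) ((ℛ k h).left j) ⊗ₜ[k] mk ((ℛ k p).right i) ((ℛ k h).right j) := by
  rw [mk_eq, Bialgebra.comul_mul, comul_inclAlg, comul_inclDualAlg, ← (ℛ k p).eq, ← (ℛ k h).eq]
  simp [Finset.sum_mul_sum, mk_eq]

noncomputable instance : HopfAlgebra k (DrinfeldDouble k H) where
  antipode := antipodeMap k H
  mul_antipode_rTensor_comul := by
    refine LinearMap.ext fun x => ?_
    induction x using induction_on with
    | h0 => simp only [map_zero]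
    | hadd u v hu hv => rw [map_add, map_add, hu, hv]
    | hmk p h =>
      simp only [LinearMap.comp_apply, comul_mk, map_sum, LinearMap.rTensor_tmul,
        LinearMap.mul'_apply, antipodeMap_mk]
      rw [Finset.sum_comm]
      have e : ∀ i j, inclAlg k H (antipode k ((ℛ k h).left j)) *
          inclDualAlg k H (antipode k ((ℛ k p).left i)) *
            mk ((ℛ k p).right i) ((ℛ k h).right j) =
          inclAlg k H (antipode k ((ℛ k h).left j)) * inclDualAlg k H
            (antipode k ((ℛ k p).left i) * (ℛ k p).right i) *
              inclAlg k H ((ℛ k h).right j) := by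
        intro i j
        rw [mk_eq, map_mul]
        simp only [mul_assoc]
      simp only [e, ← Finset.sum_mul, ← Finset.mul_sum, ← map_sum,
        sum_antipode_mul_eq_algebraMap_counit]
      simp only [Algebra.algebraMap_eq_smul_one, map_smul, map_one, mul_smul_comm, mul_one,
        smul_mul_assoc, ← map_mul, ← Finset.smul_sum, ← map_sum,
        sum_antipode_mul_eq_smul]
      simp [counit_mk, Algebra.algebraMap_eq_smul_one, smul_smul]
  mul_antipode_lTensor_comul := by
    refine LinearMap.ext fun x => ?_
    induction x using induction_on with
    | h0 => simp only [map_zero]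
    | hadd u v hu hv => rw [map_add, map_add, hu, hv]
    | hmk p h =>
      simp only [LinearMap.comp_apply, comul_mk, map_sum, LinearMap.lTensor_tmul,
        LinearMap.mul'_apply, antipodeMap_mk]
      have e : ∀ i j, mk ((ℛ k p).left i) ((ℛ k h).left j) *
          (inclAlg k H (antipode k ((ℛ k h).right j)) *
          inclDualAlg k H (antipode k ((ℛ k p).right i))) =
          inclDualAlg k H ((ℛ k p).left i) * inclAlg k H
            ((ℛ k h).left j * antipode k ((ℛ k h).right j)) *
              inclDualAlg k H (antipode k ((ℛ k p).right i)) := by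
        intro i j
        rw [mk_eq, map_mul]
        simp only [mul_assoc]
      simp only [e, ← Finset.sum_mul, ← Finset.mul_sum, ← map_sum,
        sum_mul_antipode_eq_algebraMap_counit]
      simp only [Algebra.algebraMap_eq_smul_one, map_smul, map_one, mul_smul_comm, mul_one,
        smul_mul_assoc, ← map_mul, ← Finset.smul_sum, ← map_sum,
        sum_mul_antipode_eq_smul]
      simp [counit_mk, Algebra.algebraMap_eq_smul_one, smul_smul, mul_comm]

/-- The inclusion of Hopf algebras `H → D(H)`, `h ↦ ε ⊗ h`. -/
noncomputable def incl (k H : Type*) [Field k] [Ring H] [HopfAlgebra k H]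
    [FiniteDimensional k H] : H →ₐc[k] DrinfeldDouble k H :=
  BialgHom.ofAlgHom (inclAlg k H)
    (by
      ext h
      have := counit_inclAlg_mul h (1 : DrinfeldDouble k H)
      rw [mul_one, counit_one', mul_one] at this
      simpa using this)
    (by
      ext h
      exact (comul_inclAlg h).symm)

/-- The inclusion of Hopf algebras `H^{*cop} → D(H)`, `p ↦ p ⊗ 1`. -/
noncomputable def inclDual (k H : Type*) [Field k] [Ring H] [HopfAlgebra k H]
    [FiniteDimensional k H] : DualCop k H →ₐc[k] DrinfeldDouble k H :=
  BialgHom.ofAlgHom (inclDualAlg k H)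
    (by
      ext h
      have := counit_inclDualAlg_mul h (1 : DrinfeldDouble k H)
      rw [mul_one, counit_one', mul_one] at this
      simpa using this)
    (by
      ext h
      exact (comul_inclDualAlg h).symm)

/-- The universal `R`-matrix `∑ hᵢ ⊗ hᵢ^*` of the double, for dual bases of `H` and `H^*`. -/
noncomputable def rMatrix (k H : Type*) [Field k] [Ring H] [HopfAlgebra k H]
    [FiniteDimensional k H] : DrinfeldDouble k H ⊗[k] DrinfeldDouble k H :=
  ∑ i, incl k H (Module.finBasis k H i) ⊗ₜ[k]
    inclDual k H ((DualCop.toDual k H).symm ((Module.finBasis k H).coord i))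

end DrinfeldDouble

section Legs

variable (k A : Type*) [Field k] [Ring A] [HopfAlgebra k A]

/-- `X ↦ X₁₂`, i.e. `a ⊗ b ↦ a ⊗ b ⊗ 1`. -/
noncomputable def leg12 : A ⊗[k] A →ₐ[k] A ⊗[k] (A ⊗[k] A) :=
  Algebra.TensorProduct.map (AlgHom.id k A) Algebra.TensorProduct.includeLeft

/-- `X ↦ X₁₃`, i.e. `a ⊗ b ↦ a ⊗ 1 ⊗ b`. -/
noncomputable def leg13 : A ⊗[k] A →ₐ[k] A ⊗[k] (A ⊗[k] A) :=
  Algebra.TensorProduct.map (AlgHom.id k A) Algebra.TensorProduct.includeRight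

/-- `X ↦ X₂₃`, i.e. `a ⊗ b ↦ 1 ⊗ a ⊗ b`. -/
noncomputable def leg23 : A ⊗[k] A →ₐ[k] A ⊗[k] (A ⊗[k] A) :=
  Algebra.TensorProduct.includeRight

/-- `Δ ⊗ I`. -/
noncomputable def comulLeft : A ⊗[k] A →ₐ[k] A ⊗[k] (A ⊗[k] A) :=
  (Algebra.TensorProduct.assoc k k k A A A).toAlgHom.comp
    (Algebra.TensorProduct.map (Bialgebra.comulAlgHom k A) (AlgHom.id k A))

/-- `I ⊗ Δ`. -/
noncomputable def comulRight : A ⊗[k] A →ₐ[k] A ⊗[k] (A ⊗[k] A) :=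
  Algebra.TensorProduct.map (AlgHom.id k A) (Bialgebra.comulAlgHom k A)

/-- `ε ⊗ I`, with values in `A`. -/
noncomputable def counitLeft : A ⊗[k] A →ₐ[k] A :=
  (Algebra.TensorProduct.lid k A).toAlgHom.comp
    (Algebra.TensorProduct.map (Bialgebra.counitAlgHom k A) (AlgHom.id k A))

/-- `I ⊗ ε`, with values in `A`. -/
noncomputable def counitRight : A ⊗[k] A →ₐ[k] A :=
  (Algebra.TensorProduct.rid k k A).toAlgHom.comp
    (Algebra.TensorProduct.map (AlgHom.id k A) (Bialgebra.counitAlgHom k A))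

variable {k A}

@[simp] theorem leg12_tmul (a b : A) : leg12 k A (a ⊗ₜ b) = a ⊗ₜ (b ⊗ₜ 1) := rfl
@[simp] theorem leg13_tmul (a b : A) : leg13 k A (a ⊗ₜ b) = a ⊗ₜ (1 ⊗ₜ b) := rfl
@[simp] theorem leg23_tmul (a b : A) : leg23 k A (a ⊗ₜ b) = 1 ⊗ₜ (a ⊗ₜ b) := rfl
@[simp] theorem comulLeft_tmul (a b : A) : comulLeft k A (a ⊗ₜ b) =
    TensorProduct.assoc k A A A (comul a ⊗ₜ b) := rfl
@[simp] theorem comulRight_tmul (a b : A) : comulRight k A (a ⊗ₜ b) = a ⊗ₜ comul b := rfl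
@[simp] theorem counitLeft_tmul (a b : A) : counitLeft k A (a ⊗ₜ b) = counit (R := k) a • b := rfl
@[simp] theorem counitRight_tmul (a b : A) : counitRight k A (a ⊗ₜ b) = counit (R := k) b • a := rfl

theorem comulLeft_comul (x : A) : comulLeft k A (comul x) = comulRight k A (comul x) :=
  coassoc_apply x

theorem counitLeft_comul (x : A) : counitLeft k A (comul x) = x := by
  refine Eq.trans (congrArg (TensorProduct.lid k A) (rTensor_counit_comul (R := k) x)) ?_
  rw [TensorProduct.lid_tmul, one_smul]

theorem counitRight_comul (x : A) : counitRight k A (comul x) = x := by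
  refine Eq.trans (congrArg (TensorProduct.rid k A) (lTensor_counit_comul (R := k) x)) ?_
  rw [TensorProduct.rid_tmul, one_smul]

end Legs

/-- `R` is a universal `R`-matrix for the Hopf algebra `A`, i.e. `(A, R)` is a quasitriangular
Hopf algebra. -/
structure IsQuasitriangular (k : Type*) {A : Type*} [Field k] [Ring A] [HopfAlgebra k A]
    (R : A ⊗[k] A) : Prop where
  isUnit : IsUnit R
  mul_comul : ∀ x : A, R * comul x = TensorProduct.comm k A A (comul x) * R
  comulLeft_eq : comulLeft k A R = leg13 k A R * leg23 k A R
  comulRight_eq : comulRight k A R = leg13 k A R * leg12 k A R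

/-- `(A, R)` and `(B, R')` are isomorphic as quasitriangular Hopf algebras: there is an
isomorphism of Hopf algebras `A ≃ B` mapping `R` to `R'`. -/
def QuasitriangularIso (k : Type*) {A B : Type*} [Field k] [Ring A] [HopfAlgebra k A]
    [Ring B] [HopfAlgebra k B] (R : A ⊗[k] A) (R' : B ⊗[k] B) : Prop :=
  ∃ e : A ≃ₐc[k] B, (∀ x, e (antipode k x) = antipode k (e x)) ∧
    TensorProduct.map (e : A →ₗ[k] B) (e : A →ₗ[k] B) R = R'

/-- A twist for the Hopf algebra `A`: an invertible `J ∈ A ⊗ A` with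
`(Δ ⊗ I)(J) J₁₂ = (I ⊗ Δ)(J) J₂₃` and `(ε ⊗ I)(J) = (I ⊗ ε)(J) = 1`. -/
structure Twist (k A : Type*) [Field k] [Ring A] [HopfAlgebra k A] where
  /-- The underlying invertible element. -/
  val : (A ⊗[k] A)ˣ
  cocycle : comulLeft k A val * leg12 k A val = comulRight k A val * leg23 k A val
  counit_left : counitLeft k A val = 1
  counit_right : counitRight k A val = 1

namespace Twist

variable {k A : Type*} [Field k] [Ring A] [HopfAlgebra k A] (J : Twist k A)

theorem map_inv {B : Type*} [Ring B] [Algebra k B] (f : A ⊗[k] A →ₐ[k] B) :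
    f J.val * f ↑J.val⁻¹ = 1 := by rw [← map_mul, Units.mul_inv, map_one]

theorem inv_map {B : Type*} [Ring B] [Algebra k B] (f : A ⊗[k] A →ₐ[k] B) :
    f ↑J.val⁻¹ * f J.val = 1 := by rw [← map_mul, Units.inv_mul, map_one]

theorem counit_left_inv : counitLeft k A ↑J.val⁻¹ = 1 := by
  have := J.inv_map (counitLeft k A)
  rwa [J.counit_left, mul_one] at this

theorem counit_right_inv : counitRight k A ↑J.val⁻¹ = 1 := by
  have := J.inv_map (counitRight k A)
  rwa [J.counit_right, mul_one] at this

/-- The image of a twist under a homomorphism of Hopf algebras. -/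
noncomputable def map {B : Type*} [Ring B] [HopfAlgebra k B] (f : A →ₐc[k] B) : Twist k B where
  val := Units.map (Algebra.TensorProduct.map (f : A →ₐ[k] B) (f : A →ₐ[k] B)).toMonoidHom J.val
  cocycle := by
    let F : A ⊗[k] A →ₐ[k] B ⊗[k] B :=
      Algebra.TensorProduct.map (f : A →ₐ[k] B) (f : A →ₐ[k] B)
    let F3 : A ⊗[k] (A ⊗[k] A) →ₐ[k] B ⊗[k] (B ⊗[k] B) :=
      Algebra.TensorProduct.map (f : A →ₐ[k] B) F
    have hF : ∀ x : A, comul (R := k) (f x) = F (comul x) := fun x =>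
      (CoalgHomClass.map_comp_comul_apply f x).symm
    have e1 : ∀ t, comulLeft k B (F t) = F3 (comulLeft k A t) := by
      intro t
      induction t with
      | zero => simp
      | add u v hu hv => simp only [map_add, hu, hv]
      | tmul a b =>
        have : F (a ⊗ₜ b) = f a ⊗ₜ f b := rfl
        rw [this, comulLeft_tmul, comulLeft_tmul, hF]
        generalize comul (R := k) a = s
        induction s with
        | zero => simp
        | add u v hu hv => simp only [map_add, TensorProduct.add_tmul, hu, hv]
        | tmul c d => rfl
    have e2 : ∀ t, comulRight k B (F t) = F3 (comulRight k A t) := by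
      intro t
      induction t with
      | zero => simp
      | add u v hu hv => simp only [map_add, hu, hv]
      | tmul a b =>
        have : F (a ⊗ₜ b) = f a ⊗ₜ f b := rfl
        rw [this, comulRight_tmul, comulRight_tmul, hF]
        rfl
    have e3 : ∀ t, leg12 k B (F t) = F3 (leg12 k A t) := by
      intro t
      induction t with
      | zero => simp
      | add u v hu hv => simp only [map_add, hu, hv]
      | tmul a b => simp [F, F3]
    have e4 : ∀ t, leg23 k B (F t) = F3 (leg23 k A t) := by
      intro t
      induction t with
      | zero => simp
      | add u v hu hv => simp only [map_add, hu, hv]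
      | tmul a b => simp [F, F3]
    change comulLeft k B (F J.val) * leg12 k B (F J.val) =
      comulRight k B (F J.val) * leg23 k B (F J.val)
    rw [e1, e2, e3, e4, ← map_mul, ← map_mul, J.cocycle]
  counit_left := by
    have e : ∀ t, counitLeft k B (Algebra.TensorProduct.map (f : A →ₐ[k] B) (f : A →ₐ[k] B) t) =
        f (counitLeft k A t) := by
      intro t
      induction t with
      | zero => simp
      | add u v hu hv => simp only [map_add, hu, hv]
      | tmul a b => simp
    refine (e _).trans ?_
    rw [J.counit_left, map_one]
  counit_right := by
    have e : ∀ t, counitRight k B (Algebra.TensorProduct.map (f : A →ₐ[k] B) (f : A →ₐ[k] B) t) =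
        f (counitRight k A t) := by
      intro t
      induction t with
      | zero => simp
      | add u v hu hv => simp only [map_add, hu, hv]
      | tmul a b => simp
    refine (e _).trans ?_
    rw [J.counit_right, map_one]

/-- The twisted comultiplication `x ↦ J⁻¹ Δ(x) J`. -/
noncomputable def comulJ : A →ₗ[k] A ⊗[k] A :=
  LinearMap.mulLeftRight k ((↑J.val⁻¹ : A ⊗[k] A), (J.val : A ⊗[k] A)) ∘ₗ comul

theorem comulJ_apply (x : A) : J.comulJ x =
    (↑J.val⁻¹ : A ⊗[k] A) * comul x * (J.val : A ⊗[k] A) := by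
  simp [comulJ]

theorem comulJ_left (t : A ⊗[k] A) : TensorProduct.assoc k A A A (J.comulJ.rTensor A t) =
    leg12 k A ↑J.val⁻¹ * comulLeft k A t * leg12 k A J.val := by
  induction t with
  | zero => simp
  | add u v hu hv => simp only [map_add, hu, hv, mul_add, add_mul]
  | tmul a b =>
    have h1 : ∀ (s : A ⊗[k] A) , leg12 k A s = Algebra.TensorProduct.assoc k k k A A A (s ⊗ₜ 1) := by
      intro s
      induction s with
      | zero => simp
      | add u v hu hv => simp only [map_add, hu, hv, TensorProduct.add_tmul]
      | tmul c d => rfl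
    have h2 : comulLeft k A (a ⊗ₜ b) = Algebra.TensorProduct.assoc k k k A A A (comul a ⊗ₜ b) := rfl
    rw [h1, h1, h2, ← map_mul, ← map_mul, LinearMap.rTensor_tmul, comulJ_apply]
    simp only [Algebra.TensorProduct.tmul_mul_tmul, one_mul, mul_one]
    rfl

theorem comulJ_right (t : A ⊗[k] A) : J.comulJ.lTensor A t =
    leg23 k A ↑J.val⁻¹ * comulRight k A t * leg23 k A J.val := by
  induction t with
  | zero => simp
  | add u v hu hv => simp only [map_add, hu, hv, mul_add, add_mul]
  | tmul a b =>
    rw [LinearMap.lTensor_tmul, comulJ_apply, comulRight_tmul]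
    simp [leg23]

/-- `Q = m (S ⊗ I) (J)`. -/
noncomputable def Q : A := LinearMap.mul' k A ((antipode k).rTensor A J.val)

/-- `Q⁻¹ = m (I ⊗ S) (J⁻¹)`. -/
noncomputable def Qinv : A := LinearMap.mul' k A ((antipode k).lTensor A ↑J.val⁻¹)

/-- `a ⊗ b ↦ (z ↦ S(a) z b)` -/
noncomputable def sandwich (k A : Type*) [Field k] [Ring A] [HopfAlgebra k A] :
    A ⊗[k] A →ₗ[k] A →ₗ[k] A :=
  TensorProduct.lift (LinearMap.mk₂ k
    (fun a b => LinearMap.mulLeftRight k (antipode k a, b))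
    (fun a b c => by ext; simp [add_mul]) (fun r a b => by ext; simp)
    (fun a b c => by ext; simp [mul_add]) (fun r a b => by ext; simp))

@[simp] theorem sandwich_tmul (a b z : A) : sandwich k A (a ⊗ₜ b) z = antipode k a * z * b := by
  simp [sandwich]

/-- `a ⊗ b ↦ (z ↦ a z S(b))` -/
noncomputable def sandwich' (k A : Type*) [Field k] [Ring A] [HopfAlgebra k A] :
    A ⊗[k] A →ₗ[k] A →ₗ[k] A :=
  TensorProduct.lift (LinearMap.mk₂ k
    (fun a b => LinearMap.mulLeftRight k (a, antipode k b))
    (fun a b c => by ext; simp [add_mul]) (fun r a b => by ext; simp)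
    (fun a b c => by ext; simp [mul_add]) (fun r a b => by ext; simp))

@[simp] theorem sandwich'_tmul (a b z : A) :
    sandwich' k A (a ⊗ₜ b) z = a * z * antipode k b := by
  simp [sandwich']

theorem sandwich_mul (u v : A ⊗[k] A) (z : A) :
    sandwich k A (u * v) z = sandwich k A v (sandwich k A u z) := by
  induction u with
  | zero => simp
  | add u₁ u₂ h₁ h₂ => simp only [add_mul, map_add, LinearMap.add_apply, h₁, h₂]
  | tmul a b =>
    induction v with
    | zero => simp
    | add u₁ u₂ h₁ h₂ => simp only [mul_add, map_add, LinearMap.add_apply, h₁, h₂]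
    | tmul c d => simp [antipode_mul_antidistrib, mul_assoc]

theorem sandwich'_mul (u v : A ⊗[k] A) (z : A) :
    sandwich' k A (u * v) z = sandwich' k A u (sandwich' k A v z) := by
  induction u with
  | zero => simp
  | add u₁ u₂ h₁ h₂ => simp only [add_mul, map_add, LinearMap.add_apply, h₁, h₂]
  | tmul a b =>
    induction v with
    | zero => simp
    | add u₁ u₂ h₁ h₂ => simp only [mul_add, map_add, LinearMap.add_apply, h₁, h₂]
    | tmul c d => simp [antipode_mul_antidistrib, mul_assoc]

theorem sandwich_one (t : A ⊗[k] A) :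
    sandwich k A t 1 = LinearMap.mul' k A ((antipode k).rTensor A t) := by
  induction t with
  | zero => simp
  | add u v hu hv => simp only [map_add, LinearMap.add_apply, hu, hv]
  | tmul a b => simp

theorem sandwich'_one (t : A ⊗[k] A) :
    sandwich' k A t 1 = LinearMap.mul' k A ((antipode k).lTensor A t) := by
  induction t with
  | zero => simp
  | add u v hu hv => simp only [map_add, LinearMap.add_apply, hu, hv]
  | tmul a b => simp

theorem Qinv_mul_Q : J.Qinv * J.Q = 1 := by
  let φ : A ⊗[k] (A ⊗[k] A) →ₗ[k] A :=
    LinearMap.mul' k A ∘ₗ TensorProduct.map LinearMap.id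
      (LinearMap.mul' k A ∘ₗ (antipode k).rTensor A)
  have e0 : leg23 k A J.val * leg12 k A ↑J.val⁻¹ =
      comulRight k A ↑J.val⁻¹ * comulLeft k A J.val := by
    have h := J.cocycle
    calc leg23 k A J.val * leg12 k A ↑J.val⁻¹
        = (comulRight k A ↑J.val⁻¹ * comulRight k A J.val) * leg23 k A J.val *
          leg12 k A ↑J.val⁻¹ := by rw [J.inv_map, one_mul]
      _ = comulRight k A ↑J.val⁻¹ * comulLeft k A J.val *
          (leg12 k A J.val * leg12 k A ↑J.val⁻¹) := by
        simp only [mul_assoc]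
        rw [← mul_assoc (comulRight k A J.val), ← h]
        simp only [mul_assoc]
      _ = _ := by rw [J.map_inv, mul_one]
  have e1 : ∀ u v : A ⊗[k] A, φ (leg23 k A u * leg12 k A v) =
      LinearMap.mul' k A ((antipode k).lTensor A v) *
        LinearMap.mul' k A ((antipode k).rTensor A u) := by
    intro u v
    induction u with
    | zero => simp
    | add u₁ u₂ h₁ h₂ => simp only [add_mul, mul_add, map_add, h₁, h₂]
    | tmul a b =>
      induction v with
      | zero => simp
      | add u₁ u₂ h₁ h₂ => simp only [add_mul, mul_add, map_add, h₁, h₂]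
      | tmul c d => simp [φ, antipode_mul_antidistrib, mul_assoc]
  have e2 : ∀ u v : A ⊗[k] A, φ (comulRight k A u * comulLeft k A v) =
      counitRight k A u * counitLeft k A v := by
    intro u v
    induction u with
    | zero => simp
    | add u₁ u₂ h₁ h₂ => simp only [add_mul, map_add, h₁, h₂]
    | tmul c d =>
      induction v with
      | zero => simp
      | add u₁ u₂ h₁ h₂ => simp only [mul_add, map_add, h₁, h₂]
      | tmul a b =>
        have h1 : ∀ s t : A ⊗[k] A,
            φ ((c ⊗ₜ t) * TensorProduct.assoc k A A A (s ⊗ₜ b)) =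
              c * LinearMap.mul' k A ((antipode k).lTensor A s) *
                LinearMap.mul' k A ((antipode k).rTensor A t) * b := by
          intro s t
          induction s with
          | zero => simp
          | add u₁ u₂ h₁ h₂ => simp only [TensorProduct.add_tmul, mul_add, add_mul, map_add, h₁, h₂]
          | tmul x y =>
            induction t with
            | zero => simp
            | add u₁ u₂ h₁ h₂ =>
              simp only [TensorProduct.tmul_add, mul_add, add_mul, map_add, h₁, h₂]
            | tmul x y => simp [φ, antipode_mul_antidistrib, mul_assoc]
        rw [comulRight_tmul, comulLeft_tmul, h1, mul_antipode_lTensor_comul_apply,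
          mul_antipode_rTensor_comul_apply]
        simp [Algebra.algebraMap_eq_smul_one, smul_smul, mul_comm]
  have h := congr(φ $e0)
  rw [e1, e2, J.counit_right_inv, J.counit_left, one_mul] at h
  exact h

/-- The twisted antipode `x ↦ Q⁻¹ S(x) Q`. -/
noncomputable def antipodeJ : A →ₗ[k] A :=
  LinearMap.mulLeftRight k (J.Qinv, J.Q) ∘ₗ antipode k

theorem antipodeJ_apply (x : A) : J.antipodeJ x = J.Qinv * antipode k x * J.Q := by
  simp [antipodeJ]

theorem antipodeJ_left (t : A ⊗[k] A) : LinearMap.mul' k A (J.antipodeJ.rTensor A t) =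
    J.Qinv * sandwich k A t J.Q := by
  induction t with
  | zero => simp
  | add u v hu hv => simp only [map_add, LinearMap.add_apply, mul_add, hu, hv]
  | tmul a b => simp [antipodeJ_apply, mul_assoc]

theorem antipodeJ_right (t : A ⊗[k] A) : LinearMap.mul' k A (J.antipodeJ.lTensor A t) =
    sandwich' k A t J.Qinv * J.Q := by
  induction t with
  | zero => simp
  | add u v hu hv => simp only [map_add, LinearMap.add_apply, add_mul, hu, hv]
  | tmul a b => simp [antipodeJ_apply, mul_assoc]

/-- The Hopf algebra structure of `A^J`: the algebra `A`, with the comultiplication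
`x ↦ J⁻¹ Δ(x) J` and the counit `ε`. -/
@[reducible] noncomputable def bialgebra : Bialgebra k A :=
  letI C : Coalgebra k A :=
    { comul := J.comulJ
      counit := counit
      coassoc := by
        ext x
        refine (J.comulJ_left _).trans (Eq.trans ?_ (J.comulJ_right _).symm)
        rw [comulJ_apply, map_mul, map_mul, map_mul, map_mul, comulLeft_comul]
        have h := J.cocycle
        have h' : leg12 k A ↑J.val⁻¹ * comulLeft k A ↑J.val⁻¹ =
            leg23 k A ↑J.val⁻¹ * comulRight k A ↑J.val⁻¹ := by
          refine left_inv_eq_right_inv (a := comulLeft k A J.val * leg12 k A J.val) ?_ ?_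
          · rw [mul_assoc, ← mul_assoc (comulLeft k A _), J.inv_map, one_mul, J.inv_map]
          · rw [h, mul_assoc, ← mul_assoc (leg23 k A _), J.map_inv, one_mul, J.map_inv]
        calc _ = (leg12 k A ↑J.val⁻¹ * comulLeft k A ↑J.val⁻¹) * comulRight k A (comul x) *
              (comulLeft k A J.val * leg12 k A J.val) := by simp only [mul_assoc]
          _ = _ := by rw [h, h']; simp only [mul_assoc]
      rTensor_counit_comp_comul := by
        ext x
        apply (TensorProduct.lid k A).injective
        have : counitLeft k A (J.comulJ x) = x := by
          rw [comulJ_apply, map_mul, map_mul, counitLeft_comul, J.counit_left, J.counit_left_inv,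
            one_mul, mul_one]
        refine Eq.trans this ?_
        simp
      lTensor_counit_comp_comul := by
        ext x
        apply (TensorProduct.rid k A).injective
        have : counitRight k A (J.comulJ x) = x := by
          rw [comulJ_apply, map_mul, map_mul, counitRight_comul, J.counit_right,
            J.counit_right_inv, one_mul, mul_one]
        refine Eq.trans this ?_
        simp }
  Bialgebra.mk' k A Bialgebra.counit_one (fun {a b} => Bialgebra.counit_mul a b)
    (by
      change J.comulJ 1 = 1
      rw [comulJ_apply, Bialgebra.comul_one, mul_one, Units.inv_mul])
    (by
      intro a b
      change J.comulJ (a * b) = J.comulJ a * J.comulJ b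
      simp only [comulJ_apply, Bialgebra.comul_mul, mul_assoc]
      rw [Units.mul_inv_cancel_left])

end Twist

/-- The twisted Hopf algebra `A^J`: a copy of the algebra `A`, with the comultiplication
`x ↦ J⁻¹ Δ(x) J`. -/
def Twisted {k A : Type*} [Field k] [Ring A] [HopfAlgebra k A] (_J : Twist k A) : Type _ := A

namespace Twisted

variable {k A : Type*} [Field k] [Ring A] [HopfAlgebra k A] (J : Twist k A)

instance : Ring (Twisted J) := inferInstanceAs (Ring A)

noncomputable instance : Bialgebra k (Twisted J) := J.bialgebra

theorem sandwich_comulJ (x : A) :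
    Twist.sandwich k A (J.comulJ x) J.Q = counit (R := k) (A := A) x • J.Q := by
  have hQ : J.Q = Twist.sandwich k A J.val 1 := (Twist.sandwich_one _).symm
  have h1 : Twist.sandwich k A ↑J.val⁻¹ J.Q = 1 := by
    rw [hQ, ← Twist.sandwich_mul, Units.mul_inv, Twist.sandwich_one]
    simp [Algebra.TensorProduct.one_def]
  have h2 : Twist.sandwich k A (comul x) 1 = counit (R := k) (A := A) x • (1 : A) := by
    rw [Twist.sandwich_one, mul_antipode_rTensor_comul_apply, Algebra.algebraMap_eq_smul_one]
  rw [Twist.comulJ_apply, Twist.sandwich_mul, Twist.sandwich_mul, h1, h2, map_smul, ← hQ]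

theorem sandwich'_comulJ (x : A) :
    Twist.sandwich' k A (J.comulJ x) J.Qinv = counit (R := k) (A := A) x • J.Qinv := by
  have hQ : J.Qinv = Twist.sandwich' k A ↑J.val⁻¹ 1 := (Twist.sandwich'_one _).symm
  have h1 : Twist.sandwich' k A J.val J.Qinv = 1 := by
    rw [hQ, ← Twist.sandwich'_mul, Units.mul_inv, Twist.sandwich'_one]
    simp [Algebra.TensorProduct.one_def]
  have h2 : Twist.sandwich' k A (comul x) 1 = counit (R := k) (A := A) x • (1 : A) := by
    rw [Twist.sandwich'_one, mul_antipode_lTensor_comul_apply, Algebra.algebraMap_eq_smul_one]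
  rw [Twist.comulJ_apply, Twist.sandwich'_mul, Twist.sandwich'_mul, h1, h2, map_smul, ← hQ]

theorem mul_sandwich_comulJ (x : A) : J.Qinv * Twist.sandwich k A (J.comulJ x) J.Q =
    algebraMap k A (counit (R := k) x) := by
  rw [sandwich_comulJ, mul_smul_comm, J.Qinv_mul_Q, Algebra.algebraMap_eq_smul_one]

theorem mul_sandwich'_comulJ (x : A) : Twist.sandwich' k A (J.comulJ x) J.Qinv * J.Q =
    algebraMap k A (counit (R := k) x) := by
  rw [sandwich'_comulJ, smul_mul_assoc, J.Qinv_mul_Q, Algebra.algebraMap_eq_smul_one]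

noncomputable instance : HopfAlgebra k (Twisted J) where
  antipode := J.antipodeJ
  mul_antipode_rTensor_comul := by
    refine LinearMap.ext fun x => ?_
    exact (J.antipodeJ_left (J.comulJ x)).trans (mul_sandwich_comulJ J x)
  mul_antipode_lTensor_comul := by
    refine LinearMap.ext fun x => ?_
    exact (J.antipodeJ_right (J.comulJ x)).trans (mul_sandwich'_comulJ J x)

/-- The identity map `A → A^J`, an isomorphism of algebras. -/
def of : A ≃ₐ[k] Twisted J := AlgEquiv.refl

instance [FiniteDimensional k A] : FiniteDimensional k (Twisted J) :=
  inferInstanceAs (FiniteDimensional k A)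

/-- The twisted `R`-matrix `R^J = J₂₁⁻¹ R J`, as an element of `A^J ⊗ A^J`. -/
noncomputable def rMatrix (R : A ⊗[k] A) : Twisted J ⊗[k] Twisted J :=
  Algebra.TensorProduct.map (of J : A →ₐ[k] Twisted J) (of J : A →ₐ[k] Twisted J)
    (TensorProduct.comm k A A (↑J.val⁻¹ : A ⊗[k] A) * R * (J.val : A ⊗[k] A))

end Twisted

end QDouble

/-!
The double has a universal property: let `i : K → A` be an injective homomorphism of Hopf algebras,
`K` finite-dimensional, and let `X ∈ K ⊗ A` be such that `(i ⊗ I)(X)` makes `A` quasitriangular.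
Then `p ⊗ x ↦ (p ⊗ I)(X) i(x)` is a homomorphism of bialgebras `D(K) → A` which maps the `R`-matrix
of `D(K)` to `(i ⊗ I)(X)` (`doubleLiftBialgHom`, `map_doubleLiftAlgHom_rMatrix`). Indeed,
contracting the first leg of the axioms of an `R`-matrix with functionals on `K` says that `p ↦ (p ⊗ I)(X)` is
a homomorphism of bialgebras from the co-opposite dual, and that it satisfies the commutation
relation of the double with `i`.

This is applied to `K = H^J` and `A = D(H)^J`. The element `R^J = J₂₁⁻¹ R J` is an `R`-matrix of
`D(H)^J`, since `R` is one of `D(H)` (`DrinfeldDouble.isQuasitriangular_rMatrix`) and a twist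
carries `R`-matrices to `R`-matrices (`IsQuasitriangular.twisted`). Its first leg lies in `H`,
because this holds for `R` and `J ∈ H ⊗ H`. The resulting homomorphism `F : D(H^J) → D(H)^J` has an
image containing `H` and the right leg of `R^J`; as `R = J₂₁ R^J J⁻¹`, the image contains the right
leg of `R` as well, which is `H^*`. So `F` is surjective (`DrinfeldDouble.twistAlgHom_surjective`),
and bijective because both doubles have dimension `(dim H)²`.
-/

namespace QDouble
open scoped TensorProduct
open Coalgebra HopfAlgebra WithConv

/-! ### Dual bases of `H` and `H^*` -/

section DualBasis

variable {k : Type*} {H : Type*} [Field k] [Ring H] [HopfAlgebra k H] [FiniteDimensional k H]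
  {V W : Type*} [AddCommGroup V] [Module k V] [AddCommGroup W] [Module k W]

/-- The basis of `H^{*cop}` dual to the basis `Module.finBasis k H` of `H`. -/
noncomputable def dualVec (k H : Type*) [Field k] [Ring H] [HopfAlgebra k H]
    [FiniteDimensional k H] (j : Fin (Module.finrank k H)) : DualCop k H :=
  (DualCop.toDual k H).symm ((Module.finBasis k H).coord j)

theorem toDual_dualVec (j : Fin (Module.finrank k H)) (x : H) :
    DualCop.toDual k H (dualVec k H j) x = (Module.finBasis k H).repr x j := by
  simp [dualVec]

theorem sum_dualVec_smul (x : H) :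
    ∑ j, DualCop.toDual k H (dualVec k H j) x • Module.finBasis k H j = x := by
  simp only [toDual_dualVec, Module.Basis.sum_repr]

theorem sum_smul_dualVec (p : DualCop k H) :
    ∑ j, DualCop.toDual k H p (Module.finBasis k H j) • dualVec k H j = p := by
  refine DualCop.ext' fun x => ?_
  conv_rhs => rw [← sum_dualVec_smul (k := k) x]
  simp [LinearMap.sum_apply, mul_comm]

/-- With `eᵢ`, `eⁱ` dual bases: `∑ (eᵢ ⊗ eⱼ) ⊗ eⁱ eʲ = ∑ Δ(eₗ) ⊗ eˡ`, because the product of `H^*`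
is dual to `Δ`. -/
theorem sum_tmul_dualVec_mul (f : H ⊗[k] H →ₗ[k] V) (g : DualCop k H →ₗ[k] W) :
    ∑ i, ∑ j, f (Module.finBasis k H i ⊗ₜ Module.finBasis k H j) ⊗ₜ[k]
      g (dualVec k H i * dualVec k H j) =
    ∑ l, f (comul (Module.finBasis k H l)) ⊗ₜ[k] g (dualVec k H l) := by
  have h1 : ∀ i j, g (dualVec k H i * dualVec k H j) = ∑ l,
      TensorProduct.dualDistrib k H H (DualCop.toDual k H (dualVec k H i) ⊗ₜ
        DualCop.toDual k H (dualVec k H j)) (comul (Module.finBasis k H l)) •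
          g (dualVec k H l) := by
    intro i j
    conv_lhs => rw [← sum_smul_dualVec (dualVec k H i * dualVec k H j)]
    simp only [map_sum, map_smul, DualCop.toDual_mul']
  have h2 : ∀ t : H ⊗[k] H, ∑ i, ∑ j,
      TensorProduct.dualDistrib k H H (DualCop.toDual k H (dualVec k H i) ⊗ₜ
        DualCop.toDual k H (dualVec k H j)) t •
          f (Module.finBasis k H i ⊗ₜ Module.finBasis k H j) = f t := by
    intro t
    induction t with
    | zero => simp
    | add u v hu hv => simp only [map_add, add_smul, Finset.sum_add_distrib, hu, hv]
    | tmul a b =>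
      conv_rhs => rw [← sum_dualVec_smul (k := k) a, ← sum_dualVec_smul (k := k) b]
      simp only [TensorProduct.sum_tmul, TensorProduct.tmul_sum, map_sum,
        TensorProduct.smul_tmul_smul, map_smul, TensorProduct.dualDistrib_apply]
      exact Finset.sum_comm
  simp only [h1, TensorProduct.tmul_sum]
  rw [Finset.sum_congr rfl fun i _ => Finset.sum_comm, Finset.sum_comm]
  refine Finset.sum_congr rfl fun l _ => ?_
  rw [← h2 (comul (Module.finBasis k H l))]
  simp only [TensorProduct.sum_tmul, TensorProduct.smul_tmul]

/-- An endomorphism of `H` applied to the first leg of the canonical element `∑ eᵢ ⊗ eⁱ` can be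
moved to the second leg as its transpose. -/
theorem sum_map_tmul_dualVec (φ : H →ₗ[k] H) (f : H →ₗ[k] V) (g : DualCop k H →ₗ[k] W) :
    ∑ i, f (φ (Module.finBasis k H i)) ⊗ₜ[k] g (dualVec k H i) =
    ∑ i, f (Module.finBasis k H i) ⊗ₜ[k]
      g ((DualCop.toDual k H).symm (DualCop.toDual k H (dualVec k H i) ∘ₗ φ)) := by
  have h1 : ∀ i, f (φ (Module.finBasis k H i)) = ∑ j,
      DualCop.toDual k H (dualVec k H j) (φ (Module.finBasis k H i)) •
        f (Module.finBasis k H j) := by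
    intro i
    conv_lhs => rw [← sum_dualVec_smul (k := k) (φ (Module.finBasis k H i))]
    simp only [map_sum, map_smul]
  have h2 : ∀ j, g ((DualCop.toDual k H).symm (DualCop.toDual k H (dualVec k H j) ∘ₗ φ)) =
      ∑ i, DualCop.toDual k H (dualVec k H j) (φ (Module.finBasis k H i)) •
        g (dualVec k H i) := by
    intro j
    conv_lhs => rw [← sum_smul_dualVec
      ((DualCop.toDual k H).symm (DualCop.toDual k H (dualVec k H j) ∘ₗ φ))]
    simp
  simp only [h1, h2, TensorProduct.sum_tmul, TensorProduct.tmul_sum, TensorProduct.smul_tmul]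
  exact Finset.sum_comm

/-- `Δ(p) = ∑ p(eⱼ ?) ⊗ eʲ`. The functional `p(h ?)` is written `dualLeft (S h) p`, as `dualLeft`
acts through `S⁻¹`. -/
theorem comul_eq_sum_tmul_dualVec (p : DualCop k H) : comul (R := k) p =
    ∑ j, dualLeft k H (antipode k (Module.finBasis k H j)) p ⊗ₜ[k] dualVec k H j := by
  apply (DualCop.pair₂ k H).injective
  ext x y
  simp only [TensorProduct.AlgebraTensorModule.curry_apply, TensorProduct.curry_apply,
    LinearMap.restrictScalars_self, DualCop.pair₂_comul, map_sum, LinearMap.sum_apply,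
    DualCop.pair₂_tmul, toDual_dualLeft, antipodeInv_antipode]
  conv_lhs => rw [← sum_dualVec_smul (k := k) y]
  simp [Finset.sum_mul, mul_comm]

/-- `Δ(p) = ∑ eʲ ⊗ p(? eⱼ)`. -/
theorem comul_eq_sum_dualVec_tmul (p : DualCop k H) : comul (R := k) p =
    ∑ j, dualVec k H j ⊗ₜ[k] dualRight k H (Module.finBasis k H j) p := by
  apply (DualCop.pair₂ k H).injective
  ext x y
  simp only [TensorProduct.AlgebraTensorModule.curry_apply, TensorProduct.curry_apply,
    LinearMap.restrictScalars_self, DualCop.pair₂_comul, map_sum, LinearMap.sum_apply,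
    DualCop.pair₂_tmul, toDual_dualRight]
  conv_lhs => rw [← sum_dualVec_smul (k := k) x]
  simp [Finset.mul_sum]

theorem comul_eq_sum_sum_dualVec (p : DualCop k H) : comul (R := k) p =
    ∑ i, ∑ j, DualCop.toDual k H p (Module.finBasis k H i * Module.finBasis k H j) •
      (dualVec k H j ⊗ₜ[k] dualVec k H i) := by
  apply (DualCop.pair₂ k H).injective
  ext x y
  simp only [TensorProduct.AlgebraTensorModule.curry_apply, TensorProduct.curry_apply,
    LinearMap.restrictScalars_self, DualCop.pair₂_comul, map_sum, LinearMap.sum_apply,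
    DualCop.pair₂_tmul, map_smul, LinearMap.smul_apply]
  conv_lhs => rw [← sum_dualVec_smul (k := k) x, ← sum_dualVec_smul (k := k) y]
  simp only [Finset.sum_mul_sum, map_sum, smul_mul_smul_comm, map_smul, smul_eq_mul]
  refine Finset.sum_congr rfl fun _ _ => Finset.sum_congr rfl fun _ _ => by ring

/-- `∑ eₗ ⊗ Δ(eˡ) = ∑ eᵢ eⱼ ⊗ (eʲ ⊗ eⁱ)`: the coproduct of `H^{*cop}` is dual to the opposite of
the product of `H`. -/
theorem sum_tmul_comul_dualVec (f : H →ₗ[k] V) (g : DualCop k H ⊗[k] DualCop k H →ₗ[k] W) :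
    ∑ l, f (Module.finBasis k H l) ⊗ₜ[k] g (comul (dualVec k H l)) =
    ∑ i, ∑ j, f (Module.finBasis k H i * Module.finBasis k H j) ⊗ₜ[k]
      g (dualVec k H j ⊗ₜ dualVec k H i) := by
  have h1 : ∀ x : H, f x = ∑ l, DualCop.toDual k H (dualVec k H l) x •
      f (Module.finBasis k H l) := by
    intro x
    conv_lhs => rw [← sum_dualVec_smul (k := k) x]
    simp only [map_sum, map_smul]
  simp only [comul_eq_sum_sum_dualVec, map_sum, map_smul, h1 (_ * _), TensorProduct.sum_tmul,
    TensorProduct.tmul_sum, TensorProduct.smul_tmul]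
  rw [Finset.sum_comm]
  refine Finset.sum_congr rfl fun i _ => Finset.sum_comm

end DualBasis

/-! ### The double is quasitriangular -/

namespace DrinfeldDouble

variable {k : Type*} {H : Type*} [Field k] [Ring H] [HopfAlgebra k H] [FiniteDimensional k H]

theorem rMatrix_eq_sum : rMatrix k H = ∑ i,
    inclAlg k H (Module.finBasis k H i) ⊗ₜ[k] inclDualAlg k H (dualVec k H i) := rfl

/-- `x ⊗ y ↦ x · p(y ?)`. -/
noncomputable def inclMulDual (p : DualCop k H) : H ⊗[k] H →ₗ[k] DrinfeldDouble k H :=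
  LinearMap.mul' k _ ∘ₗ TensorProduct.map (inclAlg k H).toLinearMap
    ((inclDualAlg k H).toLinearMap ∘ₗ LinearMap.applyₗ p ∘ₗ (dualLeft k H).toLinearMap ∘ₗ
      antipode k)

/-- `x ⊗ y ↦ p(? x) · y`. -/
noncomputable def dualMulIncl (p : DualCop k H) : H ⊗[k] H →ₗ[k] DrinfeldDouble k H :=
  LinearMap.mul' k _ ∘ₗ TensorProduct.map
    ((inclDualAlg k H).toLinearMap ∘ₗ LinearMap.applyₗ p ∘ₗ (dualRight k H).toLinearMap)
    (inclAlg k H).toLinearMap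

theorem inclMulDual_tmul (p : DualCop k H) (x y : H) : inclMulDual p (x ⊗ₜ y) =
    inclAlg k H x * inclDualAlg k H (dualLeft k H (antipode k y) p) := rfl

theorem dualMulIncl_tmul (p : DualCop k H) (x y : H) : dualMulIncl p (x ⊗ₜ y) =
    inclDualAlg k H (dualRight k H x p) * inclAlg k H y := rfl

/-- The commutation relation of `H` and `H^*` in the double, without inverses of antipodes:
`x₁ · p(x₂ ?) = p(? x₁) · x₂`. -/
theorem inclMulDual_comul (p : DualCop k H) (x : H) :
    inclMulDual p (comul x) = dualMulIncl p (comul x) := by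
  -- the action of `h` on the double is `actRight * actMul * actLeft`; cancel the last factor
  have e : toConv (actH k H).toLinearMap *
      toConv ((actLeft k H).toLinearMap ∘ₗ antipode k) =
      toConv (actRight k H).toLinearMap * toConv (actMul k H).toLinearMap := by
    rw [toConv_actH, mul_assoc, mul_assoc, conv_antipode, mul_one]
  have h := congr(($e : WithConv _).ofConv x (p ⊗ₜ[k] (1 : H)))
  rw [(ℛ k x).convMul_apply, (ℛ k x).convMul_apply, LinearMap.sum_apply, LinearMap.sum_apply] at h
  rw [← (ℛ k x).eq, map_sum, map_sum]
  simp only [inclMulDual_tmul, dualMulIncl_tmul, inclAlg_mul, ← mk_eq]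
  refine Eq.trans h (Finset.sum_congr rfl fun i _ => ?_)
  simp [mk]
  rfl

theorem sum_counit_tmul_dualVec : ∑ l, inclAlg k H (algebraMap k H (counit
    (Module.finBasis k H l))) ⊗ₜ[k] inclDualAlg k H (dualVec k H l) = 1 := by
  have h1 := sum_smul_dualVec (1 : DualCop k H)
  simp only [DualCop.toDual_one] at h1
  simp only [Algebra.algebraMap_eq_smul_one, map_smul, map_one, TensorProduct.smul_tmul]
  rw [← TensorProduct.tmul_sum]
  simp only [← map_smul, ← map_sum]
  rw [h1, map_one, Algebra.TensorProduct.one_def]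

/-- The inverse of the `R`-matrix is `(S ⊗ I)(R)`. -/
theorem rMatrix_mul_sum_antipode : rMatrix k H * (∑ j, inclAlg k H (antipode k
    (Module.finBasis k H j)) ⊗ₜ[k] inclDualAlg k H (dualVec k H j)) = 1 := by
  have h := sum_tmul_dualVec_mul (k := k) (H := H)
    ((inclAlg k H).toLinearMap ∘ₗ LinearMap.mul' k H ∘ₗ (antipode k).lTensor H)
    (inclDualAlg k H).toLinearMap
  rw [rMatrix_eq_sum, Finset.sum_mul_sum]
  simp only [LinearMap.comp_apply, LinearMap.lTensor_tmul, LinearMap.mul'_apply,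
    AlgHom.toLinearMap_apply, map_mul, mul_antipode_lTensor_comul_apply] at h
  simp only [Algebra.TensorProduct.tmul_mul_tmul]
  rw [h, sum_counit_tmul_dualVec]

theorem sum_antipode_mul_rMatrix : (∑ j, inclAlg k H (antipode k
    (Module.finBasis k H j)) ⊗ₜ[k] inclDualAlg k H (dualVec k H j)) * rMatrix k H = 1 := by
  have h := sum_tmul_dualVec_mul (k := k) (H := H)
    ((inclAlg k H).toLinearMap ∘ₗ LinearMap.mul' k H ∘ₗ (antipode k).rTensor H)
    (inclDualAlg k H).toLinearMap
  rw [rMatrix_eq_sum, Finset.sum_mul_sum]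
  simp only [LinearMap.comp_apply, LinearMap.rTensor_tmul, LinearMap.mul'_apply,
    AlgHom.toLinearMap_apply, map_mul, mul_antipode_rTensor_comul_apply] at h
  simp only [Algebra.TensorProduct.tmul_mul_tmul]
  rw [h, sum_counit_tmul_dualVec]

theorem rMatrix_mul_comul_inclAlg (x : H) : rMatrix k H * comul (inclAlg k H x) =
    TensorProduct.comm k _ _ (comul (R := k) (inclAlg k H x)) * rMatrix k H := by
  have h1 : ∀ t : H ⊗[k] H, rMatrix k H *
      Algebra.TensorProduct.map (inclAlg k H) (inclAlg k H) t =
      ∑ i, inclAlg k H (Module.finBasis k H i) ⊗ₜ[k] dualMulIncl (dualVec k H i) t := by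
    intro t
    induction t with
    | zero => simp
    | add u v hu hv =>
      simp only [map_add, mul_add, TensorProduct.tmul_add, Finset.sum_add_distrib, hu, hv]
    | tmul a b =>
      have h := sum_map_tmul_dualVec (k := k) (LinearMap.mulRight k a) (inclAlg k H).toLinearMap
        (LinearMap.mulRight k (inclAlg k H b) ∘ₗ (inclDualAlg k H).toLinearMap)
      simp only [LinearMap.comp_apply, AlgHom.toLinearMap_apply, LinearMap.mulRight_apply,
        map_mul] at h
      simp only [rMatrix_eq_sum, Finset.sum_mul, Algebra.TensorProduct.map_tmul,
        Algebra.TensorProduct.tmul_mul_tmul, dualMulIncl_tmul]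
      rw [h]
      rfl
  have h2 : ∀ t : H ⊗[k] H, TensorProduct.comm k _ _
      (Algebra.TensorProduct.map (inclAlg k H) (inclAlg k H) t) * rMatrix k H =
      ∑ i, inclAlg k H (Module.finBasis k H i) ⊗ₜ[k] inclMulDual (dualVec k H i) t := by
    intro t
    induction t with
    | zero => simp
    | add u v hu hv =>
      simp only [map_add, add_mul, TensorProduct.tmul_add, Finset.sum_add_distrib, hu, hv]
    | tmul a b =>
      have h := sum_map_tmul_dualVec (k := k) (LinearMap.mulLeft k b) (inclAlg k H).toLinearMap
        (LinearMap.mulLeft k (inclAlg k H a) ∘ₗ (inclDualAlg k H).toLinearMap)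
      simp only [LinearMap.comp_apply, AlgHom.toLinearMap_apply, LinearMap.mulLeft_apply,
        map_mul] at h
      simp only [rMatrix_eq_sum, Finset.mul_sum, Algebra.TensorProduct.map_tmul,
        TensorProduct.comm_tmul, Algebra.TensorProduct.tmul_mul_tmul, inclMulDual_tmul]
      rw [h]
      refine Finset.sum_congr rfl fun i _ => ?_
      congr 3
      exact DualCop.ext' fun y => by simp
  rw [comul_inclAlg, h1, h2]
  simp only [inclMulDual_comul]

theorem rMatrix_mul_comul_inclDualAlg (p : DualCop k H) :
    rMatrix k H * comul (inclDualAlg k H p) =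
      TensorProduct.comm k _ _ (comul (R := k) (inclDualAlg k H p)) * rMatrix k H := by
  rw [comul_inclDualAlg]
  trans ∑ l, inclMulDual p (comul (Module.finBasis k H l)) ⊗ₜ[k] inclDualAlg k H (dualVec k H l)
  · have h := sum_tmul_dualVec_mul (k := k) (inclMulDual p) (inclDualAlg k H).toLinearMap
    simp only [AlgHom.toLinearMap_apply] at h
    rw [← h, comul_eq_sum_tmul_dualVec, rMatrix_eq_sum, map_sum, Finset.sum_mul_sum]
    simp only [Algebra.TensorProduct.map_tmul, Algebra.TensorProduct.tmul_mul_tmul,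
      inclMulDual_tmul, map_mul]
  · simp only [inclMulDual_comul]
    have h := sum_tmul_dualVec_mul (k := k) (dualMulIncl p) (inclDualAlg k H).toLinearMap
    simp only [AlgHom.toLinearMap_apply] at h
    rw [← h, comul_eq_sum_dualVec_tmul, rMatrix_eq_sum, map_sum, map_sum, Finset.sum_mul_sum]
    simp only [Algebra.TensorProduct.map_tmul, TensorProduct.comm_tmul,
      Algebra.TensorProduct.tmul_mul_tmul, dualMulIncl_tmul, map_mul]

theorem comulLeft_rMatrix : comulLeft k _ (rMatrix k H) =
    leg13 k _ (rMatrix k H) * leg23 k _ (rMatrix k H) := by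
  have h := sum_tmul_dualVec_mul (k := k) (H := H)
    (Algebra.TensorProduct.map (inclAlg k H) (inclAlg k H)).toLinearMap
    (inclDualAlg k H).toLinearMap
  simp only [AlgHom.toLinearMap_apply, ← comul_inclAlg, Algebra.TensorProduct.map_tmul,
    map_mul] at h
  replace h := congr(TensorProduct.assoc k _ _ _ $h)
  simp only [map_sum, TensorProduct.assoc_tmul] at h
  simp only [rMatrix_eq_sum, map_sum, comulLeft_tmul, leg13_tmul, leg23_tmul, Finset.sum_mul_sum,
    Algebra.TensorProduct.tmul_mul_tmul, one_mul, mul_one]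
  exact h.symm

theorem comulRight_rMatrix : comulRight k _ (rMatrix k H) =
    leg13 k _ (rMatrix k H) * leg12 k _ (rMatrix k H) := by
  have h := sum_tmul_comul_dualVec (k := k) (H := H) (inclAlg k H).toLinearMap
    (Algebra.TensorProduct.map (inclDualAlg k H) (inclDualAlg k H)).toLinearMap
  simp only [AlgHom.toLinearMap_apply, ← comul_inclDualAlg, Algebra.TensorProduct.map_tmul,
    map_mul] at h
  simp only [rMatrix_eq_sum, map_sum, comulRight_tmul, leg13_tmul, leg12_tmul, Finset.sum_mul_sum,
    Algebra.TensorProduct.tmul_mul_tmul, one_mul, mul_one]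
  exact h

/-- The Drinfeld double, with its `R`-matrix, is a quasitriangular Hopf algebra. -/
theorem isQuasitriangular_rMatrix : IsQuasitriangular k (rMatrix k H) where
  isUnit := ⟨⟨_, _, rMatrix_mul_sum_antipode, sum_antipode_mul_rMatrix⟩, rfl⟩
  mul_comul x := by
    induction x using induction_on with
    | h0 => simp
    | hadd u v hu hv => simp only [map_add, mul_add, add_mul, hu, hv]
    | hmk p h =>
      have hc : ∀ u v : DrinfeldDouble k H ⊗[k] DrinfeldDouble k H,
          TensorProduct.comm k _ _ (u * v) =
          TensorProduct.comm k _ _ u * TensorProduct.comm k _ _ v :=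
        map_mul (Algebra.TensorProduct.comm k _ _)
      rw [mk_eq, Bialgebra.comul_mul, ← mul_assoc, rMatrix_mul_comul_inclDualAlg, mul_assoc,
        rMatrix_mul_comul_inclAlg, ← mul_assoc, hc]
  comulLeft_eq := comulLeft_rMatrix
  comulRight_eq := comulRight_rMatrix

end DrinfeldDouble

/-! ### Twisting a quasitriangular Hopf algebra -/

section Permutations

variable (k A : Type*) [Field k] [Ring A] [HopfAlgebra k A]

/-- `a ⊗ b ⊗ c ↦ a ⊗ c ⊗ b`. -/
noncomputable def swap23 : A ⊗[k] (A ⊗[k] A) →ₐ[k] A ⊗[k] (A ⊗[k] A) :=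
  Algebra.TensorProduct.map (AlgHom.id k A) (Algebra.TensorProduct.comm k A A).toAlgHom

/-- `a ⊗ b ⊗ c ↦ b ⊗ a ⊗ c`. -/
noncomputable def swap12 : A ⊗[k] (A ⊗[k] A) →ₐ[k] A ⊗[k] (A ⊗[k] A) :=
  (Algebra.TensorProduct.leftComm k A A A).toAlgHom

/-- `a ⊗ b ⊗ c ↦ b ⊗ c ⊗ a`. -/
noncomputable def rotLeft : A ⊗[k] (A ⊗[k] A) →ₐ[k] A ⊗[k] (A ⊗[k] A) :=
  (Algebra.TensorProduct.assoc k k k A A A).toAlgHom.comp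
    (Algebra.TensorProduct.comm k A (A ⊗[k] A)).toAlgHom

/-- `a ⊗ b ⊗ c ↦ c ⊗ a ⊗ b`. -/
noncomputable def rotRight : A ⊗[k] (A ⊗[k] A) →ₐ[k] A ⊗[k] (A ⊗[k] A) :=
  (Algebra.TensorProduct.comm k (A ⊗[k] A) A).toAlgHom.comp
    (Algebra.TensorProduct.assoc k k k A A A).symm.toAlgHom

variable {k A}

@[simp] theorem swap23_tmul (a b c : A) : swap23 k A (a ⊗ₜ (b ⊗ₜ c)) = a ⊗ₜ (c ⊗ₜ b) := rfl
@[simp] theorem swap12_tmul (a b c : A) : swap12 k A (a ⊗ₜ (b ⊗ₜ c)) = b ⊗ₜ (a ⊗ₜ c) := rfl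
@[simp] theorem rotLeft_tmul (a b c : A) : rotLeft k A (a ⊗ₜ (b ⊗ₜ c)) = b ⊗ₜ (c ⊗ₜ a) := rfl
@[simp] theorem rotRight_tmul (a b c : A) : rotRight k A (a ⊗ₜ (b ⊗ₜ c)) = c ⊗ₜ (a ⊗ₜ b) := rfl

/-- The flip as a homomorphism of algebras. -/
noncomputable abbrev flip (k A : Type*) [Field k] [Ring A] [HopfAlgebra k A] :
    A ⊗[k] A →ₐ[k] A ⊗[k] A :=
  (Algebra.TensorProduct.comm k A A).toAlgHom

theorem swap23_leg12 (t : A ⊗[k] A) : swap23 k A (leg12 k A t) = leg13 k A t := by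
  induction t with
  | zero => simp
  | add u v hu hv => simp only [map_add, hu, hv]
  | tmul a b => simp

theorem swap23_leg23 (t : A ⊗[k] A) : swap23 k A (leg23 k A t) = leg23 k A (flip k A t) := by
  induction t with
  | zero => simp
  | add u v hu hv => simp only [map_add, hu, hv]
  | tmul a b => simp

theorem swap12_leg12 (t : A ⊗[k] A) : swap12 k A (leg12 k A t) = leg12 k A (flip k A t) := by
  induction t with
  | zero => simp
  | add u v hu hv => simp only [map_add, hu, hv]
  | tmul a b => simp

theorem swap12_leg23 (t : A ⊗[k] A) : swap12 k A (leg23 k A t) = leg13 k A t := by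
  induction t with
  | zero => simp
  | add u v hu hv => simp only [map_add, hu, hv]
  | tmul a b => simp

theorem rotLeft_leg12 (t : A ⊗[k] A) : rotLeft k A (leg12 k A t) = leg13 k A (flip k A t) := by
  induction t with
  | zero => simp
  | add u v hu hv => simp only [map_add, hu, hv]
  | tmul a b => simp

theorem rotLeft_leg23 (t : A ⊗[k] A) : rotLeft k A (leg23 k A t) = leg12 k A t := by
  induction t with
  | zero => simp
  | add u v hu hv => simp only [map_add, hu, hv]
  | tmul a b => simp

theorem rotRight_leg12 (t : A ⊗[k] A) : rotRight k A (leg12 k A t) = leg23 k A t := by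
  induction t with
  | zero => simp
  | add u v hu hv => simp only [map_add, hu, hv]
  | tmul a b => simp

theorem rotRight_leg23 (t : A ⊗[k] A) : rotRight k A (leg23 k A t) = leg13 k A (flip k A t) := by
  induction t with
  | zero => simp
  | add u v hu hv => simp only [map_add, hu, hv]
  | tmul a b => simp

theorem rotLeft_comulRight (t : A ⊗[k] A) :
    rotLeft k A (comulRight k A t) = comulLeft k A (flip k A t) := by
  induction t with
  | zero => simp
  | add u v hu hv => simp only [map_add, hu, hv]
  | tmul a b => rfl

theorem rotRight_comulLeft (t : A ⊗[k] A) :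
    rotRight k A (comulLeft k A t) = comulRight k A (flip k A t) := by
  induction t with
  | zero => simp
  | add u v hu hv => simp only [map_add, hu, hv]
  | tmul a b =>
    have h : comulRight k A (flip k A (a ⊗ₜ b)) = b ⊗ₜ comul a := rfl
    rw [h, comulLeft_tmul]
    generalize comul (R := k) a = s
    induction s with
    | zero => simp
    | add u v hu hv => simp only [map_add, TensorProduct.add_tmul, TensorProduct.tmul_add, hu, hv]
    | tmul c d => simp

end Permutations

theorem Twisted.rMatrix_eq {k A : Type*} [Field k] [Ring A] [HopfAlgebra k A] (J : Twist k A)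
    (R : A ⊗[k] A) : Twisted.rMatrix J R =
      (flip k A ↑J.val⁻¹ * R * (J.val : A ⊗[k] A) : A ⊗[k] A) :=
  LinearMap.congr_fun (TensorProduct.map_id (R := k) (M := A) (N := A)) _

namespace IsQuasitriangular

variable {k A : Type*} [Field k] [Ring A] [HopfAlgebra k A] {R : A ⊗[k] A}

/-- `R₂₃` turns the coproduct in the last two legs into the opposite one. -/
theorem leg23_mul_comulRight (hR : IsQuasitriangular k R) (t : A ⊗[k] A) :
    leg23 k A R * comulRight k A t = swap23 k A (comulRight k A t) * leg23 k A R := by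
  induction t with
  | zero => simp
  | add u v hu hv => simp only [map_add, mul_add, add_mul, hu, hv]
  | tmul a b =>
    have h : swap23 k A (a ⊗ₜ comul b) = a ⊗ₜ TensorProduct.comm k A A (comul b) := rfl
    rw [comulRight_tmul, h]
    change (1 ⊗ₜ R) * _ = _ * (1 ⊗ₜ R)
    rw [Algebra.TensorProduct.tmul_mul_tmul, Algebra.TensorProduct.tmul_mul_tmul, one_mul, mul_one,
      hR.mul_comul]

/-- `R₁₂` turns the coproduct in the first two legs into the opposite one. -/
theorem leg12_mul_comulLeft (hR : IsQuasitriangular k R) (t : A ⊗[k] A) :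
    leg12 k A R * comulLeft k A t = swap12 k A (comulLeft k A t) * leg12 k A R := by
  induction t with
  | zero => simp
  | add u v hu hv => simp only [map_add, mul_add, add_mul, hu, hv]
  | tmul a b =>
    have h1 : ∀ s, leg12 k A s = Algebra.TensorProduct.assoc k k k A A A (s ⊗ₜ 1) := by
      intro s
      induction s with
      | zero => simp
      | add u v hu hv => simp only [map_add, TensorProduct.add_tmul, hu, hv]
      | tmul c d => simp
    have h2 : ∀ s : A ⊗[k] A, swap12 k A (Algebra.TensorProduct.assoc k k k A A A (s ⊗ₜ b)) =
        Algebra.TensorProduct.assoc k k k A A A (TensorProduct.comm k A A s ⊗ₜ b) := by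
      intro s
      induction s with
      | zero => simp
      | add u v hu hv => simp only [map_add, TensorProduct.add_tmul, hu, hv]
      | tmul c d => simp
    have h3 : comulLeft k A (a ⊗ₜ b) = Algebra.TensorProduct.assoc k k k A A A (comul a ⊗ₜ b) := rfl
    rw [h3, h2, h1, ← map_mul, ← map_mul, Algebra.TensorProduct.tmul_mul_tmul,
      Algebra.TensorProduct.tmul_mul_tmul, one_mul, mul_one, hR.mul_comul]

/-- `R₁₃` turns `a₁ ⊗ b ⊗ a₂` into `a₂ ⊗ b ⊗ a₁`. -/
theorem leg13_mul_swap23_comulLeft (hR : IsQuasitriangular k R) (t : A ⊗[k] A) :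
    leg13 k A R * swap23 k A (comulLeft k A t) = rotLeft k A (comulLeft k A t) * leg13 k A R := by
  induction t with
  | zero => simp
  | add u v hu hv => simp only [map_add, mul_add, add_mul, hu, hv]
  | tmul a b =>
    have h1 : leg13 k A R = swap12 k A (1 ⊗ₜ R) := (swap12_leg23 R).symm
    have h2 : ∀ s : A ⊗[k] A, swap23 k A (TensorProduct.assoc k A A A (s ⊗ₜ b)) =
        swap12 k A (b ⊗ₜ s) := by
      intro s
      induction s with
      | zero => simp
      | add u v hu hv => simp only [map_add, TensorProduct.add_tmul, TensorProduct.tmul_add, hu, hv]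
      | tmul c d => simp
    have h3 : ∀ s : A ⊗[k] A, rotLeft k A (TensorProduct.assoc k A A A (s ⊗ₜ b)) =
        swap12 k A (b ⊗ₜ TensorProduct.comm k A A s) := by
      intro s
      induction s with
      | zero => simp
      | add u v hu hv => simp only [map_add, TensorProduct.add_tmul, TensorProduct.tmul_add, hu, hv]
      | tmul c d => simp
    rw [comulLeft_tmul, h1, h2, h3, ← map_mul, ← map_mul, Algebra.TensorProduct.tmul_mul_tmul,
      Algebra.TensorProduct.tmul_mul_tmul, one_mul, mul_one, hR.mul_comul]

/-- `R₁₃` turns `b₁ ⊗ a ⊗ b₂` into `b₂ ⊗ a ⊗ b₁`. -/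
theorem leg13_mul_swap12_comulRight (hR : IsQuasitriangular k R) (t : A ⊗[k] A) :
    leg13 k A R * swap12 k A (comulRight k A t) =
      rotRight k A (comulRight k A t) * leg13 k A R := by
  induction t with
  | zero => simp
  | add u v hu hv => simp only [map_add, mul_add, add_mul, hu, hv]
  | tmul a b =>
    have h1 : leg13 k A R = swap12 k A (1 ⊗ₜ R) := (swap12_leg23 R).symm
    have h3 : ∀ s : A ⊗[k] A, rotRight k A (a ⊗ₜ s) =
        swap12 k A (a ⊗ₜ TensorProduct.comm k A A s) := by
      intro s
      induction s with
      | zero => simp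
      | add u v hu hv => simp only [map_add, TensorProduct.tmul_add, hu, hv]
      | tmul c d => simp
    rw [comulRight_tmul, h1, h3, ← map_mul, ← map_mul, Algebra.TensorProduct.tmul_mul_tmul,
      Algebra.TensorProduct.tmul_mul_tmul, one_mul, mul_one, hR.mul_comul]

/-- The computation common to both hexagon identities of `R^J`, in the group of units of
`A ⊗ A ⊗ A`. Here `jₐᵦ` and `rₐᵦ` are the legs of `J` and `R`, and `cl`, `cr` are `(Δ ⊗ I)(J)`,
`(I ⊗ Δ)(J)`, the element `cl'` is `(Δ ⊗ I)(J₂₁)`, and `sl`, `sr` and `p` arise from `cl`, `cr` and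
`cl` by permutations of the legs. The hypotheses are the twist equation `hc`, its permutations `hs` (two legs
exchanged) and `hp` (legs rotated), and the quasi-cocommutativity of `R` in two pairs of legs.
For the second hexagon, the pairs of legs 12 and 23, and the maps `Δ ⊗ I` and `I ⊗ Δ`, exchange
their roles. -/
theorem twist_hexagon {G : Type*} [Group G] {j12 j13 j23 j31 j32 cl cr cl' sl sr p r13 r23 : G}
    (hc : cl * j12 = cr * j23) (hs : sl * j13 = sr * j32) (hp : p * j31 = cl' * j12)
    (h23 : r23 * cr = sr * r23) (h13 : r13 * sl = p * r13) :
    j12⁻¹ * (cl'⁻¹ * (r13 * r23) * cl) * j12 =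
      j31⁻¹ * r13 * j13 * (j32⁻¹ * r23 * j23) := by
  have hs' : sr = sl * j13 * j32⁻¹ := by rw [hs]; group
  have hp' : p = cl' * j12 * j31⁻¹ := by rw [← hp]; group
  calc j12⁻¹ * (cl'⁻¹ * (r13 * r23) * cl) * j12
      = j12⁻¹ * cl'⁻¹ * r13 * r23 * (cl * j12) := by group
    _ = j12⁻¹ * cl'⁻¹ * r13 * (r23 * cr) * j23 := by rw [hc]; group
    _ = j12⁻¹ * cl'⁻¹ * (r13 * sl) * j13 * j32⁻¹ * r23 * j23 := by rw [h23, hs']; group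
    _ = _ := by rw [h13, hp']; group

/-- If `(A, R)` is quasitriangular, so is `(A^J, R^J)`. -/
theorem twisted (hR : IsQuasitriangular k R) (J : Twist k A) :
    IsQuasitriangular k (Twisted.rMatrix J R) := by
  obtain ⟨r, rfl⟩ := hR.isUnit
  let u (f : A ⊗[k] A →ₐ[k] A ⊗[k] (A ⊗[k] A)) : (A ⊗[k] A)ˣ →* (A ⊗[k] (A ⊗[k] A))ˣ :=
    Units.map f.toMonoidHom
  let J' : (A ⊗[k] A)ˣ := Units.map (flip k A).toMonoidHom J.val
  let RJ : (A ⊗[k] A)ˣ := J'⁻¹ * r * J.val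
  have hRJ : Twisted.rMatrix J (r : A ⊗[k] A) = (RJ : A ⊗[k] A) := Twisted.rMatrix_eq J _
  refine ⟨?_, ?_, ?_, ?_⟩
  · rw [hRJ]
    exact RJ.isUnit
  · intro x
    rw [hRJ]
    have hc : ∀ u v : A ⊗[k] A, TensorProduct.comm k _ _ (u * v) =
        TensorProduct.comm k _ _ u * TensorProduct.comm k _ _ v :=
      map_mul (Algebra.TensorProduct.comm k _ _)
    suffices h : ∀ y : A, (RJ : A ⊗[k] A) * J.comulJ y =
        TensorProduct.comm k A A (J.comulJ y) * RJ from h x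
    intro y
    have e1 : TensorProduct.comm k A A J.val = J' := rfl
    have e2 : TensorProduct.comm k A A ↑J.val⁻¹ = ↑J'⁻¹ := rfl
    simp only [RJ, Twist.comulJ_apply, Units.val_mul, hc, e1, e2, mul_assoc,
      Units.mul_inv_cancel_left]
    rw [← mul_assoc (r : A ⊗[k] A), hR.mul_comul]
    simp only [mul_assoc]
  · rw [hRJ]
    change TensorProduct.assoc k A A A (J.comulJ.rTensor A (RJ : A ⊗[k] A)) =
      leg13 k A RJ * leg23 k A RJ
    rw [Twist.comulJ_left]
    have h := twist_hexagon (G := (A ⊗[k] (A ⊗[k] A))ˣ) (j12 := u (leg12 k A) J.val)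
      (j13 := u (leg13 k A) J.val) (j23 := u (leg23 k A) J.val) (j31 := u (leg13 k A) J')
      (j32 := u (leg23 k A) J') (cl := u (comulLeft k A) J.val) (cr := u (comulRight k A) J.val)
      (cl' := u (comulLeft k A) J') (sl := u ((swap23 k A).comp (comulLeft k A)) J.val)
      (sr := u ((swap23 k A).comp (comulRight k A)) J.val)
      (p := u ((rotLeft k A).comp (comulLeft k A)) J.val)
      (r13 := u (leg13 k A) r) (r23 := u (leg23 k A) r)
      (Units.ext J.cocycle)
      (Units.ext (by
        have h := congr(swap23 k A $(J.cocycle))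
        rw [map_mul, map_mul, swap23_leg12, swap23_leg23] at h
        exact h))
      (Units.ext (by
        have h := congr(rotLeft k A $(J.cocycle))
        rw [map_mul, map_mul, rotLeft_leg12, rotLeft_leg23, rotLeft_comulRight] at h
        exact h))
      (Units.ext (hR.leg23_mul_comulRight _)) (Units.ext (hR.leg13_mul_swap23_comulLeft _))
    have h0 : u (comulLeft k A) r = u (leg13 k A) r * u (leg23 k A) r := Units.ext hR.comulLeft_eq
    rw [← h0] at h
    simp only [← map_mul, ← map_inv] at h
    exact congr(($h : A ⊗[k] (A ⊗[k] A)))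
  · rw [hRJ]
    change J.comulJ.lTensor A (RJ : A ⊗[k] A) = leg13 k A RJ * leg12 k A RJ
    rw [Twist.comulJ_right]
    have h := twist_hexagon (G := (A ⊗[k] (A ⊗[k] A))ˣ) (j12 := u (leg23 k A) J.val)
      (j13 := u (leg13 k A) J.val) (j23 := u (leg12 k A) J.val) (j31 := u (leg13 k A) J')
      (j32 := u (leg12 k A) J') (cl := u (comulRight k A) J.val) (cr := u (comulLeft k A) J.val)
      (cl' := u (comulRight k A) J') (sl := u ((swap12 k A).comp (comulRight k A)) J.val)
      (sr := u ((swap12 k A).comp (comulLeft k A)) J.val)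
      (p := u ((rotRight k A).comp (comulRight k A)) J.val)
      (r13 := u (leg13 k A) r) (r23 := u (leg12 k A) r)
      (Units.ext J.cocycle.symm)
      (Units.ext (by
        have h := congr(swap12 k A $(J.cocycle))
        rw [map_mul, map_mul, swap12_leg12, swap12_leg23] at h
        exact h.symm))
      (Units.ext (by
        have h := congr(rotRight k A $(J.cocycle))
        rw [map_mul, map_mul, rotRight_leg12, rotRight_leg23, rotRight_comulLeft] at h
        exact h.symm))
      (Units.ext (hR.leg12_mul_comulLeft _)) (Units.ext (hR.leg13_mul_swap12_comulRight _))
    have h0 : u (comulRight k A) r = u (leg13 k A) r * u (leg12 k A) r :=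
      Units.ext hR.comulRight_eq
    rw [← h0] at h
    simp only [← map_mul, ← map_inv] at h
    exact congr(($h : A ⊗[k] (A ⊗[k] A)))

end IsQuasitriangular

/-! ### A universal property of the double -/

section Contraction

variable {k V W : Type*} [Field k] [AddCommGroup V] [Module k V] [AddCommGroup W] [Module k W]

/-- The contraction `v ⊗ w ↦ p(v) w` of the first tensor factor with a functional. -/
noncomputable def contract (p : Module.Dual k V) : V ⊗[k] W →ₗ[k] W :=
  (TensorProduct.lid k W).toLinearMap ∘ₗ p.rTensor W

@[simp] theorem contract_tmul (p : Module.Dual k V) (v : V) (w : W) :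
    contract p (v ⊗ₜ[k] w) = p v • w := by
  simp [contract]

end Contraction

/-- Dropping a convolution factor: if `m f(h) = f'(h₁) m g'(h₂)` and `g' * g = 1`, then `m`
intertwines `f * g` with `f'`. -/
theorem inter_mul_of_mul_eq_one {k H V W : Type*} [Field k] [Ring H] [HopfAlgebra k H]
    [AddCommGroup V] [Module k V] [AddCommGroup W] [Module k W] (m : W →ₗ[k] V)
    {f g g' : WithConv (H →ₗ[k] Module.End k W)} (f' : H →ₗ[k] Module.End k V)
    (hg : g' * g = 1)
    (hf : ∀ h w, m (f.ofConv h w) = ∑ i ∈ (ℛ k h).index,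
      f' ((ℛ k h).left i) (m (g'.ofConv ((ℛ k h).right i) w))) :
    Inter m (toConv f') (f * g) := by
  intro h w
  let α : H ⊗[k] H →ₗ[k] V := m ∘ₗ LinearMap.applyₗ w ∘ₗ LinearMap.mul' k (Module.End k W) ∘ₗ
    TensorProduct.map g'.ofConv g.ofConv
  let Ω : H ⊗[k] (H ⊗[k] H) →ₗ[k] V :=
    TensorProduct.lift (LinearMap.compl₂ (f' : H →ₗ[k] V →ₗ[k] V) α)
  have hΩ : ∀ x t, Ω (x ⊗ₜ t) = f' x (α t) := fun x t => by simp [Ω]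
  have hα : ∀ y, α (comul y) = counit (R := k) y • m w := by
    intro y
    have h1 := congr(m (($hg : WithConv _).ofConv y w))
    rw [(ℛ k y).convMul_apply] at h1
    rw [← (ℛ k y).eq]
    simpa [α, Algebra.algebraMap_eq_smul_one] using h1
  have h1 : m ((f * g).ofConv h w) =
      Ω (TensorProduct.assoc k H H H (comul.rTensor H (comul h))) := by
    rw [(ℛ k h).convMul_apply]
    conv_rhs => rw [← (ℛ k h).eq]
    simp only [LinearMap.sum_apply, map_sum, Module.End.mul_apply, hf, LinearMap.rTensor_tmul]
    refine Finset.sum_congr rfl fun i _ => ?_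
    rw [← (ℛ k ((ℛ k h).left i)).eq]
    simp only [TensorProduct.sum_tmul, map_sum, TensorProduct.assoc_tmul, hΩ]
    rfl
  have h2 : Ω (comul.lTensor H (comul h)) = f' h (m w) := by
    conv_rhs => rw [← counitRight_comul (k := k) h]
    generalize comul (R := k) h = t
    induction t with
    | zero => simp
    | add u v hu hv => simp only [map_add, LinearMap.add_apply, hu, hv]
    | tmul a b => simp [hΩ, hα]
  rw [h1, coassoc_apply, h2]

section Universal

variable {k K A : Type*} [Field k] [Ring K] [HopfAlgebra k K] [FiniteDimensional k K]
  [Ring A] [HopfAlgebra k A]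

/-- The linear map `H^* → A`, `p ↦ (p ⊗ I)(X)`, given by an element `X` of `H ⊗ A`. -/
noncomputable def dualHom (X : K ⊗[k] A) : DualCop k K →ₗ[k] A where
  toFun p := contract (DualCop.toDual k K p) X
  map_add' p q := by simp [contract, LinearMap.rTensor_add]
  map_smul' c p := by simp [contract, LinearMap.rTensor_smul]

/-- An element of `H ⊗ A` is recovered from its contractions. -/
theorem sum_tmul_dualHom (X : K ⊗[k] A) :
    ∑ j, Module.finBasis k K j ⊗ₜ[k] dualHom X (dualVec k K j) = X := by
  have h : ∀ X : K ⊗[k] A, ∑ j, Module.finBasis k K j ⊗ₜ[k]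
      contract (DualCop.toDual k K (dualVec k K j)) X = X := by
    intro X
    induction X with
    | zero => simp
    | add u v hu hv => simp only [map_add, TensorProduct.tmul_add, Finset.sum_add_distrib, hu, hv]
    | tmul a c =>
      simp only [contract_tmul, ← TensorProduct.smul_tmul, ← TensorProduct.sum_tmul,
        sum_dualVec_smul]
  exact h X

theorem sum_smul_dualHom (X : K ⊗[k] A) (p : DualCop k K) :
    ∑ j, DualCop.toDual k K p (Module.finBasis k K j) • dualHom X (dualVec k K j) =
      dualHom X p := by
  simp only [← map_smul, ← map_sum, sum_smul_dualVec]

/-- Applying `ε` to the first leg of `(Δ ⊗ I)(R) = R₁₃ R₂₃` gives `R = (1 ⊗ (ε ⊗ I)(R)) R`. -/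
theorem IsQuasitriangular.counitLeft_eq {R : A ⊗[k] A} (hR : IsQuasitriangular k R) :
    counitLeft k A R = 1 := by
  let f : A ⊗[k] (A ⊗[k] A) →ₐ[k] A ⊗[k] A :=
    (Algebra.TensorProduct.lid k (A ⊗[k] A)).toAlgHom.comp
      (Algebra.TensorProduct.map (Bialgebra.counitAlgHom k A) (AlgHom.id k (A ⊗[k] A)))
  have hf : ∀ (a : A) (t : A ⊗[k] A), f (a ⊗ₜ t) = counit (R := k) a • t := fun _ _ => rfl
  have h1 : ∀ t, f (comulLeft k A t) = t := by
    intro t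
    induction t with
    | zero => simp
    | add u v hu hv => simp only [map_add, hu, hv]
    | tmul a b =>
      have h : ∀ s : A ⊗[k] A, f (TensorProduct.assoc k A A A (s ⊗ₜ b)) =
          counitLeft k A s ⊗ₜ b := by
        intro s
        induction s with
        | zero => simp
        | add u v hu hv => simp only [map_add, TensorProduct.add_tmul, hu, hv]
        | tmul c d => simp [hf, TensorProduct.smul_tmul']
      rw [comulLeft_tmul, h, counitLeft_comul]
  have h2 : ∀ t, f (leg13 k A t) = 1 ⊗ₜ counitLeft k A t := by
    intro t
    induction t with
    | zero => simp
    | add u v hu hv => simp only [map_add, TensorProduct.tmul_add, hu, hv]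
    | tmul a b => simp [hf]
  have h3 : ∀ t, f (leg23 k A t) = t := by
    intro t
    rw [leg23, Algebra.TensorProduct.includeRight_apply, hf, Bialgebra.counit_one, one_smul]
  have h := congr(f $(hR.comulLeft_eq))
  rw [map_mul, h1, h2, h3] at h
  have h4 := hR.isUnit.mul_right_cancel ((one_mul R).trans h)
  have h5 := congr(counitLeft k A $h4)
  rw [map_one, counitLeft_tmul, Bialgebra.counit_one, one_smul] at h5
  exact h5.symm

/-- Applying `ε` to the last leg of `(I ⊗ Δ)(R) = R₁₃ R₁₂` gives `R = ((I ⊗ ε)(R) ⊗ 1) R`. -/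
theorem IsQuasitriangular.counitRight_eq {R : A ⊗[k] A} (hR : IsQuasitriangular k R) :
    counitRight k A R = 1 := by
  let f : A ⊗[k] (A ⊗[k] A) →ₐ[k] A ⊗[k] A :=
    Algebra.TensorProduct.map (AlgHom.id k A) (counitRight k A)
  have h1 : ∀ t, f (comulRight k A t) = t := by
    intro t
    induction t with
    | zero => simp
    | add u v hu hv => simp only [map_add, hu, hv]
    | tmul a b => simp [f, counitRight_comul]
  have h2 : ∀ t, f (leg13 k A t) = counitRight k A t ⊗ₜ 1 := by
    intro t
    induction t with
    | zero => simp
    | add u v hu hv => simp only [map_add, TensorProduct.add_tmul, hu, hv]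
    | tmul a b => simp [f, TensorProduct.smul_tmul']
  have h3 : ∀ t, f (leg12 k A t) = t := by
    intro t
    induction t with
    | zero => simp
    | add u v hu hv => simp only [map_add, hu, hv]
    | tmul a b => simp [f]
  have h := congr(f $(hR.comulRight_eq))
  rw [map_mul, h1, h2, h3] at h
  have h4 := hR.isUnit.mul_right_cancel ((one_mul R).trans h)
  have h5 := congr(counitRight k A $h4)
  rw [map_one, counitRight_tmul, Bialgebra.counit_one, one_smul] at h5
  exact h5.symm

variable (i : K →ₐc[k] A) (X : K ⊗[k] A)

/-- The image in `A ⊗ A` of an element of `H ⊗ A`. -/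
noncomputable def pushLeft : K ⊗[k] A →ₐ[k] A ⊗[k] A :=
  Algebra.TensorProduct.map (i : K →ₐ[k] A) (AlgHom.id k A)

theorem pushLeft_eq_sum : pushLeft i X =
    ∑ j, i (Module.finBasis k K j) ⊗ₜ[k] dualHom X (dualVec k K j) := by
  conv_lhs => rw [← sum_tmul_dualHom X]
  simp [pushLeft]

theorem comul_map (x : K) : comul (R := k) (i x) = TensorProduct.map (i : K →ₗ[k] A)
    (i : K →ₗ[k] A) (comul x) :=
  (CoalgHomClass.map_comp_comul_apply i x).symm

variable {i X}

theorem dualHom_one (hR : IsQuasitriangular k (pushLeft i X)) : dualHom X 1 = 1 := by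
  have h := hR.counitLeft_eq
  rw [pushLeft_eq_sum, map_sum] at h
  rw [← h, ← sum_smul_dualHom]
  simp

/-- The first leg of `R` lies in `i(H)`, so contracting `(Δ ⊗ I)(R) = R₁₃ R₂₃` with `p` and `q`
gives the multiplicativity of `p ↦ (p ⊗ I)(R)`. The functionals on `H` are extended to `A` along
a linear retraction of `i`. -/
theorem dualHom_mul (hi : Function.Injective i) (hR : IsQuasitriangular k (pushLeft i X))
    (p q : DualCop k K) : dualHom X (p * q) = dualHom X p * dualHom X q := by
  obtain ⟨π, hπ⟩ := LinearMap.exists_leftInverse_of_injective (i : K →ₗ[k] A)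
    (LinearMap.ker_eq_bot.mpr hi)
  replace hπ : ∀ x, π (i x) = x := fun x => congr($hπ x)
  let Λ : A ⊗[k] (A ⊗[k] A) →ₗ[k] A :=
    contract (DualCop.toDual k K q ∘ₗ π) ∘ₗ contract (DualCop.toDual k K p ∘ₗ π)
  have h1 : ∀ (t : K ⊗[k] K) (y : A), Λ (TensorProduct.assoc k A A A
      (TensorProduct.map (i : K →ₗ[k] A) (i : K →ₗ[k] A) t ⊗ₜ y)) =
      TensorProduct.dualDistrib k K K (DualCop.toDual k K p ⊗ₜ DualCop.toDual k K q) t • y := by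
    intro t y
    induction t with
    | zero => simp
    | add u v hu hv => simp only [map_add, TensorProduct.add_tmul, add_smul, hu, hv]
    | tmul a b => simp [Λ, hπ, smul_smul]
  have h := congr(Λ $(hR.comulLeft_eq))
  rw [pushLeft_eq_sum, map_sum, map_sum, map_sum, map_sum, Finset.sum_mul_sum] at h
  simp only [comulLeft_tmul, comul_map, h1, leg13_tmul, leg23_tmul, map_sum,
    ← DualCop.toDual_mul', sum_smul_dualHom] at h
  rw [h, ← sum_smul_dualHom X p, ← sum_smul_dualHom X q, Finset.sum_mul_sum]
  refine Finset.sum_congr rfl fun a _ => Finset.sum_congr rfl fun b _ => ?_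
  simp [Λ, hπ, smul_smul, mul_comm]

theorem counit_dualHom (hi : Function.Injective i) (hR : IsQuasitriangular k (pushLeft i X))
    (p : DualCop k K) : counit (R := k) (dualHom X p) = counit (R := k) p := by
  obtain ⟨π, hπ⟩ := LinearMap.exists_leftInverse_of_injective (i : K →ₗ[k] A)
    (LinearMap.ker_eq_bot.mpr hi)
  replace hπ : ∀ x, π (i x) = x := fun x => congr($hπ x)
  have h := congr(DualCop.toDual k K p (π $(hR.counitRight_eq)))
  have h1 : π 1 = 1 := by rw [← map_one i, hπ]
  rw [pushLeft_eq_sum, h1, ← DualCop.counit_apply] at h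
  rw [← h, ← sum_smul_dualHom]
  simp [hπ, mul_comm]

/-- The contraction of `(I ⊗ Δ)(R) = R₁₃ R₁₂` with `p`. -/
theorem comul_dualHom (hi : Function.Injective i) (hR : IsQuasitriangular k (pushLeft i X))
    (p : DualCop k K) : comul (R := k) (dualHom X p) =
      TensorProduct.map (dualHom X) (dualHom X) (comul p) := by
  obtain ⟨π, hπ⟩ := LinearMap.exists_leftInverse_of_injective (i : K →ₗ[k] A)
    (LinearMap.ker_eq_bot.mpr hi)
  replace hπ : ∀ x, π (i x) = x := fun x => congr($hπ x)
  have h := congr(contract (DualCop.toDual k K p ∘ₗ π) $(hR.comulRight_eq))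
  rw [pushLeft_eq_sum, map_sum, map_sum, map_sum, map_sum, Finset.sum_mul_sum] at h
  simp only [comulRight_tmul, leg13_tmul, leg12_tmul, map_sum, contract_tmul,
    Algebra.TensorProduct.tmul_mul_tmul, one_mul, mul_one, ← map_mul, LinearMap.comp_apply,
    hπ] at h
  rw [comul_eq_sum_sum_dualVec, ← sum_smul_dualHom X p]
  simp only [map_sum, map_smul, TensorProduct.map_tmul, h]

/-- The commutation relation of the images of `H` and `H^*` in `A`:
`p(? x₁) · x₂ = x₁ · p(x₂ ?)`. It is the contraction of `R Δ(x) = Δᵒᵖ(x) R` with `p`. -/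
theorem sum_dualHom_mul (hi : Function.Injective i) (hR : IsQuasitriangular k (pushLeft i X))
    (p : DualCop k K) (x : K) :
    ∑ j ∈ (ℛ k x).index, dualHom X (dualRight k K ((ℛ k x).left j) p) * i ((ℛ k x).right j) =
    ∑ j ∈ (ℛ k x).index, i ((ℛ k x).left j) *
      dualHom X (dualLeft k K (antipode k ((ℛ k x).right j)) p) := by
  obtain ⟨π, hπ⟩ := LinearMap.exists_leftInverse_of_injective (i : K →ₗ[k] A)
    (LinearMap.ker_eq_bot.mpr hi)
  replace hπ : ∀ x, π (i x) = x := fun x => congr($hπ x)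
  have h := congr(contract (DualCop.toDual k K p ∘ₗ π) $(hR.mul_comul (i x)))
  have h1 : ∀ a b : K, contract (DualCop.toDual k K p ∘ₗ π) (pushLeft i X * (i a ⊗ₜ i b)) =
      dualHom X (dualRight k K a p) * i b := by
    intro a b
    rw [pushLeft_eq_sum, Finset.sum_mul, map_sum, ← sum_smul_dualHom, Finset.sum_mul]
    simp only [Algebra.TensorProduct.tmul_mul_tmul, ← map_mul, contract_tmul,
      LinearMap.comp_apply, hπ, toDual_dualRight, smul_mul_assoc]
  have h2 : ∀ a b : K, contract (DualCop.toDual k K p ∘ₗ π) ((i b ⊗ₜ i a) * pushLeft i X) =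
      i a * dualHom X (dualLeft k K (antipode k b) p) := by
    intro a b
    rw [pushLeft_eq_sum, Finset.mul_sum, map_sum, ← sum_smul_dualHom, Finset.mul_sum]
    simp only [Algebra.TensorProduct.tmul_mul_tmul, ← map_mul, contract_tmul,
      LinearMap.comp_apply, hπ, toDual_dualLeft, antipodeInv_antipode, mul_smul_comm]
  rw [comul_map, ← (ℛ k x).eq] at h
  simp only [map_sum, Finset.mul_sum, Finset.sum_mul, TensorProduct.map_tmul,
    TensorProduct.comm_tmul] at h
  exact (Finset.sum_congr rfl fun j _ => (h1 _ _).symm).trans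
    (h.trans (Finset.sum_congr rfl fun j _ => h2 _ _))

variable (i X) in
/-- The linear map `D(H) → A`, `p ⊗ x ↦ (p ⊗ I)(X) i(x)`. -/
noncomputable def doubleLift : DualCop k K ⊗[k] K →ₗ[k] A :=
  LinearMap.mul' k A ∘ₗ TensorProduct.map (dualHom X) (i : K →ₗ[k] A)

@[simp] theorem doubleLift_tmul (p : DualCop k K) (x : K) :
    doubleLift i X (p ⊗ₜ x) = dualHom X p * i x := rfl

theorem doubleLift_actH (hi : Function.Injective i) (hR : IsQuasitriangular k (pushLeft i X))
    (x : K) (w : DualCop k K ⊗[k] K) :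
    doubleLift i X (actH k K x w) = i x * doubleLift i X w := by
  have h := inter_mul_of_mul_eq_one (doubleLift i X)
    (f := toConv (actRight k K).toLinearMap * toConv (actMul k K).toLinearMap)
    (g := toConv (actLeft k K).toLinearMap)
    (g' := toConv ((actLeft k K).toLinearMap ∘ₗ antipode k))
    ((Algebra.lmul k A).toLinearMap ∘ₗ (i : K →ₗ[k] A)) (antipode_conv _) (by
      intro x w
      rw [(ℛ k x).convMul_apply]
      induction w with
      | zero => simp
      | add u v hu hv => simp only [map_add, Finset.sum_add_distrib, hu, hv]
      | tmul q g =>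
        have h1 := congr($(sum_dualHom_mul hi hR q x) * i g)
        rw [Finset.sum_mul, Finset.sum_mul] at h1
        simp only [LinearMap.sum_apply, map_sum]
        refine Eq.trans (Finset.sum_congr rfl fun j _ => ?_)
          (h1.trans (Finset.sum_congr rfl fun j _ => ?_))
        · simp [mul_assoc]
        · simp [mul_assoc]) x w
  rw [mul_assoc, ← toConv_actH] at h
  exact h.symm

theorem doubleLift_actDual (hi : Function.Injective i)
    (hR : IsQuasitriangular k (pushLeft i X)) (p : DualCop k K) (w : DualCop k K ⊗[k] K) :
    doubleLift i X (actDual k K p w) = dualHom X p * doubleLift i X w := by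
  induction w with
  | zero => simp
  | add u v hu hv => simp only [map_add, mul_add, hu, hv]
  | tmul q g => simp [dualHom_mul hi hR, mul_assoc]

theorem doubleLift_doubleMul (hi : Function.Injective i)
    (hR : IsQuasitriangular k (pushLeft i X)) (v w : DualCop k K ⊗[k] K) :
    doubleLift i X (doubleMul k K v w) = doubleLift i X v * doubleLift i X w := by
  induction v with
  | zero => simp
  | add u v hu hv => simp only [map_add, LinearMap.add_apply, add_mul, hu, hv]
  | tmul p h =>
    rw [doubleMul_tmul, doubleLift_actDual hi hR, doubleLift_actH hi hR, ← mul_assoc,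
      doubleLift_tmul]

/-- The algebra homomorphism `D(H) → A` defined by a bialgebra homomorphism `i : H → A` and
an `R`-matrix of `A` that lies in `i(H) ⊗ A`. -/
noncomputable def doubleLiftAlgHom (hi : Function.Injective i)
    (hR : IsQuasitriangular k (pushLeft i X)) : DrinfeldDouble k K →ₐ[k] A :=
  AlgHom.ofLinearMap (doubleLift i X)
    (by
      refine (doubleLift_tmul (i := i) (X := X) 1 1).trans ?_
      rw [dualHom_one hR, map_one, mul_one])
    (doubleLift_doubleMul hi hR)

theorem doubleLiftAlgHom_inclDualAlg (hi : Function.Injective i)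
    (hR : IsQuasitriangular k (pushLeft i X)) (p : DualCop k K) :
    doubleLiftAlgHom hi hR (DrinfeldDouble.inclDualAlg k K p) = dualHom X p := by
  refine (doubleLift_tmul (i := i) (X := X) p 1).trans ?_
  rw [map_one, mul_one]

theorem doubleLiftAlgHom_inclAlg (hi : Function.Injective i)
    (hR : IsQuasitriangular k (pushLeft i X)) (x : K) :
    doubleLiftAlgHom hi hR (DrinfeldDouble.inclAlg k K x) = i x := by
  refine (doubleLift_tmul (i := i) (X := X) 1 x).trans ?_
  rw [dualHom_one hR, one_mul]

/-- Algebra homomorphisms out of the double are determined on `H^*` and `H`. -/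
theorem DrinfeldDouble.algHom_ext {B : Type*} [Ring B] [Algebra k B]
    {f g : DrinfeldDouble k K →ₐ[k] B}
    (h1 : ∀ p, f (DrinfeldDouble.inclDualAlg k K p) = g (DrinfeldDouble.inclDualAlg k K p))
    (h2 : ∀ x, f (DrinfeldDouble.inclAlg k K x) = g (DrinfeldDouble.inclAlg k K x)) : f = g := by
  ext x
  induction x using DrinfeldDouble.induction_on with
  | h0 => simp
  | hadd u v hu hv => simp only [map_add, hu, hv]
  | hmk p h => rw [DrinfeldDouble.mk_eq, map_mul, map_mul, h1, h2]

/-- The homomorphism of bialgebras `D(H) → A` defined by a bialgebra homomorphism `i : H → A`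
and an `R`-matrix of `A` that lies in `i(H) ⊗ A`. -/
noncomputable def doubleLiftBialgHom (hi : Function.Injective i)
    (hR : IsQuasitriangular k (pushLeft i X)) : DrinfeldDouble k K →ₐc[k] A :=
  BialgHom.ofAlgHom (doubleLiftAlgHom hi hR)
    (by
      refine DrinfeldDouble.algHom_ext (fun p => ?_) fun x => ?_
      · refine (congrArg (counit (R := k)) (doubleLiftAlgHom_inclDualAlg hi hR p)).trans ?_
        rw [counit_dualHom hi hR]
        exact (CoalgHomClass.counit_comp_apply (DrinfeldDouble.inclDual k K) p).symm
      · refine (congrArg (counit (R := k)) (doubleLiftAlgHom_inclAlg hi hR x)).trans ?_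
        rw [CoalgHomClass.counit_comp_apply]
        exact (CoalgHomClass.counit_comp_apply (DrinfeldDouble.incl k K) x).symm)
    (by
      refine DrinfeldDouble.algHom_ext (fun p => ?_) fun x => ?_
      · refine Eq.trans ?_ (congrArg (comul (R := k))
          (doubleLiftAlgHom_inclDualAlg hi hR p)).symm
        rw [comul_dualHom hi hR]
        refine (congrArg (Algebra.TensorProduct.map _ _)
          (DrinfeldDouble.comul_inclDualAlg p)).trans ?_
        generalize comul (R := k) p = t
        induction t with
        | zero => simp
        | add u v hu hv => simp only [map_add, hu, hv]
        | tmul a b => simp [doubleLiftAlgHom_inclDualAlg]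
      · refine Eq.trans ?_ (congrArg (comul (R := k)) (doubleLiftAlgHom_inclAlg hi hR x)).symm
        rw [comul_map]
        refine (congrArg (Algebra.TensorProduct.map _ _)
          (DrinfeldDouble.comul_inclAlg x)).trans ?_
        generalize comul (R := k) x = t
        induction t with
        | zero => simp
        | add u v hu hv => simp only [map_add, hu, hv]
        | tmul a b => simp [doubleLiftAlgHom_inclAlg])

theorem map_doubleLiftAlgHom_rMatrix (hi : Function.Injective i)
    (hR : IsQuasitriangular k (pushLeft i X)) :
    TensorProduct.map (doubleLiftAlgHom hi hR).toLinearMap (doubleLiftAlgHom hi hR).toLinearMap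
      (DrinfeldDouble.rMatrix k K) = pushLeft i X := by
  rw [DrinfeldDouble.rMatrix_eq_sum, pushLeft_eq_sum, map_sum]
  simp only [TensorProduct.map_tmul, AlgHom.toLinearMap_apply, doubleLiftAlgHom_inclAlg,
    doubleLiftAlgHom_inclDualAlg]

end Universal

/-! ### The double of a twisted Hopf algebra -/

/-- A homomorphism of bialgebras between Hopf algebras commutes with the antipodes. -/
theorem map_antipode {k A B : Type*} [Field k] [Ring A] [HopfAlgebra k A] [Ring B]
    [HopfAlgebra k B] (f : A →ₐc[k] B) (x : A) : f (antipode k x) = antipode k (f x) := by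
  have h1 := LinearMap.convMul_comp_coalgHom_distrib (R := k)
    (toConv (antipode k (A := B))) (toConv LinearMap.id) (f : A →ₗc[k] B)
  rw [LinearMap.antipode_mul_id] at h1
  have h2 : toConv (antipode k (A := B) ∘ₗ (f : A →ₗ[k] B)) *
      toConv ((f : A →ₐ[k] B) : A →ₗ[k] B) = 1 := by
    apply WithConv.ext
    refine Eq.trans h1.symm ?_
    ext x
    simp [LinearMap.convOne_def]
  have h3 := left_inv_eq_right_inv h2 (conv_antipode (f : A →ₐ[k] B))
  exact congr(($h3 : WithConv _).ofConv x).symm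

/-- A homomorphism of Hopf algebras, regarded as a homomorphism of the twisted Hopf algebras. -/
noncomputable def Twisted.map {k A B : Type*} [Field k] [Ring A] [HopfAlgebra k A] [Ring B]
    [HopfAlgebra k B] (f : A →ₐc[k] B) (J : Twist k A) : Twisted J →ₐc[k] Twisted (J.map f) :=
  BialgHom.ofAlgHom
    ((Twisted.of (J.map f)).toAlgHom.comp ((f : A →ₐ[k] B).comp (Twisted.of J).symm.toAlgHom))
    (AlgHom.ext fun x => by
      have h : ∀ y : A, counit (R := k) (f y) = counit (R := k) y :=
        CoalgHomClass.counit_comp_apply f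
      exact h x)
    (AlgHom.ext fun x => by
      let F : A ⊗[k] A →ₐ[k] B ⊗[k] B :=
        Algebra.TensorProduct.map (f : A →ₐ[k] B) (f : A →ₐ[k] B)
      have h : ∀ y : A, F (J.comulJ y) = (J.map f).comulJ (f y) := by
        intro y
        have e1 : F ↑J.val⁻¹ = ↑(J.map f).val⁻¹ := rfl
        have e2 : F ↑J.val = ↑(J.map f).val := rfl
        have e3 : F (comul y) = comul (f y) := CoalgHomClass.map_comp_comul_apply f y
        rw [Twist.comulJ_apply, Twist.comulJ_apply, map_mul, map_mul, e1, e2, e3]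
      exact h x)

theorem Twisted.map_injective {k A B : Type*} [Field k] [Ring A] [HopfAlgebra k A] [Ring B]
    [HopfAlgebra k B] {f : A →ₐc[k] B} (hf : Function.Injective f) (J : Twist k A) :
    Function.Injective (Twisted.map f J) := hf

namespace DrinfeldDouble

variable {k : Type*} {H : Type*} [Field k] [Ring H] [HopfAlgebra k H] [FiniteDimensional k H]

theorem inclAlg_injective : Function.Injective (inclAlg k H) := by
  have h : Function.LeftInverse
      ((TensorProduct.lid k H).toLinearMap ∘ₗ (counit (R := k) (A := DualCop k H)).rTensor H :
        DualCop k H ⊗[k] H →ₗ[k] H) (TensorProduct.mk k (DualCop k H) H 1) := fun x => by simp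
  exact h.injective

variable (k H) in
theorem finrank_eq : Module.finrank k (DrinfeldDouble k H) =
    Module.finrank k H * Module.finrank k H := by
  change Module.finrank k (DualCop k H ⊗[k] H) = _
  rw [Module.finrank_tensorProduct, (DualCop.toDual k H).finrank_eq, Subspace.dual_finrank_eq]

variable (k H) in
/-- The `R`-matrix of the double as an element of `H ⊗ D(H)`. -/
noncomputable def rMatrixHalf : H ⊗[k] DrinfeldDouble k H :=
  ∑ j, Module.finBasis k H j ⊗ₜ[k] inclDualAlg k H (dualVec k H j)

theorem contract_rMatrixHalf (p : DualCop k H) :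
    contract (DualCop.toDual k H p) (rMatrixHalf k H) = inclDualAlg k H p := by
  simp only [rMatrixHalf, map_sum, contract_tmul]
  simp only [← map_smul, ← map_sum, sum_smul_dualVec]

variable (J : Twist k H)

/-- `x ⊗ y ↦ x ⊗ (ε ⊗ y)`. -/
noncomputable def pushRight (k H : Type*) [Field k] [Ring H] [HopfAlgebra k H]
    [FiniteDimensional k H] : H ⊗[k] H →ₐ[k] H ⊗[k] DrinfeldDouble k H :=
  Algebra.TensorProduct.map (AlgHom.id k H) (inclAlg k H)

/-- The twisted `R`-matrix `J₂₁⁻¹ R J` of the double as an element of `H ⊗ D(H)`. -/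
noncomputable def twistedHalf : H ⊗[k] DrinfeldDouble k H :=
  pushRight k H (flip k H ↑J.val⁻¹) * rMatrixHalf k H * pushRight k H J.val

theorem rMatrixHalf_eq : rMatrixHalf k H =
    pushRight k H (flip k H J.val) * twistedHalf J * pushRight k H ↑J.val⁻¹ := by
  have h1 : pushRight k H (flip k H J.val) * pushRight k H (flip k H ↑J.val⁻¹) = 1 := by
    rw [← map_mul, ← map_mul, Units.mul_inv, map_one, map_one]
  have h2 : pushRight k H J.val * pushRight k H ↑J.val⁻¹ = 1 := by
    rw [← map_mul, Units.mul_inv, map_one]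
  rw [twistedHalf]
  simp only [mul_assoc]
  rw [h2, mul_one, ← mul_assoc, h1, one_mul]

theorem map_twistedHalf : Algebra.TensorProduct.map (inclAlg k H)
      (AlgHom.id k (DrinfeldDouble k H)) (twistedHalf J) =
    flip k _ ↑(J.map (incl k H)).val⁻¹ * rMatrix k H *
      ((J.map (incl k H)).val : DrinfeldDouble k H ⊗[k] DrinfeldDouble k H) := by
  have h1 : ∀ t, Algebra.TensorProduct.map (inclAlg k H) (AlgHom.id k (DrinfeldDouble k H))
      (pushRight k H t) = Algebra.TensorProduct.map (inclAlg k H) (inclAlg k H) t := by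
    intro t
    induction t with
    | zero => simp
    | add u v hu hv => simp only [map_add, hu, hv]
    | tmul a b => simp [pushRight]
  have h2 : ∀ t, flip k _ (Algebra.TensorProduct.map (inclAlg k H) (inclAlg k H) t) =
      Algebra.TensorProduct.map (inclAlg k H) (inclAlg k H) (flip k H t) := by
    intro t
    induction t with
    | zero => simp
    | add u v hu hv => simp only [map_add, hu, hv]
    | tmul a b => simp
  have e1 : (↑(J.map (incl k H)).val⁻¹ : DrinfeldDouble k H ⊗[k] DrinfeldDouble k H) =
      Algebra.TensorProduct.map (inclAlg k H) (inclAlg k H) ↑J.val⁻¹ := rfl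
  have e2 : (↑(J.map (incl k H)).val : DrinfeldDouble k H ⊗[k] DrinfeldDouble k H) =
      Algebra.TensorProduct.map (inclAlg k H) (inclAlg k H) ↑J.val := rfl
  rw [twistedHalf, map_mul, map_mul, h1, h1, e1, e2, h2, rMatrixHalf, map_sum, rMatrix_eq_sum]
  simp only [Algebra.TensorProduct.map_tmul, AlgHom.id_apply]

/-- The inclusion `H^J → D(H)^J`. -/
noncomputable abbrev inclTwisted : Twisted J →ₐc[k] Twisted (J.map (incl k H)) :=
  Twisted.map (incl k H) J

/-- The element `twistedHalf J`, regarded as an element of `H^J ⊗ D(H)^J`. -/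
noncomputable def rMatrixTwisted : Twisted J ⊗[k] Twisted (J.map (incl k H)) :=
  twistedHalf (H := H) J

theorem pushLeft_rMatrixTwisted : pushLeft (inclTwisted J) (rMatrixTwisted J) =
    Twisted.rMatrix (J.map (incl k H)) (rMatrix k H) :=
  (map_twistedHalf J).trans (Twisted.rMatrix_eq (J.map (incl k H)) (rMatrix k H)).symm

theorem isQuasitriangular_pushLeft_rMatrixTwisted :
    IsQuasitriangular k (pushLeft (inclTwisted J) (rMatrixTwisted J)) := by
  rw [pushLeft_rMatrixTwisted]
  exact isQuasitriangular_rMatrix.twisted _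

theorem inclTwisted_injective : Function.Injective (inclTwisted J) :=
  Twisted.map_injective (f := incl k H) inclAlg_injective J

/-- The homomorphism `D(H^J) → D(H)^J` that is the inclusion on `H^J` and `p ↦ (p ⊗ I)(R^J)` on
the dual of `H^J`. -/
noncomputable def twistHom :
    DrinfeldDouble k (Twisted J) →ₐc[k] Twisted (J.map (incl k H)) :=
  doubleLiftBialgHom (inclTwisted_injective J) (isQuasitriangular_pushLeft_rMatrixTwisted J)

/-- `twistHom J` as a homomorphism of algebras into `D(H)`. -/
noncomputable def twistAlgHom : DrinfeldDouble k (Twisted J) →ₐ[k] DrinfeldDouble k H :=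
  (Twisted.of (J.map (incl k H))).symm.toAlgHom.comp
    (doubleLiftAlgHom (inclTwisted_injective J) (isQuasitriangular_pushLeft_rMatrixTwisted J))

theorem twistAlgHom_inclAlg (x : H) :
    twistAlgHom J (inclAlg k (Twisted J) (Twisted.of J x)) = inclAlg k H x :=
  doubleLiftAlgHom_inclAlg (inclTwisted_injective J) (isQuasitriangular_pushLeft_rMatrixTwisted J) _

/-- `I ⊗ F : H ⊗ D(H^J) → H ⊗ D(H)` for the homomorphism `F : D(H^J) → D(H)`. -/
noncomputable def idTwist :
    H ⊗[k] DrinfeldDouble k (Twisted J) →ₐ[k] H ⊗[k] DrinfeldDouble k H :=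
  Algebra.TensorProduct.map (AlgHom.id k H) (twistAlgHom J)

theorem pushRight_mem_range (t : H ⊗[k] H) : pushRight k H t ∈ (idTwist J).range := by
  induction t with
  | zero => simp
  | add u v hu hv => rw [map_add]; exact add_mem hu hv
  | tmul a b =>
    exact ⟨a ⊗ₜ inclAlg k (Twisted J) (Twisted.of J b),
      congrArg (fun y => a ⊗ₜ[k] y) (twistAlgHom_inclAlg J b)⟩

/-- `J₂₁⁻¹ R J = ∑ eⱼ ⊗ F(eʲ)`. -/
theorem twistedHalf_mem_range : twistedHalf J ∈ (idTwist J).range := by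
  have h := sum_tmul_dualHom (rMatrixTwisted J)
  refine ⟨∑ j, (Twisted.of J).symm (Module.finBasis k (Twisted J) j) ⊗ₜ[k]
    inclDualAlg k (Twisted J) (dualVec k (Twisted J) j), ?_⟩
  refine Eq.trans ?_ (h : _ = twistedHalf (H := H) J)
  refine (map_sum (idTwist J) _ _).trans (Finset.sum_congr rfl fun j _ => ?_)
  exact congrArg (fun y => (Twisted.of J).symm (Module.finBasis k (Twisted J) j) ⊗ₜ[k] y)
    (doubleLiftAlgHom_inclDualAlg (inclTwisted_injective J)
      (isQuasitriangular_pushLeft_rMatrixTwisted J) _)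

theorem contract_idTwist (p : Module.Dual k H) (t : H ⊗[k] DrinfeldDouble k (Twisted J)) :
    contract p (idTwist J t) = twistAlgHom J (contract p t) := by
  induction t with
  | zero => simp
  | add u v hu hv => simp only [map_add, hu, hv]
  | tmul a b => simp [idTwist]

/-- The image of `D(H^J) → D(H)` contains `H` and the right leg of `R^J`, hence the right
leg of `J₂₁ R^J J⁻¹ = R`, which is `H^*`. -/
theorem twistAlgHom_surjective : Function.Surjective (twistAlgHom J) := by
  rw [← AlgHom.range_eq_top, eq_top_iff]
  rintro y -
  have h0 : rMatrixHalf k H ∈ (idTwist J).range := by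
    rw [rMatrixHalf_eq J]
    exact mul_mem (mul_mem (pushRight_mem_range J _) (twistedHalf_mem_range J))
      (pushRight_mem_range J _)
  obtain ⟨z, hz⟩ := h0
  induction y using induction_on with
  | h0 => exact zero_mem _
  | hadd u v hu hv => exact add_mem hu hv
  | hmk p x =>
    rw [mk_eq]
    refine mul_mem ⟨contract (DualCop.toDual k H p) z, ?_⟩ ⟨_, twistAlgHom_inclAlg J x⟩
    refine (contract_idTwist J _ z).symm.trans ?_
    exact (congrArg (contract (DualCop.toDual k H p)) hz).trans (contract_rMatrixHalf p)

theorem twistHom_bijective : Function.Bijective (twistHom J) := by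
  have hs := twistAlgHom_surjective J
  have hd : Module.finrank k (DrinfeldDouble k (Twisted J)) =
      Module.finrank k (DrinfeldDouble k H) := by
    rw [finrank_eq, finrank_eq, (Twisted.of J).toLinearEquiv.finrank_eq]
  have hi : Function.Injective (twistAlgHom J).toLinearMap :=
    (LinearMap.injective_iff_surjective_of_finrank_eq_finrank hd).mpr hs
  exact ⟨hi, hs⟩

end DrinfeldDouble

end QDouble

theorem proposition3p2 {k : Type*} {H : Type*} [Field k] [Ring H] [HopfAlgebra k H]
    [FiniteDimensional k H] (J : QDouble.Twist k H) :
    QDouble.IsQuasitriangular k (QDouble.DrinfeldDouble.rMatrix k (QDouble.Twisted J)) ∧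
    QDouble.IsQuasitriangular k
      (QDouble.Twisted.rMatrix (J.map (QDouble.DrinfeldDouble.incl k H))
        (QDouble.DrinfeldDouble.rMatrix k H)) ∧
    QDouble.QuasitriangularIso k
      (QDouble.DrinfeldDouble.rMatrix k (QDouble.Twisted J))
      (QDouble.Twisted.rMatrix (J.map (QDouble.DrinfeldDouble.incl k H))
        (QDouble.DrinfeldDouble.rMatrix k H)) := by
  refine ⟨QDouble.DrinfeldDouble.isQuasitriangular_rMatrix,
    QDouble.DrinfeldDouble.isQuasitriangular_rMatrix.twisted _,
    BialgEquiv.ofBijective _ (QDouble.DrinfeldDouble.twistHom_bijective J),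
    fun x => QDouble.map_antipode (QDouble.DrinfeldDouble.twistHom J) x, ?_⟩
  rw [← QDouble.DrinfeldDouble.pushLeft_rMatrixTwisted]
  exact QDouble.map_doubleLiftAlgHom_rMatrix (QDouble.DrinfeldDouble.inclTwisted_injective J)
    (QDouble.DrinfeldDouble.isQuasitriangular_pushLeft_rMatrixTwisted J)
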